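/- Let $\Gamma=D^*_{x^3}$ be the class-two torsion-free nilpotent group of Hirsch length $8$ generated by $x_1,x_2,x_3,y_1,y_2,y_3,e,f$, where $e,f$ are central and the commutators of the remaining generators are $$[x_i,x_j]=[y_i,y_j]=1,\qquad [x_i,y_j]=e^{\delta_{ij}}f^{K_{ij}},\qquad K=\begin{pmatrix}0&1&0\\0&0&1\\0&0&0\end{pmatrix}$$ ($K$ is the companion matrix of $x^3$; the relations say that $[x_i,y_i]=e$ for $i=1,2,3$, $[x_1,y_2]=[x_2,y_3]=f$, and all other $[x_i,y_j]$ are trivial). For $n\ge 1$ let $a_n^\wedge(\Gamma)$ be the number of subgroups $\Delta\le\Gamma$ of index $n$ with $\widehat\Delta\cong\widehat\Gamma$ (profinite completions), and for a prime $p$ let $\zeta^\wedge_{\Gamma,p}(s)=\sum_{k\ge 0}a^\wedge_{p^k}(\Gamma)\,p^{-ks}$ be the local pro-isomorphic zeta function. Put $$W(X,T)=\frac{(1-X^{29}T^{10})\,(1+X^{14}T^{5}+X^{29}T^{10}+X^{45}T^{15}-X^{59}T^{21}-X^{75}T^{26}-X^{90}T^{31}-X^{104}T^{36})}{(1-X^{15}T^{5})(1-X^{29}T^{9})(1-X^{30}T^{11})(1-X^{30}T^{10})(1-X^{61}T^{21})}.$$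 Then for every prime $p>2$ the series $\zeta^\wedge_{\Gamma,p}(s)$ converges for all complex $s$ with $\operatorname{Re}(s)>29/9$, and there $$\zeta^\wedge_{\Gamma,p}(s)=W(p,p^{-s})=\frac{(1-p^{29-10s})(-p^{104-36s}-p^{90-31s}-p^{75-26s}-p^{59-21s}+p^{45-15s}+p^{29-10s}+p^{14-5s}+1)}{(1-p^{15-5s})(1-p^{29-9s})(1-p^{30-11s})(1-p^{30-10s})(1-p^{61-21s})}.$$ Moreover $W(X^{-1},T^{-1})=-X^{32}T^{10}\,W(X,T)$, i.e. $\zeta^\wedge_{\Gamma,p}$ satisfies the functional equation $$\zeta^\wedge_{\Gamma,p}(s)\big|_{p\to p^{-1}}=-p^{32-10s}\,\zeta^\wedge_{\Gamma,p}(s).$$ -/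

import Mathlib

open scoped Matrix

/-- The companion matrix of the monic polynomial `X ^ m - ∑ j, c j * X ^ j`: ones on the
superdiagonal and last row `(c 0, …, c (m - 1))`. -/
def companionMatrix (m : ℕ) (c : Fin m → ℤ) : Matrix (Fin m) (Fin m) ℤ :=
  Matrix.of fun i j =>
    (if (i : ℕ) + 1 = j then 1 else 0) + (if (i : ℕ) + 1 = m then c j else 0)

/-- Elements of the `D*`-group attached to an integer matrix `K`, in normal form:
`⟨a, b, u, v⟩` stands for `y₁ ^ b₁ ⋯ yₘ ^ bₘ * x₁ ^ a₁ ⋯ xₘ ^ aₘ * e ^ u * f ^ v`. -/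
@[ext]
structure DStar {m : ℕ} (K : Matrix (Fin m) (Fin m) ℤ) where
  /-- exponents of the generators `x₁, …, xₘ` -/
  x : Fin m → ℤ
  /-- exponents of the generators `y₁, …, yₘ` -/
  y : Fin m → ℤ
  /-- exponent of the central generator `e` -/
  e : ℤ
  /-- exponent of the central generator `f` -/
  f : ℤ

namespace DStar

open scoped commutatorElement

variable {m : ℕ} {K : Matrix (Fin m) (Fin m) ℤ}

instance : One (DStar K) := ⟨⟨0, 0, 0, 0⟩⟩

instance : Mul (DStar K) :=
  ⟨fun g h => ⟨g.x + h.x, g.y + h.y, g.e + h.e + g.x ⬝ᵥ h.y, g.f + h.f + g.x ⬝ᵥ (K *ᵥ h.y)⟩⟩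

instance : Inv (DStar K) :=
  ⟨fun g => ⟨-g.x, -g.y, -g.e + g.x ⬝ᵥ g.y, -g.f + g.x ⬝ᵥ (K *ᵥ g.y)⟩⟩

theorem one_def : (1 : DStar K) = ⟨0, 0, 0, 0⟩ := rfl

theorem mul_def (g h : DStar K) : g * h =
    ⟨g.x + h.x, g.y + h.y, g.e + h.e + g.x ⬝ᵥ h.y, g.f + h.f + g.x ⬝ᵥ (K *ᵥ h.y)⟩ := rfl

theorem inv_def (g : DStar K) : g⁻¹ =
    ⟨-g.x, -g.y, -g.e + g.x ⬝ᵥ g.y, -g.f + g.x ⬝ᵥ (K *ᵥ g.y)⟩ := rfl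

/-- The class-two group with the relations `[xᵢ, yⱼ] = e ^ δᵢⱼ * f ^ Kᵢⱼ`, all other commutators
of the generators being trivial; see `commutator_genX_genY` and the facts after it. -/
instance : Group (DStar K) :=
  Group.ofLeftAxioms
    (by
      intro a b c
      ext <;> simp [mul_def, Matrix.mulVec_add, add_assoc] <;> ring)
    (by intro a; ext <;> simp [mul_def, one_def])
    (by intro a; ext <;> simp [mul_def, one_def, inv_def])

/-- The generator `xᵢ`. -/
def genX (i : Fin m) : DStar K := ⟨Pi.single i 1, 0, 0, 0⟩

/-- The generator `yⱼ`. -/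
def genY (j : Fin m) : DStar K := ⟨0, Pi.single j 1, 0, 0⟩

/-- The generator `e`. -/
def genE : DStar K := ⟨0, 0, 1, 0⟩

/-- The generator `f`. -/
def genF : DStar K := ⟨0, 0, 0, 1⟩

theorem commutator_eq (g h : DStar K) : ⁅g, h⁆ =
    ⟨0, 0, g.x ⬝ᵥ h.y - h.x ⬝ᵥ g.y, g.x ⬝ᵥ (K *ᵥ h.y) - h.x ⬝ᵥ (K *ᵥ g.y)⟩ := by
  rw [commutatorElement_def]
  ext <;> simp [mul_def, inv_def, Matrix.mulVec_neg] <;> ring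

theorem genE_zpow (n : ℤ) : (genE : DStar K) ^ n = ⟨0, 0, n, 0⟩ := by
  have key : ∀ k : ℕ, (genE : DStar K) ^ k = ⟨0, 0, k, 0⟩ := by
    intro k
    induction k with
    | zero => rfl
    | succ k ih => rw [pow_succ, ih]; ext <;> simp [mul_def, genE]
  obtain ⟨k, rfl | rfl⟩ := n.eq_nat_or_neg
  · rw [zpow_natCast, key]
  · rw [zpow_neg, zpow_natCast, key]; ext <;> simp [inv_def]

theorem genF_zpow (n : ℤ) : (genF : DStar K) ^ n = ⟨0, 0, 0, n⟩ := by
  have key : ∀ k : ℕ, (genF : DStar K) ^ k = ⟨0, 0, 0, k⟩ := by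
    intro k
    induction k with
    | zero => rfl
    | succ k ih => rw [pow_succ, ih]; ext <;> simp [mul_def, genF]
  obtain ⟨k, rfl | rfl⟩ := n.eq_nat_or_neg
  · rw [zpow_natCast, key]
  · rw [zpow_neg, zpow_natCast, key]; ext <;> simp [inv_def]

theorem commutator_genX_genY (i j : Fin m) :
    ⁅(genX i : DStar K), (genY j : DStar K)⁆ = genE ^ (if i = j then (1 : ℤ) else 0) * genF ^ (K i j) := by
  rw [commutator_eq, genE_zpow, genF_zpow]
  ext <;> simp [mul_def, genX, genY, Pi.single_apply, eq_comm]

theorem commutator_genX_genX (i j : Fin m) : ⁅(genX i : DStar K), (genX j : DStar K)⁆ = 1 := by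
  rw [commutator_eq]; simp [genX, one_def]

theorem commutator_genY_genY (i j : Fin m) : ⁅(genY i : DStar K), (genY j : DStar K)⁆ = 1 := by
  rw [commutator_eq]; simp [genY, one_def]

theorem commutator_genE (g : DStar K) : ⁅(genE : DStar K), g⁆ = 1 := by
  rw [commutator_eq]; simp [genE, one_def]

theorem commutator_genF (g : DStar K) : ⁅(genF : DStar K), g⁆ = 1 := by
  rw [commutator_eq]; simp [genF, one_def]

end DStar

/-- The group `D*_{x^3}`: generators `x₁, x₂, x₃, y₁, y₂, y₃, e, f`, with `e`, `f` central and
`[xᵢ, yᵢ] = e`, `[x₁, y₂] = [x₂, y₃] = f` the only non-trivial commutators of generators. -/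
abbrev DStarCube : Type := DStar (companionMatrix 3 0)

theorem companionMatrix_three_zero :
    companionMatrix 3 0 = !![0, 1, 0; 0, 0, 1; 0, 0, 0] := by
  decide

/-- `proIsoCount Γ n` is the number of subgroups of index `n` in `Γ` whose profinite completion is
isomorphic, as a topological group, to the profinite completion of `Γ`. -/
noncomputable def proIsoCount (Γ : Type) [Group Γ] (n : ℕ) : ℕ :=
  Nat.card {Δ : Subgroup Γ // Δ.index = n ∧
    Nonempty (ProfiniteGrp.ProfiniteCompletion.completion (GrpCat.of Δ) ≃ₜ*
      ProfiniteGrp.ProfiniteCompletion.completion (GrpCat.of Γ))}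

/-- The explicit rational function in two variables; `x` is to be `p` and `t` is to be `p ^ (-s)`,
so that `x ^ a * t ^ b` is `p ^ (a - b s)`. -/
noncomputable def zetaCube (x t : ℂ) : ℂ :=
  ((1 - x ^ 29 * t ^ 10) *
      (-(x ^ 104 * t ^ 36) - x ^ 90 * t ^ 31 - x ^ 75 * t ^ 26 - x ^ 59 * t ^ 21
        + x ^ 45 * t ^ 15 + x ^ 29 * t ^ 10 + x ^ 14 * t ^ 5 + 1)) /
    ((1 - x ^ 15 * t ^ 5) * (1 - x ^ 29 * t ^ 9) * (1 - x ^ 30 * t ^ 11) *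
      (1 - x ^ 30 * t ^ 10) * (1 - x ^ 61 * t ^ 21))

/-! Put A = ℤ[t]/t³ and read the six non-central coordinates as the pair (z₀ + z₂t + z₄t², z₁ + z₃t
+ z₅t²) in A². The pair (z₂ᵢ, z₂ᵢ₊₁) is level i. The two components B₁, B₂ of the commutator form
are the coefficients of t and t² in the 2×2 determinant over A. Hence B₂(tz, w) = B₁(z, w), and
determinant-one matrices preserve both components.

A subgroup Δ has an image L modulo the centre and a central part M. If Δ has p-power index and the
completion of the whole group, it maps onto Hei(𝔽_p), so (L, M) reduces modulo p onto the standard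
pair. Nondegeneracy modulo p then provides a rescaled multiplication by t, an operator T on L itself
(`nonempty_shiftData`), and T(L) consists of all vectors of L that vanish in level 0
(`ShiftData.exists_eq_T`). After a rotation in SL₂(ℤ) that diagonalizes the level-0 projection, L
acquires a basis v, w, Tv, Tw, T²v, T²w on which v and w pair to zero: a frame
(`ShiftData.exists_frame`). Conversely a valid frame carries the standard pair onto (L, M)
compatibly with the forms, and this lifts to an isomorphism of the whole group onto Δ
(`Hei.nonempty_mulEquiv`). So the subgroups to be counted are exactly those with a frame.

Reduced frames, together with points of the projective line over ℤ/p^d, enumerate the pairs (L, M)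
without repetition (`Frame.eq_of_rot_range_eq`), and over each pair lie [ℤ² : M]⁶ subgroups
(`Hei.card_fiber`). The existence of a frame with given level-1 entries A, B, C comes down to
divisibility of p^d A² + BC by p^r₀, together with powers of p dividing B and C. Sorting by gcd(B,
pⁿ) counts the solutions (`sum_card_dvd_sq`). What remains is a sum of geometric series with one
factor p^(-⌈(l + 2μ - d)/2⌉), evaluated by splitting according to order and parity
(`hasSum_kernel`), and a rational identity (`planeSum_add`). -/

/-! ### The group over a general ring, in coordinates sorted by level. -/

/-- The cocycle of `Hei`: the coordinates `0, …, 5` stand for the generators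
`x₁, y₃, x₂, y₂, x₃, y₁`. -/
def heiCocycle {R : Type} [CommRing R] (z w : Fin 6 → R) : R × R :=
  (z 0 * w 3 + z 2 * w 1, z 0 * w 5 + z 2 * w 3 + z 4 * w 1)

/-- The commutator form of `Hei`. -/
def heiForm {R : Type} [CommRing R] (z w : Fin 6 → R) : R × R :=
  heiCocycle z w - heiCocycle w z

/-- The `R`-points of the group scheme underlying `DStarCube`, with the central part separated:
`c.1` is the exponent of `f` and `c.2` that of `e`. -/
@[ext]
structure Hei (R : Type) where
  /-- coordinates modulo the centre -/
  z : Fin 6 → R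
  /-- central coordinates -/
  c : R × R

namespace Hei

variable {R : Type} [CommRing R]

instance : One (Hei R) := ⟨⟨0, 0⟩⟩

instance : Mul (Hei R) := ⟨fun g h => ⟨g.z + h.z, g.c + h.c + heiCocycle g.z h.z⟩⟩

instance : Inv (Hei R) := ⟨fun g => ⟨-g.z, -g.c + heiCocycle g.z g.z⟩⟩

@[simp] theorem one_z : (1 : Hei R).z = 0 := rfl
@[simp] theorem one_c : (1 : Hei R).c = 0 := rfl
@[simp] theorem mul_z (g h : Hei R) : (g * h).z = g.z + h.z := rfl
@[simp] theorem mul_c (g h : Hei R) : (g * h).c = g.c + h.c + heiCocycle g.z h.z := rfl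
@[simp] theorem inv_z (g : Hei R) : g⁻¹.z = -g.z := rfl
@[simp] theorem inv_c (g : Hei R) : g⁻¹.c = -g.c + heiCocycle g.z g.z := rfl

end Hei

section Cocycle

variable {R : Type} [CommRing R] (z z' w w' : Fin 6 → R)

theorem heiCocycle_add_left : heiCocycle (z + z') w = heiCocycle z w + heiCocycle z' w := by
  ext <;> simp [heiCocycle] <;> ring

theorem heiCocycle_add_right : heiCocycle z (w + w') = heiCocycle z w + heiCocycle z w' := by
  ext <;> simp [heiCocycle] <;> ring

@[simp] theorem heiCocycle_zero_left : heiCocycle 0 w = 0 := by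
  ext <;> simp [heiCocycle]

@[simp] theorem heiCocycle_zero_right : heiCocycle z 0 = 0 := by
  ext <;> simp [heiCocycle]

@[simp] theorem heiCocycle_neg_left : heiCocycle (-z) w = -heiCocycle z w := by
  ext <;> simp [heiCocycle] <;> ring

theorem heiForm_add_left : heiForm (z + z') w = heiForm z w + heiForm z' w := by
  simp only [heiForm, heiCocycle_add_left, heiCocycle_add_right]; abel

theorem heiForm_fst :
    (heiForm z w).1 = z 0 * w 3 - z 1 * w 2 + z 2 * w 1 - z 3 * w 0 := by
  simp [heiForm, heiCocycle]; ring

theorem heiForm_snd : (heiForm z w).2 =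
    z 0 * w 5 - z 1 * w 4 + z 2 * w 3 - z 3 * w 2 + z 4 * w 1 - z 5 * w 0 := by
  simp [heiForm, heiCocycle]; ring

end Cocycle

namespace Hei

variable {R : Type} [CommRing R]

instance : Group (Hei R) :=
  Group.ofLeftAxioms
    (by
      intro a b c
      ext1
      · simp [add_assoc]
      · simp only [mul_c, mul_z, heiCocycle_add_left, heiCocycle_add_right]; abel)
    (by intro a; ext1 <;> simp)
    (by intro a; ext1 <;> simp)

instance [Finite R] : Finite (Hei R) :=
  Finite.of_injective (fun g : Hei R => (g.z, g.c)) (by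
    intro g h hgh
    simp only [Prod.mk.injEq] at hgh
    exact Hei.ext hgh.1 hgh.2)

/-- Reduction of the integral points. -/
def cast (R : Type) [CommRing R] : Hei ℤ →* Hei R where
  toFun g := ⟨fun i => (g.z i : R), ((g.c.1 : R), (g.c.2 : R))⟩
  map_one' := by ext <;> simp
  map_mul' g h := by ext <;> simp [heiCocycle]

theorem cast_surjective (n : ℕ) : Function.Surjective (cast (ZMod n)) := by
  intro g
  refine ⟨⟨fun i => (ZMod.intCast_surjective (g.z i)).choose,
    ((ZMod.intCast_surjective g.c.1).choose, (ZMod.intCast_surjective g.c.2).choose)⟩, ?_⟩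
  ext
  · exact (ZMod.intCast_surjective _).choose_spec
  · exact (ZMod.intCast_surjective _).choose_spec
  · exact (ZMod.intCast_surjective _).choose_spec

/-- `DStarCube` in the coordinates of `Hei`. -/
def ofDStarCube : DStarCube ≃* Hei ℤ where
  toFun g := ⟨![g.x 0, g.y 2, g.x 1, g.y 1, g.x 2, g.y 0], (g.f, g.e)⟩
  invFun h := ⟨![h.z 0, h.z 2, h.z 4], ![h.z 5, h.z 3, h.z 1], h.c.2, h.c.1⟩
  left_inv g := by
    ext i
    · fin_cases i <;> rfl
    · fin_cases i <;> rfl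
    · rfl
    · rfl
  right_inv h := by
    ext i
    · fin_cases i <;> rfl
    · rfl
    · rfl
  map_mul' g h := by
    ext i
    · fin_cases i <;> rfl
    · simp [DStar.mul_def, heiCocycle, companionMatrix_three_zero, dotProduct, Matrix.mulVec,
        Fin.sum_univ_three]
    · simp [DStar.mul_def, heiCocycle, dotProduct, Fin.sum_univ_three]

end Hei

/-! ### Profinite completions and finite quotients. -/

section Profinite

open CategoryTheory ProfiniteGrp

theorem nonempty_continuousMulEquiv_of_iso {A B : ProfiniteGrp.{0}} (i : A ≅ B) :
    Nonempty (A ≃ₜ* B) :=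
  ⟨ContinuousMulEquiv.mk
    ⟨⟨i.hom, i.inv, fun x => ConcreteCategory.congr_hom i.hom_inv_id x,
      fun x => ConcreteCategory.congr_hom i.inv_hom_id x⟩, fun x y => map_mul i.hom.hom x y⟩
    i.hom.hom.continuous_toFun i.inv.hom.continuous_toFun⟩

/-- Isomorphic groups have isomorphic profinite completions. -/
theorem nonempty_completion_congr {G H : Type} [Group G] [Group H] (e : G ≃* H) :
    Nonempty (ProfiniteCompletion.completion (GrpCat.of G) ≃ₜ*
      ProfiniteCompletion.completion (GrpCat.of H)) :=
  nonempty_continuousMulEquiv_of_iso (profiniteCompletion.mapIso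
    (MulEquiv.toGrpIso (X := GrpCat.of G) (Y := GrpCat.of H) e))

/-- A finite quotient of a group is a quotient of every group with the same profinite
completion. -/
theorem exists_surjective_of_completion {G H Q : Type} [Group G] [Group H] [Group Q] [Finite Q]
    (e : ProfiniteCompletion.completion (GrpCat.of G) ≃ₜ*
      ProfiniteCompletion.completion (GrpCat.of H))
    (f : H →* Q) (hf : Function.Surjective f) :
    ∃ g : G →* Q, Function.Surjective g := by
  let P : ProfiniteGrp := ofFiniteGrp (FiniteGrp.of Q)
  let F : GrpCat.of H ⟶ GrpCat.of P := GrpCat.ofHom f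
  let l := ProfiniteCompletion.lift F
  have hl : ∀ h : H, l (ProfiniteCompletion.etaFn (GrpCat.of H) h) = f h := fun h =>
    ConcreteCategory.congr_hom (ProfiniteCompletion.lift_eta F) h
  let k : G →* Q :=
    ((l.hom.toMonoidHom.comp e.toMulEquiv.toMonoidHom).comp
      (ProfiniteCompletion.eta (GrpCat.of G)).hom : G →* P)
  refine ⟨k, fun q => ?_⟩
  obtain ⟨h, rfl⟩ := hf q
  -- The composite of `e` with the lift of `f` is continuous into a discrete group, so each fibre is
  -- open and, being nonempty, meets the dense image of G.
  let U : Set (ProfiniteCompletion.completion (GrpCat.of G)) :=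
    {x | l (e x) = (f h : P)}
  have hU : IsOpen U := by
    have hd : IsOpen ({(f h : P)} : Set P) := by
      have : DiscreteTopology P := ⟨rfl⟩
      exact isOpen_discrete _
    exact hd.preimage (l.hom.continuous_toFun.comp e.continuous_toFun)
  have hne : U.Nonempty := by
    refine ⟨e.symm (ProfiniteCompletion.etaFn (GrpCat.of H) h), ?_⟩
    change l (e (e.symm _)) = _
    rw [e.apply_symm_apply]
    exact hl h
  obtain ⟨g, hg⟩ := (ProfiniteCompletion.denseRange (GrpCat.of G)).exists_mem_open hU hne
  exact ⟨g, hg⟩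

/-- `proIsoCount` depends only on the isomorphism class of the group. -/
theorem proIsoCount_congr {G H : Type} [Group G] [Group H] (e : G ≃* H) (n : ℕ) :
    proIsoCount G n = proIsoCount H n := by
  obtain ⟨eh⟩ := nonempty_completion_congr e
  refine Nat.card_congr ((e.mapSubgroup.toEquiv).subtypeEquiv fun Δ => ?_)
  obtain ⟨ed⟩ := nonempty_completion_congr (e.subgroupMap Δ)
  refine and_congr ?_ ⟨fun ⟨a⟩ => ⟨(ed.symm.trans a).trans eh⟩,
    fun ⟨a⟩ => ⟨(ed.trans a).trans eh.symm⟩⟩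
  change _ ↔ (Δ.map e.toMonoidHom).index = n
  rw [show (Δ.map e.toMonoidHom).index = Δ.index from Subgroup.index_map_equiv Δ e]

end Profinite

/-! ### Subgroups seen through their image modulo the centre and their central part. -/

namespace Hei

variable {R : Type} [CommRing R]

/-- Projection modulo the centre. -/
def zHom (R : Type) [CommRing R] : Hei R →* Multiplicative (Fin 6 → R) where
  toFun g := Multiplicative.ofAdd g.z
  map_one' := rfl
  map_mul' _ _ := rfl

/-- Inclusion of the central coordinates. -/
def cHom (R : Type) [CommRing R] : Multiplicative (R × R) →* Hei R where
  toFun u := ⟨0, u.toAdd⟩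
  map_one' := rfl
  map_mul' u v := by ext1 <;> simp

/-- The image of a subgroup modulo the centre. -/
def zSub (Δ : Subgroup (Hei R)) : AddSubgroup (Fin 6 → R) :=
  Subgroup.toAddSubgroup' (Δ.map (zHom R))

/-- The central coordinates of the central elements of a subgroup. -/
def cSub (Δ : Subgroup (Hei R)) : AddSubgroup (R × R) :=
  Subgroup.toAddSubgroup' (Δ.comap (cHom R))

theorem mem_zSub {Δ : Subgroup (Hei R)} {l : Fin 6 → R} : l ∈ zSub Δ ↔ ∃ g ∈ Δ, g.z = l :=
  Iff.rfl

theorem mem_cSub {Δ : Subgroup (Hei R)} {u : R × R} : u ∈ cSub Δ ↔ (⟨0, u⟩ : Hei R) ∈ Δ :=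
  Iff.rfl

theorem range_cHom : (cHom R).range = (zHom R).ker := by
  ext g
  constructor
  · rintro ⟨u, rfl⟩; rfl
  · intro h
    exact ⟨Multiplicative.ofAdd g.c, Hei.ext (Eq.symm h) rfl⟩

theorem mk_zero_mul (u : R × R) (g : Hei R) : (⟨0, u⟩ : Hei R) * g = g * ⟨0, u⟩ := by
  ext1 <;> simp [add_comm]

theorem ker_le_normalizer (Δ : Subgroup (Hei R)) :
    (zHom R).ker ≤ Subgroup.normalizer (Δ : Set (Hei R)) := by
  rw [← range_cHom]
  rintro _ ⟨u, rfl⟩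
  rw [Subgroup.mem_normalizer_iff]
  intro h
  rw [show cHom R u * h = h * cHom R u from mk_zero_mul _ _, mul_inv_cancel_right]

/-- The centre normalizes Δ, so the index splits along Δ ≤ Δ·ker ≤ G, and the lower step is the
index of the central part by the second isomorphism theorem. -/
theorem index_eq (Δ : Subgroup (Hei R)) : Δ.index = (zSub Δ).index * (cSub Δ).index := by
  have h1 : (zSub Δ).index = (Δ ⊔ (zHom R).ker).index := by
    change (Δ.map (zHom R)).index = _
    rw [Subgroup.index_map, MonoidHom.range_eq_top.2, Subgroup.index_top, mul_one]
    exact fun l => ⟨⟨l, 0⟩, rfl⟩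
  have h2 : (cSub Δ).index = Δ.relIndex (Δ ⊔ (zHom R).ker) := by
    change (Δ.comap (cHom R)).index = _
    rw [Subgroup.index_comap, range_cHom, sup_comm]
    let _ := Subgroup.normal_subgroupOf_of_le_normalizer (ker_le_normalizer Δ)
    let _ := Subgroup.normal_subgroupOf_sup_of_le_normalizer (ker_le_normalizer Δ)
    exact Nat.card_congr (QuotientGroup.quotientInfEquivProdNormalizerQuotient _ _
      (ker_le_normalizer Δ)).toEquiv
  rw [h1, h2, mul_comm, Subgroup.relIndex_mul_index le_sup_left]

theorem mul_comm_form (g h : Hei R) : g * h = h * g * ⟨0, heiForm g.z h.z⟩ := by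
  ext1
  · simp [add_comm]
  · simp [heiForm]; abel

theorem commute_iff {g h : Hei R} : Commute g h ↔ heiForm g.z h.z = 0 := by
  rw [commute_iff_eq, Hei.ext_iff, mul_z, mul_z, mul_c, mul_c, heiForm, sub_eq_zero, add_comm h.z,
    add_comm h.c]
  simp

theorem mk_zero_mul_mk_zero (u v : R × R) : (⟨0, u⟩ : Hei R) * ⟨0, v⟩ = ⟨0, u + v⟩ := by
  ext1 <;> simp

theorem zpow_z (g : Hei R) (n : ℤ) : (g ^ n).z = n • g.z :=
  congrArg Multiplicative.toAdd (map_zpow (zHom R) g n)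

theorem eq_mul_mk_zero {g h : Hei R} (e : g.z = h.z) :
    g = h * ⟨0, g.c - h.c⟩ := by
  ext1 <;> simp [e]

/-- An element of Δ' differs from an element of Δ with the same image by a central element of Δ',
which already lies in Δ. -/
theorem le_of_zSub_of_cSub {Δ Δ' : Subgroup (Hei R)} (h : Δ ≤ Δ') (hz : zSub Δ' ≤ zSub Δ)
    (hc : cSub Δ' ≤ cSub Δ) : Δ' ≤ Δ := by
  intro g hg
  obtain ⟨k, hk, hkz⟩ := mem_zSub.1 (hz (mem_zSub.2 ⟨g, hg, rfl⟩))
  have h1 := eq_mul_mk_zero hkz.symm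
  rw [h1]
  refine Δ.mul_mem hk (mem_cSub.1 (hc (mem_cSub.2 ?_)))
  have : (⟨0, g.c - k.c⟩ : Hei R) = k⁻¹ * g := by
    rw [eq_inv_mul_iff_mul_eq]; exact h1.symm
  rw [this]
  exact Δ'.mul_mem (Δ'.inv_mem (h hk)) hg

end Hei

/-! ### Lifting maps of lattices to the group, and subgroups over a given pair of lattices. -/

theorem commute_triple_zpow_add {G : Type} [Group G] {a b c : G} (hab : Commute a b)
    (hac : Commute a c) (hbc : Commute b c) (n n' k k' l l' : ℤ) :
    a ^ (n + n') * b ^ (k + k') * c ^ (l + l') =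
      (a ^ n * b ^ k * c ^ l) * (a ^ n' * b ^ k' * c ^ l') := by
  rw [zpow_add, zpow_add, zpow_add, (hab.zpow_zpow n' k).mul_mul_mul_comm,
    ((hac.zpow_zpow n' l).mul_left (hbc.zpow_zpow k' l)).mul_mul_mul_comm]

namespace Hei

variable {P : (Fin 6 → ℤ) →+ (Fin 6 → ℤ)} {m : ℤ × ℤ →+ ℤ × ℤ}

theorem map_eq_sum (P : (Fin 6 → ℤ) →+ (Fin 6 → ℤ)) (z : Fin 6 → ℤ) :
    P z = ∑ i, z i • P (Pi.single i 1) := by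
  conv_lhs => rw [← Finset.univ_sum_single z]
  rw [map_sum]
  refine Finset.sum_congr rfl fun i _ => ?_
  rw [← map_zsmul]
  congr 1
  ext j
  by_cases h : j = i
  · subst h; simp
  · simp [h]

/-- An additive map compatible with the commutator form lifts to an endomorphism of `Hei ℤ`, with
arbitrary lifts of the basis vectors. -/
theorem exists_hom (hB : ∀ z w, heiForm (P z) (P w) = m (heiForm z w)) (c : Fin 6 → ℤ × ℤ) :
    ∃ φ : Hei ℤ →* Hei ℤ, (∀ g, (φ g).z = P g.z) ∧ (∀ u, φ ⟨0, u⟩ = ⟨0, m u⟩) ∧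
      ∀ i, φ ⟨Pi.single i 1, 0⟩ = ⟨P (Pi.single i 1), c i⟩ := by
  set a : Fin 6 → Hei ℤ := fun i => ⟨P (Pi.single i 1), c i⟩ with ha
  have hcomm : ∀ i j, heiForm (Pi.single i 1 : Fin 6 → ℤ) (Pi.single j 1) = 0 →
      Commute (a i) (a j) := by
    intro i j h
    rw [commute_iff, ha]
    simp only [hB, h, map_zero]
  have c02 : Commute (a 0) (a 2) := hcomm 0 2 (by decide)
  have c04 : Commute (a 0) (a 4) := hcomm 0 4 (by decide)
  have c24 : Commute (a 2) (a 4) := hcomm 2 4 (by decide)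
  have c13 : Commute (a 1) (a 3) := hcomm 1 3 (by decide)
  have c15 : Commute (a 1) (a 5) := hcomm 1 5 (by decide)
  have c35 : Commute (a 3) (a 5) := hcomm 3 5 (by decide)
  -- The even coordinates belong to the x-generators and the odd ones to the y-generators. Each
  -- triple of images commutes, so X and Y are additive. The normal form Y · X · centre matches the
  -- cocycle, which pairs x on the left with y on the right.
  let X : (Fin 6 → ℤ) → Hei ℤ := fun z => a 0 ^ z 0 * a 2 ^ z 2 * a 4 ^ z 4
  let Y : (Fin 6 → ℤ) → Hei ℤ := fun z => a 1 ^ z 1 * a 3 ^ z 3 * a 5 ^ z 5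
  have hX : ∀ z w, X (z + w) = X z * X w := fun z w =>
    commute_triple_zpow_add c02 c04 c24 _ _ _ _ _ _
  have hY : ∀ z w, Y (z + w) = Y z * Y w := fun z w =>
    commute_triple_zpow_add c13 c15 c35 _ _ _ _ _ _
  have hXz : ∀ z, (X z).z = P ![z 0, 0, z 2, 0, z 4, 0] := by
    intro z
    rw [map_eq_sum P ![z 0, 0, z 2, 0, z 4, 0]]
    simp [X, zpow_z, ha, Fin.sum_univ_succ, add_assoc]
  have hYz : ∀ z, (Y z).z = P ![0, z 1, 0, z 3, 0, z 5] := by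
    intro z
    rw [map_eq_sum P ![0, z 1, 0, z 3, 0, z 5]]
    simp [Y, zpow_z, ha, Fin.sum_univ_succ, add_assoc]
  have hXY : ∀ z w, X z * Y w = Y w * X z * ⟨0, m (heiCocycle z w)⟩ := by
    intro z w
    rw [mul_comm_form, hXz, hYz, hB]
    congr 3
    simp [heiForm, heiCocycle]
  refine ⟨⟨⟨fun g => Y g.z * X g.z * ⟨0, m g.c⟩, ?_⟩, ?_⟩, ?_, ?_, ?_⟩
  · simp [X, Y]; rfl
  · intro g h
    simp only [mul_z, mul_c, hX, hY, map_add]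
    rw [← mk_zero_mul_mk_zero, ← mk_zero_mul_mk_zero]
    calc Y g.z * Y h.z * (X g.z * X h.z) *
          (⟨0, m g.c⟩ * ⟨0, m h.c⟩ * ⟨0, m (heiCocycle g.z h.z)⟩)
        = Y g.z * Y h.z * (X g.z * X h.z) *
          (⟨0, m (heiCocycle g.z h.z)⟩ * (⟨0, m g.c⟩ * ⟨0, m h.c⟩)) := by
          rw [mk_zero_mul _ (_ * _)]
      _ = Y g.z * (Y h.z * X g.z * (X h.z * ⟨0, m (heiCocycle g.z h.z)⟩)) *
          (⟨0, m g.c⟩ * ⟨0, m h.c⟩) := by simp only [mul_assoc]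
      _ = Y g.z * (X g.z * Y h.z) * X h.z * (⟨0, m g.c⟩ * ⟨0, m h.c⟩) := by
          rw [← mk_zero_mul, hXY]; simp only [mul_assoc]
      _ = Y g.z * X g.z * ((Y h.z * X h.z) * ⟨0, m g.c⟩) * ⟨0, m h.c⟩ := by
          simp only [mul_assoc]
      _ = Y g.z * X g.z * ⟨0, m g.c⟩ * (Y h.z * X h.z * ⟨0, m h.c⟩) := by
          rw [← mk_zero_mul (m g.c)]; simp only [mul_assoc]
  · intro g
    change (Y g.z).z + (X g.z).z + 0 = _
    rw [hXz, hYz, ← map_add, add_zero]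
    congr 1
    ext i
    fin_cases i <;> simp
  · intro u
    change Y 0 * X 0 * _ = _
    simp [X, Y]
  · intro i
    change Y _ * X _ * ⟨0, m 0⟩ = a i
    rw [map_zero, show (⟨0, 0⟩ : Hei ℤ) = 1 from rfl, mul_one]
    fin_cases i <;> simp [X, Y]

/-- The six lifts force the range into Δ, and nested subgroups with equal image and equal central
part coincide. Thus Δ is determined by its lifts of a basis. -/
theorem range_eq {φ : Hei ℤ →* Hei ℤ}
    {c : Fin 6 → ℤ × ℤ} (h1 : ∀ g, (φ g).z = P g.z) (h2 : ∀ u, φ ⟨0, u⟩ = ⟨0, m u⟩)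
    (h3 : ∀ i, φ ⟨Pi.single i 1, 0⟩ = ⟨P (Pi.single i 1), c i⟩) {Δ : Subgroup (Hei ℤ)}
    (hz : zSub Δ = P.range) (hc : cSub Δ = m.range)
    (hΔ : ∀ i, (⟨P (Pi.single i 1), c i⟩ : Hei ℤ) ∈ Δ) : φ.range = Δ := by
  have hle : φ.range ≤ Δ := by
    rw [MonoidHom.range_eq_map, Subgroup.map_le_iff_le_comap]
    refine le_of_zSub_of_cSub le_top ?_ ?_
    · intro z _
      have : z = ∑ i, z i • (Pi.single i 1 : Fin 6 → ℤ) := by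
        simpa using map_eq_sum (AddMonoidHom.id _) z
      rw [this]
      refine sum_mem fun i _ => zsmul_mem (mem_zSub.2 ⟨⟨Pi.single i 1, 0⟩, ?_, rfl⟩) _
      rw [Subgroup.mem_comap, h3]
      exact hΔ i
    · intro u _
      rw [mem_cSub, Subgroup.mem_comap, h2, ← mem_cSub, hc]
      exact ⟨u, rfl⟩
  refine le_antisymm hle (le_of_zSub_of_cSub hle ?_ ?_)
  · rw [hz]
    rintro _ ⟨z, rfl⟩
    exact mem_zSub.2 ⟨φ ⟨z, 0⟩, ⟨_, rfl⟩, h1 _⟩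
  · rw [hc]
    rintro _ ⟨u, rfl⟩
    exact mem_cSub.2 ⟨⟨0, u⟩, h2 u⟩

theorem zSub_range {φ : Hei ℤ →* Hei ℤ} (h1 : ∀ g, (φ g).z = P g.z) :
    zSub φ.range = P.range := by
  ext l
  rw [mem_zSub]
  constructor
  · rintro ⟨_, ⟨g, rfl⟩, rfl⟩; exact ⟨g.z, (h1 g).symm⟩
  · rintro ⟨z, rfl⟩; exact ⟨φ ⟨z, 0⟩, ⟨_, rfl⟩, h1 _⟩

theorem cSub_range (hP : Function.Injective P) {φ : Hei ℤ →* Hei ℤ} (h1 : ∀ g, (φ g).z = P g.z)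
    (h2 : ∀ u, φ ⟨0, u⟩ = ⟨0, m u⟩) : cSub φ.range = m.range := by
  ext u
  rw [mem_cSub]
  constructor
  · rintro ⟨g, hg⟩
    have h0 : g.z = 0 := hP (by rw [← h1, hg, map_zero])
    have : g = ⟨0, g.c⟩ := Hei.ext h0 rfl
    rw [this, h2] at hg
    exact ⟨g.c, congrArg Hei.c hg⟩
  · rintro ⟨v, rfl⟩; exact ⟨⟨0, v⟩, h2 v⟩

theorem exists_lifts {Δ : Subgroup (Hei ℤ)} (hz : zSub Δ = P.range) :
    ∃ c : Fin 6 → ℤ × ℤ, ∀ i, (⟨P (Pi.single i 1), c i⟩ : Hei ℤ) ∈ Δ := by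
  have : ∀ i, ∃ c, (⟨P (Pi.single i 1), c⟩ : Hei ℤ) ∈ Δ := by
    intro i
    have h : P (Pi.single i 1) ∈ zSub Δ := by rw [hz]; exact ⟨_, rfl⟩
    obtain ⟨g, hg, e⟩ := mem_zSub.1 h
    exact ⟨g.c, by rw [← e]; exact hg⟩
  choose c hc using this
  exact ⟨c, hc⟩

/-- This is the converse half of the classification: a pair of lattices similar to the standard one
only carries copies of the whole group. -/
theorem nonempty_mulEquiv (hP : Function.Injective P) (hm : Function.Injective m)
    (hB : ∀ z w, heiForm (P z) (P w) = m (heiForm z w)) {Δ : Subgroup (Hei ℤ)}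
    (hz : zSub Δ = P.range) (hc : cSub Δ = m.range) : Nonempty (Δ ≃* Hei ℤ) := by
  obtain ⟨c, hΔ⟩ := exists_lifts hz
  obtain ⟨φ, h1, h2, h3⟩ := exists_hom hB c
  have hr := range_eq h1 h2 h3 hz hc hΔ
  have hφ : Function.Injective φ := by
    rw [injective_iff_map_eq_one]
    intro g hg
    have h0 : g.z = 0 := hP (by rw [← h1, hg, map_zero]; rfl)
    have : g = ⟨0, g.c⟩ := Hei.ext h0 rfl
    rw [this, h2] at hg
    have : g.c = 0 := hm ((congrArg Hei.c hg).trans (map_zero m).symm)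
    exact Hei.ext h0 this
  rw [← hr]
  exact ⟨(MonoidHom.ofInjective hφ).symm⟩

/-- The number of subgroups with given image modulo the centre and given central part. -/
theorem card_fiber (hP : Function.Injective P)
    (hB : ∀ z w, heiForm (P z) (P w) = m (heiForm z w)) :
    Nat.card {Δ : Subgroup (Hei ℤ) // zSub Δ = P.range ∧ cSub Δ = m.range} =
      m.range.index ^ 6 := by
  have hlift := fun Δ : {Δ : Subgroup (Hei ℤ) // zSub Δ = P.range ∧ cSub Δ = m.range} =>
    exists_lifts Δ.2.1
  choose c hcΔ using hlift
  -- A subgroup over the pair corresponds to the central coordinates, modulo M, of its lifts of the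
  -- six basis vectors. All choices occur, as ranges of the lifted endomorphisms.
  let F : {Δ : Subgroup (Hei ℤ) // zSub Δ = P.range ∧ cSub Δ = m.range} →
      (Fin 6 → (ℤ × ℤ) ⧸ m.range) := fun Δ i => QuotientAddGroup.mk (c Δ i)
  have move : ∀ (Δ : Subgroup (Hei ℤ)), cSub Δ = m.range → ∀ (z : Fin 6 → ℤ) (u v : ℤ × ℤ),
      (⟨z, u⟩ : Hei ℤ) ∈ Δ → (QuotientAddGroup.mk u : (ℤ × ℤ) ⧸ m.range) = QuotientAddGroup.mk v →
      (⟨z, v⟩ : Hei ℤ) ∈ Δ := by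
    intro Δ hc z u v hu huv
    rw [QuotientAddGroup.eq, ← hc, mem_cSub] at huv
    have : (⟨z, v⟩ : Hei ℤ) = ⟨z, u⟩ * ⟨0, -u + v⟩ := by ext1 <;> simp
    rw [this]
    exact Δ.mul_mem hu huv
  have hF : Function.Bijective F := by
    constructor
    · intro Δ Δ' h
      obtain ⟨φ, h1, h2, h3⟩ := exists_hom hB (c Δ)
      have e1 := range_eq h1 h2 h3 Δ.2.1 Δ.2.2 (hcΔ Δ)
      have e2 := range_eq h1 h2 h3 Δ'.2.1 Δ'.2.2
        (fun i => move Δ'.1 Δ'.2.2 _ _ _ (hcΔ Δ' i) (congrFun h i).symm)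
      exact Subtype.ext (e1.symm.trans e2)
    · intro f
      have : ∀ i, ∃ u, (QuotientAddGroup.mk u : (ℤ × ℤ) ⧸ m.range) = f i := fun i =>
        QuotientAddGroup.mk_surjective (f i)
      choose u hu using this
      obtain ⟨φ, h1, h2, h3⟩ := exists_hom hB u
      let Δ : {Δ : Subgroup (Hei ℤ) // zSub Δ = P.range ∧ cSub Δ = m.range} :=
        ⟨φ.range, zSub_range h1, cSub_range hP h1 h2⟩
      refine ⟨Δ, funext fun i => ?_⟩
      rw [← hu i]
      have ha : (⟨P (Pi.single i 1), u i⟩ : Hei ℤ) ∈ Δ.1 := ⟨_, h3 i⟩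
      have hb := hcΔ Δ i
      refine QuotientAddGroup.eq.2 ?_
      rw [← Δ.2.2, mem_cSub]
      have := Δ.1.mul_mem (Δ.1.inv_mem hb) ha
      rwa [show (⟨P (Pi.single i 1), c Δ i⟩ : Hei ℤ)⁻¹ * ⟨P (Pi.single i 1), u i⟩ =
        ⟨0, -c Δ i + u i⟩ by ext1 <;> simp; abel] at this
  rw [Nat.card_eq_of_bijective F hF, Nat.card_fun, AddSubgroup.index]
  simp

end Hei

/-! ### Reduction of the lattice pair modulo n. -/

/-- The pair `(L, M)` of a lattice with a lattice containing its commutators reduces modulo `n`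
onto the pair belonging to `Hei (ZMod n)`. -/
def ReducesTo (n : ℕ) (L : AddSubgroup (Fin 6 → ℤ)) (M : AddSubgroup (ℤ × ℤ)) : Prop :=
  ∃ (ψ : L →+ (Fin 6 → ZMod n)) (θ : M →+ ZMod n × ZMod n), Function.Surjective ψ ∧
    ∀ l l' : L, ∃ h : heiForm (l : Fin 6 → ℤ) l' ∈ M, θ ⟨_, h⟩ = heiForm (ψ l) (ψ l')

/-- The second component alone is unimodular, as pairing with the basis vectors shows. This
identifies the centre of `Hei R` with the elements whose non-central coordinates vanish. -/
theorem heiForm_left_nondegenerate {R : Type} [CommRing R] {z : Fin 6 → R}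
    (h : ∀ w, heiForm z w = 0) : z = 0 := by
  have h' : ∀ w, (heiForm z w).2 = 0 := fun w => by rw [h]; rfl
  have h0 := h' (Pi.single 5 1)
  have h1 := h' (Pi.single 4 1)
  have h2 := h' (Pi.single 3 1)
  have h3 := h' (Pi.single 2 1)
  have h4 := h' (Pi.single 1 1)
  have h5 := h' (Pi.single 0 1)
  simp [heiForm_snd] at h0 h1 h2 h3 h4 h5
  ext i
  fin_cases i <;> simpa

namespace Hei

variable {R : Type} [CommRing R]

theorem eq_mul_form (g h : Hei R) : g * h * (h * g)⁻¹ = ⟨0, heiForm g.z h.z⟩ := by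
  rw [mul_inv_eq_iff_eq_mul, mk_zero_mul, mul_comm_form]

/-- Central elements of Δ commute with everything, hence so do their images under a surjection, and
they land in the centre. So π descends to the quotient by the central part, and commutators give the
compatibility with the forms. -/
theorem reducesTo_of_surjective {n : ℕ} {Δ : Subgroup (Hei ℤ)} (π : Δ →* Hei (ZMod n))
    (hπ : Function.Surjective π) : ReducesTo n (zSub Δ) (cSub Δ) := by
  have hcent : ∀ (u : ℤ × ℤ) (hu : (⟨0, u⟩ : Hei ℤ) ∈ Δ), (π ⟨_, hu⟩).z = 0 := by
    intro u hu
    refine heiForm_left_nondegenerate fun w => ?_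
    obtain ⟨g, hg⟩ := hπ ⟨w, 0⟩
    have : Commute (π ⟨_, hu⟩) (π g) := by
      rw [commute_iff_eq, ← map_mul, ← map_mul]
      congr 1
      exact Subtype.ext (mk_zero_mul u g.1)
    rw [commute_iff, hg] at this
    exact this
  have hz : ∀ g h : Δ, g.1.z = h.1.z → (π g).z = (π h).z := by
    intro g h e
    have hm : (⟨0, g.1.c - h.1.c⟩ : Hei ℤ) ∈ Δ := by
      have : (⟨0, g.1.c - h.1.c⟩ : Hei ℤ) = h.1⁻¹ * g.1 := by
        rw [eq_inv_mul_iff_mul_eq, ← eq_mul_mk_zero e]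
      rw [this]
      exact Δ.mul_mem (Δ.inv_mem h.2) g.2
    have : g = h * ⟨_, hm⟩ := Subtype.ext (eq_mul_mk_zero e)
    rw [this, map_mul, mul_z, hcent, add_zero]
  have hl : ∀ l : zSub Δ, ∃ g : Δ, g.1.z = l.1 := fun l => by
    obtain ⟨g, hg, e⟩ := mem_zSub.1 l.2
    exact ⟨⟨g, hg⟩, e⟩
  choose δ hδ using hl
  refine ⟨AddMonoidHom.mk' (fun l => (π (δ l)).z) ?_,
    AddMonoidHom.mk' (fun u => (π ⟨⟨0, u.1⟩, mem_cSub.1 u.2⟩).c) ?_, ?_, ?_⟩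
  · intro l l'
    rw [← mul_z, ← map_mul]
    apply hz
    rw [hδ]
    change _ = (δ l).1.z + (δ l').1.z
    rw [hδ, hδ]; rfl
  · intro u v
    have : (⟨⟨0, (u + v : cSub Δ).1⟩, mem_cSub.1 (u + v).2⟩ : Δ) = ⟨⟨0, u.1⟩, mem_cSub.1 u.2⟩ * ⟨⟨0, v.1⟩, mem_cSub.1 v.2⟩ :=
      Subtype.ext (mk_zero_mul_mk_zero _ _).symm
    simp only [this, map_mul, mul_c]
    rw [hcent u.1 (mem_cSub.1 u.2), heiCocycle_zero_left, add_zero]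
  · intro x
    obtain ⟨g, hg⟩ := hπ ⟨x, 0⟩
    refine ⟨⟨g.1.z, mem_zSub.2 ⟨g.1, g.2, rfl⟩⟩, ?_⟩
    change (π (δ _)).z = x
    rw [hz _ g (hδ _), hg]
  · intro l l'
    have h1 : ((δ l * δ l' * (δ l' * δ l)⁻¹ : Δ) : Hei ℤ) = ⟨0, heiForm l.1 l'.1⟩ := by
      rw [← hδ l, ← hδ l', ← eq_mul_form]; rfl
    have h2 : (⟨0, heiForm l.1 l'.1⟩ : Hei ℤ) ∈ Δ := by rw [← h1]; exact Subtype.prop _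
    refine ⟨h2, ?_⟩
    change (π ⟨⟨0, heiForm l.1 l'.1⟩, h2⟩).c = heiForm (π (δ l)).z (π (δ l')).z
    have h3 : (⟨⟨0, heiForm l.1 l'.1⟩, h2⟩ : Δ) = δ l * δ l' * (δ l' * δ l)⁻¹ :=
      Subtype.ext h1.symm
    rw [h3, map_mul, map_inv, map_mul, map_mul, eq_mul_form]

end Hei

/-! ### Lattices of p-power index and nondegeneracy over a field. -/

theorem AddSubgroup.exists_eq_zmultiples_prime_pow {p : ℕ} (hp : p.Prime) (S : AddSubgroup ℤ)
    {N : ℕ} (hN : (p : ℤ) ^ N ∈ S) : ∃ r : ℕ, S = AddSubgroup.zmultiples ((p : ℤ) ^ r) := by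
  obtain ⟨a, ha⟩ := Int.subgroup_cyclic S
  rw [← AddSubgroup.zmultiples_eq_closure] at ha
  rw [ha, Int.mem_zmultiples_iff] at hN
  have h2 : a.natAbs ∣ p ^ N := by
    have := Int.natAbs_dvd_natAbs.2 hN
    rwa [Int.natAbs_pow, Int.natAbs_natCast] at this
  obtain ⟨r, -, hr⟩ := (Nat.dvd_prime_pow hp).1 h2
  refine ⟨r, ha.trans ?_⟩
  ext x
  rw [Int.mem_zmultiples_iff, Int.mem_zmultiples_iff, ← Int.natAbs_dvd, hr]
  push_cast
  rfl

/-- Hermite normal form of a lattice of `p`-power index in the plane. -/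
theorem AddSubgroup.exists_hermite {p : ℕ} (hp : p.Prime) (M : AddSubgroup (ℤ × ℤ)) {N : ℕ}
    (hN : ∀ u, (p : ℤ) ^ N • u ∈ M) : ∃ (r r' : ℕ) (s : ℤ), ((p : ℤ) ^ r, s) ∈ M ∧
      (0, (p : ℤ) ^ r') ∈ M ∧ ∀ u ∈ M, ∃ x y : ℤ, u = (x * (p : ℤ) ^ r, x * s + y * (p : ℤ) ^ r') := by
  obtain ⟨r, hr⟩ := AddSubgroup.exists_eq_zmultiples_prime_pow hp
    (M.map (AddMonoidHom.fst ℤ ℤ)) (N := N) ⟨_, hN (1, 0), by simp⟩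
  obtain ⟨r', hr'⟩ := AddSubgroup.exists_eq_zmultiples_prime_pow hp
    (M.comap (AddMonoidHom.inr ℤ ℤ)) (N := N) (by simpa using hN (0, 1))
  obtain ⟨⟨x, s⟩, hm, rfl : x = _⟩ : (p : ℤ) ^ r ∈ M.map (AddMonoidHom.fst ℤ ℤ) := by
    rw [hr]; exact AddSubgroup.mem_zmultiples _
  have hm' : (p : ℤ) ^ r' ∈ M.comap (AddMonoidHom.inr ℤ ℤ) := by
    rw [hr']; exact AddSubgroup.mem_zmultiples _
  refine ⟨r, r', s, hm, hm', fun u hu => ?_⟩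
  have h1 : u.1 ∈ M.map (AddMonoidHom.fst ℤ ℤ) := ⟨u, hu, rfl⟩
  rw [hr, Int.mem_zmultiples_iff] at h1
  obtain ⟨x, hx⟩ := h1
  have h2 : u.2 - x * s ∈ M.comap (AddMonoidHom.inr ℤ ℤ) := by
    have := M.sub_mem hu (M.zsmul_mem hm x)
    have e : u - x • ((p : ℤ) ^ r, s) = (0, u.2 - x * s) := by
      ext <;> simp [hx, mul_comm]
    rw [e] at this
    exact this
  rw [hr', Int.mem_zmultiples_iff] at h2
  obtain ⟨y, hy⟩ := h2
  refine ⟨x, y, ?_⟩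
  ext
  · simp [hx, mul_comm]
  · simp only; linear_combination hy

/-- The kernel of a surjection of a full lattice onto `(ℤ/p)⁶`. -/
theorem exists_eq_smul_of_map_eq_zero {p : ℕ} (hp : p ≠ 0) {L : AddSubgroup (Fin 6 → ℤ)}
    (hL : L.index ≠ 0) {ψ : L →+ (Fin 6 → ZMod p)} (hψ : Function.Surjective ψ) {l : L}
    (hl : ψ l = 0) : ∃ k : L, l = (p : ℤ) • k := by
  have : NeZero p := ⟨hp⟩
  let f : (Fin 6 → ℤ) →+ (Fin 6 → ℤ) := zsmulAddGroupHom (p : ℤ)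
  have hf : f.ker = ⊥ := by
    rw [AddMonoidHom.ker_eq_bot_iff]
    intro x y h
    exact smul_right_injective _ (Nat.cast_ne_zero.2 hp : (p : ℤ) ≠ 0) h
  let g : (Fin 6 → ℤ) →+ (Fin 6 → ZMod p) :=
    { toFun := fun x i => (x i : ZMod p)
      map_zero' := by ext; simp
      map_add' := fun x y => by ext; simp }
  have hg : Function.Surjective g := fun x =>
    ⟨fun i => (ZMod.intCast_surjective (x i)).choose,
      funext fun i => (ZMod.intCast_surjective (x i)).choose_spec⟩
  have hgf : f.range = g.ker := by
    ext x
    rw [AddMonoidHom.mem_range, AddMonoidHom.mem_ker]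
    constructor
    · rintro ⟨y, rfl⟩
      ext i
      change (((p : ℤ) * y i : ℤ) : ZMod p) = 0
      simp
    · intro h
      have : ∀ i, (p : ℤ) ∣ x i := fun i =>
        (ZMod.intCast_zmod_eq_zero_iff_dvd _ _).1 (congrFun h i)
      choose y hy using this
      exact ⟨y, funext fun i => (hy i).symm⟩
  have hcard : Nat.card (Fin 6 → ZMod p) ≠ 0 := Nat.card_pos.ne'
  -- pL lies in the kernel of ψ, and both have index p⁶ in L, so they are equal.
  have h1 : (L.map f).index = L.index * Nat.card (Fin 6 → ZMod p) := by
    rw [AddSubgroup.index_map, hf, sup_bot_eq, hgf, AddSubgroup.index_ker,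
      AddMonoidHom.range_eq_top.2 hg, AddSubgroup.card_top]
  have hle : L.map f ≤ L := by
    rintro _ ⟨x, hx, rfl⟩; exact L.zsmul_mem hx _
  have h2 : (L.map f).relIndex L = Nat.card (Fin 6 → ZMod p) := by
    have := AddSubgroup.relIndex_mul_index hle
    rw [h1, mul_comm L.index] at this
    exact Nat.eq_of_mul_eq_mul_right (Nat.pos_of_ne_zero hL) this
  have h3 : ψ.ker.index = Nat.card (Fin 6 → ZMod p) := by
    rw [AddSubgroup.index_ker, AddMonoidHom.range_eq_top.2 hψ, AddSubgroup.card_top]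
  have hle2 : (L.map f).addSubgroupOf L ≤ ψ.ker := by
    intro x hx
    obtain ⟨y, hy, hyx⟩ := AddSubgroup.mem_addSubgroupOf.1 hx
    have : x = (p : ℤ) • (⟨y, hy⟩ : L) := Subtype.ext hyx.symm
    rw [AddMonoidHom.mem_ker, this, map_zsmul]
    ext i
    simp
  have h4 : ((L.map f).addSubgroupOf L).relIndex ψ.ker = 1 := by
    have := AddSubgroup.relIndex_mul_index hle2
    rw [h3, show ((L.map f).addSubgroupOf L).index = _ from h2] at this
    exact Nat.eq_of_mul_eq_mul_right (Nat.pos_of_ne_zero hcard) (this.trans (one_mul _).symm)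
  obtain ⟨y, hy, hyx⟩ := AddSubgroup.mem_addSubgroupOf.1
    (AddSubgroup.relIndex_eq_one.1 h4 (AddMonoidHom.mem_ker.2 hl))
  exact ⟨⟨y, hy⟩, Subtype.ext hyx.symm⟩

/-- A combination of the two commutator forms in which the second one occurs is nondegenerate. -/
theorem eq_zero_of_heiForm {K : Type} [Field K] {x : Fin 6 → K} (k : K)
    (h : ∀ y, (heiForm x y).2 = k * (heiForm x y).1) : x = 0 := by
  have h5 := h (Pi.single 5 1)
  have h4 := h (Pi.single 4 1)
  have h3 := h (Pi.single 3 1)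
  have h2 := h (Pi.single 2 1)
  have h1 := h (Pi.single 1 1)
  have h0 := h (Pi.single 0 1)
  simp [heiForm_snd, heiForm_fst] at h0 h1 h2 h3 h4 h5
  rw [h5, mul_zero] at h3
  rw [h4, mul_zero] at h2
  rw [h3, mul_zero] at h1
  rw [h2, mul_zero] at h0
  ext i
  fin_cases i <;> simpa

/-- Since B₁(x, ·) = B₂(tx, ·), the hypothesis reads (1 - k·shift) y = t·shift(x), where shift is
multiplication by the nilpotent variable. The geometric series stops after two terms. -/
theorem eq_of_heiForm {K : Type} [Field K] {x y : Fin 6 → K} (k t : K)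
    (h : ∀ w, (heiForm y w).2 = k * (heiForm y w).1 + t * (heiForm x w).1) :
    y = ![0, 0, t * x 0, t * x 1, t * x 2 + k * t * x 0, t * x 3 + k * t * x 1] := by
  have h5 := h (Pi.single 5 1)
  have h4 := h (Pi.single 4 1)
  have h3 := h (Pi.single 3 1)
  have h2 := h (Pi.single 2 1)
  have h1 := h (Pi.single 1 1)
  have h0 := h (Pi.single 0 1)
  simp [heiForm_snd, heiForm_fst] at h0 h1 h2 h3 h4 h5
  rw [h5, mul_zero, zero_add] at h3
  rw [h4, mul_zero, neg_zero, zero_add] at h2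
  rw [h3] at h1
  rw [neg_inj.1 (h2.trans rfl : -y 3 = -(t * x 1))] at h0
  ext i
  fin_cases i
  · simpa
  · simpa
  · simpa
  · simp; linear_combination -h2
  · simp; linear_combination h1
  · simp; linear_combination -h0

/-! ### The shift operator on a lattice with standard reduction. -/

/-- The nilpotent operator carried by a lattice that reduces onto the standard one, together with
the matrix entries of the commutator form in a Hermite basis of the central lattice. -/
structure ShiftData (p : ℕ) (L : AddSubgroup (Fin 6 → ℤ)) (M : AddSubgroup (ℤ × ℤ))
    (ψ : L →+ (Fin 6 → ZMod p)) where
  /-- exponent of the first elementary divisor of the Hermite basis -/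
  r : ℕ
  /-- exponent of the second elementary divisor of the Hermite basis -/
  r' : ℕ
  /-- the off-diagonal entry of the Hermite basis -/
  s : ℤ
  /-- first coefficient of the commutator form -/
  b₁ : L → L → ℤ
  /-- second coefficient of the commutator form -/
  b₂ : L → L → ℤ
  /-- the operator -/
  T : L →+ L
  /-- the reduced first coefficient is the first standard form divided by this unit -/
  t : ZMod p
  /-- leading coefficient of the reduced operator -/
  τ : ZMod p
  /-- second coefficient of the reduced operator -/
  κ : ZMod p
  t_ne : t ≠ 0
  τ_ne : τ ≠ 0
  mem₁ : ((p : ℤ) ^ r, s) ∈ M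
  mem₂ : (0, (p : ℤ) ^ r') ∈ M
  eq_of_mem : ∀ u ∈ M, ∃ x y : ℤ, u = (x * (p : ℤ) ^ r, x * s + y * (p : ℤ) ^ r')
  form_fst : ∀ l l' : L, (heiForm (l : Fin 6 → ℤ) l').1 = (p : ℤ) ^ r * b₁ l l'
  form_snd : ∀ l l' : L, (heiForm (l : Fin 6 → ℤ) l').2 = s * b₁ l l' + (p : ℤ) ^ r' * b₂ l l'
  red : ∀ l l' : L, t * (b₁ l l' : ZMod p) = (heiForm (ψ l) (ψ l')).1
  b₂_T : ∀ l l' : L, b₂ (T l) l' = b₁ l l'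
  ψ_T : ∀ l : L, ψ (T l) = ![0, 0, τ * ψ l 0, τ * ψ l 1, τ * ψ l 2 + κ * ψ l 0,
    τ * ψ l 3 + κ * ψ l 1]
  T_zero : ∀ l : L, (T l : Fin 6 → ℤ) 0 = 0
  T_one : ∀ l : L, (T l : Fin 6 → ℤ) 1 = 0
  T_two : ∀ l : L, (p : ℤ) ^ r * (T l : Fin 6 → ℤ) 2 = (p : ℤ) ^ r' * (l : Fin 6 → ℤ) 0
  T_three : ∀ l : L, (p : ℤ) ^ r * (T l : Fin 6 → ℤ) 3 = (p : ℤ) ^ r' * (l : Fin 6 → ℤ) 1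
  T_four : ∀ l : L, (p : ℤ) ^ (2 * r) * (T l : Fin 6 → ℤ) 4 =
    (p : ℤ) ^ (r + r') * (l : Fin 6 → ℤ) 2 + (p : ℤ) ^ r' * s * (l : Fin 6 → ℤ) 0
  T_five : ∀ l : L, (p : ℤ) ^ (2 * r) * (T l : Fin 6 → ℤ) 5 =
    (p : ℤ) ^ (r + r') * (l : Fin 6 → ℤ) 3 + (p : ℤ) ^ r' * s * (l : Fin 6 → ℤ) 1

/-- A lattice of `p`-power index contains a vector of the last level that is not divisible by `p`
in the lattice. -/
theorem exists_primitive_vector {p : ℕ} (hp : p.Prime) {L : AddSubgroup (Fin 6 → ℤ)} {N : ℕ}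
    (hN : ∀ z, (p : ℤ) ^ N • z ∈ L) :
    ∃ x : L, (∀ i ≠ 4, (x : Fin 6 → ℤ) i = 0) ∧ ∀ k : L, x ≠ (p : ℤ) • k := by
  obtain ⟨j, hj⟩ := AddSubgroup.exists_eq_zmultiples_prime_pow hp
    (L.comap (AddMonoidHom.single (fun _ : Fin 6 => ℤ) 4)) (N := N) (by
      have := hN (Pi.single 4 1)
      rw [← Pi.single_smul] at this
      simpa using this)
  have hx : (p : ℤ) ^ j ∈ L.comap (AddMonoidHom.single (fun _ : Fin 6 => ℤ) 4) := by
    rw [hj]; exact AddSubgroup.mem_zmultiples _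
  refine ⟨⟨Pi.single 4 ((p : ℤ) ^ j), hx⟩, fun i hi => by simp [hi], fun k hk => ?_⟩
  have hk' : (Pi.single 4 ((p : ℤ) ^ j) : Fin 6 → ℤ) = (p : ℤ) • (k : Fin 6 → ℤ) :=
    congrArg Subtype.val hk
  have hp0 : (p : ℤ) ≠ 0 := by exact_mod_cast hp.ne_zero
  have h4 : (k : Fin 6 → ℤ) = Pi.single 4 ((k : Fin 6 → ℤ) 4) := by
    ext i
    by_cases hi : i = 4
    · subst hi; simp
    · have := congrFun hk' i
      simp [hi] at this
      simp [hi, this.resolve_left hp.ne_zero]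
  have hmem : (k : Fin 6 → ℤ) 4 ∈ L.comap (AddMonoidHom.single (fun _ : Fin 6 => ℤ) 4) := by
    change Pi.single 4 _ ∈ L
    rw [← h4]; exact k.2
  rw [hj, Int.mem_zmultiples_iff] at hmem
  obtain ⟨c, hc⟩ := hmem
  have h5 := congrFun hk' 4
  simp only [Pi.single_eq_same, Pi.smul_apply, smul_eq_mul, hc] at h5
  have h6 : (p : ℤ) ^ j * 1 = (p : ℤ) ^ j * (p * c) := by linear_combination h5
  have h7 := mul_left_cancel₀ (pow_ne_zero _ hp0) h6
  exact (Nat.prime_iff_prime_int.1 hp).not_isUnit (IsUnit.of_mul_eq_one _ h7.symm)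

theorem index_ne_zero_of_smul_mem {p : ℕ} (hp : p ≠ 0) {L : AddSubgroup (Fin 6 → ℤ)} {N : ℕ}
    (hN : ∀ z, (p : ℤ) ^ N • z ∈ L) : L.index ≠ 0 := by
  have hn : (p : ℤ) ^ N ≠ 0 := pow_ne_zero _ (Nat.cast_ne_zero.2 hp)
  have : NeZero (p ^ N) := ⟨pow_ne_zero _ hp⟩
  let g : (Fin 6 → ℤ) →+ (Fin 6 → ZMod (p ^ N)) :=
    { toFun := fun x i => (x i : ZMod (p ^ N))
      map_zero' := by ext; simp
      map_add' := fun x y => by ext; simp }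
  have hle : g.ker ≤ L := by
    intro x hx
    have : ∀ i, ((p ^ N : ℕ) : ℤ) ∣ x i := fun i =>
      (ZMod.intCast_zmod_eq_zero_iff_dvd _ _).1 (congrFun (AddMonoidHom.mem_ker.1 hx) i)
    choose y hy using this
    have : x = (p : ℤ) ^ N • y := by
      ext i; rw [hy]; simp
    rw [this]; exact hN y
  have h1 : g.ker.index ≠ 0 := by
    rw [AddSubgroup.index_ker]
    exact Nat.card_pos.ne'
  exact fun h => h1 (Nat.eq_zero_of_zero_dvd (h ▸ AddSubgroup.index_dvd_of_le hle))

/-- In a Hermite basis of M the form has coefficients b₁ and b₂. Over ℚ the equation b₂(Tl, ·) =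
b₁(l, ·) defines T uniquely. Integrality of T holds because b₂ is nondegenerate modulo p. -/
theorem nonempty_shiftData {p : ℕ} [Fact p.Prime] {L : AddSubgroup (Fin 6 → ℤ)}
    {M : AddSubgroup (ℤ × ℤ)} {N : ℕ} (hL : ∀ z, (p : ℤ) ^ N • z ∈ L)
    (hM : ∀ u, (p : ℤ) ^ N • u ∈ M) {ψ : L →+ (Fin 6 → ZMod p)} {θ : M →+ ZMod p × ZMod p}
    (hψ : Function.Surjective ψ)
    (hθ : ∀ l l' : L, ∃ h : heiForm (l : Fin 6 → ℤ) l' ∈ M, θ ⟨_, h⟩ = heiForm (ψ l) (ψ l')) :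
    Nonempty (ShiftData p L M ψ) := by
  have hp : p.Prime := Fact.out
  have hp0 : (p : ℤ) ≠ 0 := by exact_mod_cast hp.ne_zero
  have hpn : ∀ n, (p : ℤ) ^ n ≠ 0 := fun n => pow_ne_zero _ hp0
  obtain ⟨r, r', s, m1, m2, hm⟩ := AddSubgroup.exists_hermite hp M hM
  have hb : ∀ l l' : L, ∃ x y : ℤ, heiForm (l : Fin 6 → ℤ) l' =
      (x * (p : ℤ) ^ r, x * s + y * (p : ℤ) ^ r') := fun l l' => hm _ (hθ l l').1
  choose b₁ b₂ hb using hb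
  have hker : ∀ {l : L}, ψ l = 0 → ∃ k : L, l = (p : ℤ) • k := fun h =>
    exists_eq_smul_of_map_eq_zero hp.ne_zero (index_ne_zero_of_smul_mem hp.ne_zero hL) hψ h
  -- the matrix of the reduced central lattice
  have hred : ∀ l l' : L, heiForm (ψ l) (ψ l') =
      b₁ l l' • θ ⟨_, m1⟩ + b₂ l l' • θ ⟨_, m2⟩ := by
    intro l l'
    obtain ⟨h, e⟩ := hθ l l'
    rw [← e, ← map_zsmul, ← map_zsmul, ← map_add]
    congr 1
    refine Subtype.ext ((hb l l').trans ?_)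
    ext <;> simp
  set t11 := (θ ⟨_, m1⟩).1
  set t21 := (θ ⟨_, m1⟩).2
  set t12 := (θ ⟨_, m2⟩).1
  set t22 := (θ ⟨_, m2⟩).2
  have hr1 : ∀ l l' : L, (heiForm (ψ l) (ψ l')).1 = b₁ l l' * t11 + b₂ l l' * t12 := by
    intro l l'; rw [hred]; simp [t11, t12]
  have hr2 : ∀ l l' : L, (heiForm (ψ l) (ψ l')).2 = b₁ l l' * t21 + b₂ l l' * t22 := by
    intro l l'; rw [hred]; simp [t21, t22]
  -- The standard form takes the values (1, 0) and (0, 1), on the basis pairs (0, 3) and (0, 5), so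
  -- the matrix of θ is invertible.
  have hD : t11 * t22 - t12 * t21 ≠ 0 := by
    obtain ⟨x, hx⟩ := hψ (Pi.single 0 1)
    obtain ⟨y, hy⟩ := hψ (Pi.single 3 1)
    obtain ⟨w, hw⟩ := hψ (Pi.single 5 1)
    have a1 := hr1 x y
    have a2 := hr2 x y
    have a3 := hr1 x w
    have a4 := hr2 x w
    simp [hx, hy, hw, heiForm_fst, heiForm_snd] at a1 a2 a3 a4
    intro hD
    have : (1 : ZMod p) = 0 := by
      linear_combination (b₁ x y * b₂ x w - b₂ x y * b₁ x w : ZMod p) * hD +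
        a1 * (b₁ x w * t21 + b₂ x w * t22) + a4 - a2 * (b₁ x w * t11 + b₂ x w * t12)
    exact one_ne_zero this
  obtain ⟨x, hx0, hxp⟩ := exists_primitive_vector hp hL
  -- A last-level vector x has b₁(x, ·) = 0. If t12 were nonzero, the second reduced form at ψ x
  -- would be a multiple of the first, forcing ψ x = 0 and x into pL, against primitivity.
  have ht12 : t12 = 0 := by
    by_contra h12
    obtain ⟨k, hk⟩ : ∃ k : L, x = (p : ℤ) • k := by
      refine hker (eq_zero_of_heiForm (t22 / t12) fun y => ?_)
      obtain ⟨l', rfl⟩ := hψ y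
      have hb0 : b₁ x l' = 0 := by
        have := congrArg Prod.fst (hb x l')
        rw [heiForm_fst, hx0 0 (by decide), hx0 1 (by decide), hx0 2 (by decide),
          hx0 3 (by decide)] at this
        simpa [hp.ne_zero] using this
      rw [hr1, hr2, hb0]
      field_simp
      simp
      ring
    exact hxp k hk
  rw [ht12, zero_mul, sub_zero] at hD
  have ht11 : t11 ≠ 0 := left_ne_zero_of_mul hD
  have ht22 : t22 ≠ 0 := right_ne_zero_of_mul hD
  simp only [ht12, mul_zero, add_zero] at hr1
  have hb1 : ∀ l l' : L, (heiForm (l : Fin 6 → ℤ) l').1 = (p : ℤ) ^ r * b₁ l l' := fun l l' => by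
    rw [hb]; ring
  have hb2 : ∀ l l' : L, (heiForm (l : Fin 6 → ℤ) l').2 =
      s * b₁ l l' + (p : ℤ) ^ r' * b₂ l l' := fun l l' => by
    rw [hb]; ring
  have hnd : ∀ l : L, (∀ l', (p : ℤ) ∣ b₂ l l') → ∃ k : L, l = (p : ℤ) • k := by
    intro l h
    refine hker (eq_zero_of_heiForm (t21 / t11) fun y => ?_)
    obtain ⟨l', rfl⟩ := hψ y
    rw [hr1, hr2, (ZMod.intCast_zmod_eq_zero_iff_dvd _ _).2 (h l')]
    field_simp
    simp
  -- the operator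
  let S : L → Fin 6 → ℤ := fun l => ![0, 0, (p : ℤ) ^ (r + r') * l.1 0, (p : ℤ) ^ (r + r') * l.1 1,
    (p : ℤ) ^ (r + r') * l.1 2 + (p : ℤ) ^ r' * s * l.1 0,
    (p : ℤ) ^ (r + r') * l.1 3 + (p : ℤ) ^ r' * s * l.1 1]
  -- S l is p^(2r) times the rational solution. With t the standard shift, b₂(y, ·) = b₁(l, ·) means
  -- (1 - s p^(-r) t) y = p^(r'-r) t l, so y = p^(r'-r) t l + s p^(r'-2r) t² l.
  have key : ∀ (l y : L) (n : ℕ), (p : ℤ) ^ n • (y : Fin 6 → ℤ) = (p : ℤ) ^ N • S l →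
      ∀ l', (p : ℤ) ^ n * b₂ y l' = (p : ℤ) ^ (N + 2 * r) * b₁ l l' := by
    intro l y n h l'
    have g0 := congrFun h 0
    have g1 := congrFun h 1
    have g2 := congrFun h 2
    have g3 := congrFun h 3
    have g4 := congrFun h 4
    have g5 := congrFun h 5
    simp [S] at g0 g1 g2 g3 g4 g5
    have c1 := hb1 y l'
    have c2 := hb2 y l'
    have c3 := hb1 l l'
    rw [heiForm_fst] at c1 c3
    rw [heiForm_snd] at c2
    have g0' : (y : Fin 6 → ℤ) 0 = 0 := g0.resolve_left fun h => hp.ne_zero h.1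
    have g1' : (y : Fin 6 → ℤ) 1 = 0 := g1.resolve_left fun h => hp.ne_zero h.1
    rw [g0', g1'] at c1 c2
    apply mul_left_cancel₀ (hpn (r + r'))
    simp only [pow_add, pow_mul', pow_two] at *
    linear_combination (-(p : ℤ) ^ r * (p : ℤ) ^ n) * c2 + s * (p : ℤ) ^ n * c1 +
      (p : ℤ) ^ r * (g2 * l'.1 3 - g3 * l'.1 2 + g4 * l'.1 1 - g5 * l'.1 0) -
      s * (g2 * l'.1 1 - g3 * l'.1 0) + (p : ℤ) ^ N * (p : ℤ) ^ r * (p : ℤ) ^ r * (p : ℤ) ^ r' * c3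
  -- While fewer than N + 2r factors p have been removed from p^N S l, the quotient y still has
  -- b₂(y, ·) divisible by p, hence lies in pL.
  have hdiv : ∀ (l : L) (n : ℕ), n ≤ N + 2 * r → ∃ y : L,
      (p : ℤ) ^ n • (y : Fin 6 → ℤ) = (p : ℤ) ^ N • S l := by
    intro l n
    induction n with
    | zero => intro _; exact ⟨⟨_, hL (S l)⟩, by simp⟩
    | succ n ih =>
      intro hn
      obtain ⟨y, hy⟩ := ih (by omega)
      obtain ⟨k, rfl⟩ := hnd y (fun l' => by
        have := key l y n hy l'
        obtain ⟨e, he⟩ := Nat.exists_eq_add_of_lt (show n < N + 2 * r by omega)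
        rw [he, show n + e + 1 = n + (e + 1) by ring, pow_add, mul_assoc] at this
        rw [mul_left_cancel₀ (hpn n) this, pow_succ]
        exact ⟨(p : ℤ) ^ e * b₁ l l', by ring⟩)
      refine ⟨k, ?_⟩
      rw [← hy, pow_succ, mul_smul]
      rfl
  choose T hT using fun l => hdiv l _ le_rfl
  have hT' : ∀ l, (p : ℤ) ^ (2 * r) • (T l : Fin 6 → ℤ) = S l := by
    intro l
    have := hT l
    rw [pow_add, mul_smul] at this
    exact smul_right_injective _ (hpn N) this
  have hTb : ∀ l l', b₂ (T l) l' = b₁ l l' := fun l l' =>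
    mul_left_cancel₀ (hpn _) (key l (T l) _ (hT l) l')
  have hadd : ∀ l l', T (l + l') = T l + T l' := by
    intro l l'
    apply Subtype.ext
    apply smul_right_injective _ (hpn (2 * r))
    simp only [AddSubgroup.coe_add, smul_add, hT']
    ext i
    fin_cases i <;> simp [S] <;> ring
  refine ⟨{
    r := r, r' := r', s := s, b₁ := b₁, b₂ := b₂, T := AddMonoidHom.mk' T hadd
    t := t11, τ := t22 / t11, κ := t21 / t11 * (t22 / t11)
    t_ne := ht11
    τ_ne := by simp [ht11, ht22]
    mem₁ := m1, mem₂ := m2, eq_of_mem := hm, form_fst := hb1, form_snd := hb2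
    red := fun l l' => by rw [hr1]; ring
    b₂_T := hTb
    ψ_T := ?_, T_zero := ?_, T_one := ?_, T_two := ?_, T_three := ?_, T_four := ?_
    T_five := ?_ }⟩
  · intro l
    have := eq_of_heiForm (x := ψ l) (y := ψ (T l)) (t21 / t11) (t22 / t11) (fun w => by
      obtain ⟨l', rfl⟩ := hψ w
      rw [hr1, hr1, hr2, hTb]
      field_simp)
    change ψ (T l) = _
    rw [this]
  · intro l
    have := congrFun (hT' l) 0
    simpa [S, hp.ne_zero] using this
  · intro l
    have := congrFun (hT' l) 1
    simpa [S, hp.ne_zero] using this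
  · intro l
    have := congrFun (hT' l) 2
    simp only [S, Pi.smul_apply, smul_eq_mul] at this
    apply mul_left_cancel₀ (hpn r)
    rw [← mul_assoc, ← mul_assoc, ← pow_add, ← pow_add, ← two_mul]
    exact this
  · intro l
    have := congrFun (hT' l) 3
    simp only [S, Pi.smul_apply, smul_eq_mul] at this
    apply mul_left_cancel₀ (hpn r)
    rw [← mul_assoc, ← mul_assoc, ← pow_add, ← pow_add, ← two_mul]
    exact this
  · intro l
    exact congrFun (hT' l) 4
  · intro l
    exact congrFun (hT' l) 5

/-! ### Frames, and their extraction from the shift operator. -/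

/-- Coordinates of a normalized basis of a lattice carrying a nilpotent operator. -/
structure Frame where
  /-- level `0` exponent -/
  r₀ : ℕ
  /-- level `1` exponent -/
  r₁ : ℕ
  /-- level `2` exponent -/
  r₂ : ℕ
  /-- difference of the elementary divisor exponents -/
  d : ℕ
  /-- level `1` coordinate -/
  A : ℤ
  /-- level `1` coordinate -/
  B : ℤ
  /-- level `1` coordinate -/
  C : ℤ
  /-- level `2` coordinate -/
  E : ℤ
  /-- level `2` coordinate -/
  W₁₁ : ℤ
  /-- level `2` coordinate -/
  W₁₂ : ℤ
  /-- level `2` coordinate -/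
  W₂₁ : ℤ
  /-- level `2` coordinate -/
  W₂₂ : ℤ
  /-- level `2` coordinate determined by `B` -/
  B₁ : ℤ
  /-- level `2` coordinate determined by `C` -/
  C₁ : ℤ
  /-- level `2` coordinate determined by `A` and `E` -/
  E₁ : ℤ

namespace Frame

/-- The relations between the coordinates of a frame. -/
structure Valid (p : ℕ) (F : Frame) : Prop where
  r : F.r₂ + F.r₀ = 2 * F.r₁
  W : (p : ℤ) ^ F.r₀ * F.W₂₂ = p ^ F.d * F.A ^ 2 + F.B * F.C - p ^ (F.r₀ + F.d) * F.W₁₁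
  B : (p : ℤ) ^ F.r₀ * F.B₁ = p ^ F.r₁ * F.B
  C : (p : ℤ) ^ F.r₀ * F.C₁ = p ^ F.r₁ * F.C
  E : (p : ℤ) ^ F.r₀ * (F.E₁ - p ^ F.d * F.E) = -2 * p ^ (F.r₁ + F.d) * F.A

/-- The linear map sending the standard basis to the frame. -/
def map (p : ℕ) (F : Frame) : (Fin 6 → ℤ) →+ (Fin 6 → ℤ) :=
  AddMonoidHom.mk' (fun n => ![p ^ F.r₀ * n 0, p ^ (F.r₀ + F.d) * n 1,
    F.A * n 0 + F.B * n 1 + p ^ F.r₁ * n 2,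
    F.C * n 0 - p ^ F.d * F.A * n 1 + p ^ (F.r₁ + F.d) * n 3,
    F.W₁₁ * n 0 + F.W₁₂ * n 1 + F.E * n 2 + F.B₁ * n 3 + p ^ F.r₂ * n 4,
    F.W₂₁ * n 0 + F.W₂₂ * n 1 + F.C₁ * n 2 + F.E₁ * n 3 + p ^ (F.r₂ + F.d) * n 5])
    (fun x y => by ext i; fin_cases i <;> simp <;> ring)

/-- The map of central coordinates belonging to a frame. -/
def centre (p : ℕ) (F : Frame) : ℤ × ℤ →+ ℤ × ℤ :=
  AddMonoidHom.mk' (fun u => (p ^ (F.r₀ + F.r₁ + F.d) * u.1,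
    (p ^ (F.r₀ + F.d) * F.E - p ^ (F.r₁ + F.d) * F.A) * u.1 + p ^ (2 * F.r₁ + F.d) * u.2))
    (fun x y => by ext <;> simp <;> ring)

theorem map_apply (p : ℕ) (F : Frame) (n : Fin 6 → ℤ) :
    F.map p n = ![p ^ F.r₀ * n 0, p ^ (F.r₀ + F.d) * n 1,
    F.A * n 0 + F.B * n 1 + p ^ F.r₁ * n 2,
    F.C * n 0 - p ^ F.d * F.A * n 1 + p ^ (F.r₁ + F.d) * n 3,
    F.W₁₁ * n 0 + F.W₁₂ * n 1 + F.E * n 2 + F.B₁ * n 3 + p ^ F.r₂ * n 4,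
    F.W₂₁ * n 0 + F.W₂₂ * n 1 + F.C₁ * n 2 + F.E₁ * n 3 + p ^ (F.r₂ + F.d) * n 5] := rfl

theorem centre_apply (p : ℕ) (F : Frame) (u : ℤ × ℤ) :
    F.centre p u = (p ^ (F.r₀ + F.r₁ + F.d) * u.1,
    (p ^ (F.r₀ + F.d) * F.E - p ^ (F.r₁ + F.d) * F.A) * u.1 + p ^ (2 * F.r₁ + F.d) * u.2) := rfl

end Frame

namespace ShiftData

variable {p : ℕ} [hpf : Fact p.Prime] {L : AddSubgroup (Fin 6 → ℤ)} {M : AddSubgroup (ℤ × ℤ)}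
  {ψ : L →+ (Fin 6 → ZMod p)} (D : ShiftData p L M ψ)

theorem pow_ne (n : ℕ) : (p : ℤ) ^ n ≠ 0 :=
  pow_ne_zero _ (by exact_mod_cast hpf.out.ne_zero)

theorem T_two_eq_zero {l : L} (h : l.1 0 = 0) : (D.T l).1 2 = 0 := by
  have := D.T_two l
  rw [h, mul_zero] at this
  exact (mul_eq_zero.1 this).resolve_left (pow_ne _)

theorem T_three_eq_zero {l : L} (h : l.1 1 = 0) : (D.T l).1 3 = 0 := by
  have := D.T_three l
  rw [h, mul_zero] at this
  exact (mul_eq_zero.1 this).resolve_left (pow_ne _)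

theorem T_eq_zero {l : L} (h : ∀ i < 4, l.1 i = 0) : D.T l = 0 := by
  have h4 := D.T_four l
  have h5 := D.T_five l
  rw [h 2 (by decide), h 0 (by decide), mul_zero, mul_zero, add_zero] at h4
  rw [h 3 (by decide), h 1 (by decide), mul_zero, mul_zero, add_zero] at h5
  ext i
  fin_cases i
  · exact D.T_zero l
  · exact D.T_one l
  · exact D.T_two_eq_zero (h 0 (by decide))
  · exact D.T_three_eq_zero (h 1 (by decide))
  · exact (mul_eq_zero.1 h4).resolve_left (pow_ne _)
  · exact (mul_eq_zero.1 h5).resolve_left (pow_ne _)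

theorem TT_apply (l : L) : ∀ i < 4, (D.T (D.T l)).1 i = 0 := by
  intro i hi
  have h0 := D.T_zero l
  have h1 := D.T_one l
  fin_cases i
  · exact D.T_zero _
  · exact D.T_one _
  · exact D.T_two_eq_zero h0
  · exact D.T_three_eq_zero h1
  · exact absurd hi (by decide)
  · exact absurd hi (by decide)

theorem TTT (l : L) : D.T (D.T (D.T l)) = 0 := D.T_eq_zero (D.TT_apply l)

theorem TT_four (l : L) :
    (p : ℤ) ^ D.r * (D.T (D.T l)).1 4 = (p : ℤ) ^ D.r' * (D.T l).1 2 := by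
  have := D.T_four (D.T l)
  rw [D.T_zero, mul_zero, add_zero, two_mul, pow_add, pow_add, mul_assoc, mul_assoc] at this
  exact mul_left_cancel₀ (pow_ne _) this

theorem TT_five (l : L) :
    (p : ℤ) ^ D.r * (D.T (D.T l)).1 5 = (p : ℤ) ^ D.r' * (D.T l).1 3 := by
  have := D.T_five (D.T l)
  rw [D.T_one, mul_zero, add_zero, two_mul, pow_add, pow_add, mul_assoc, mul_assoc] at this
  exact mul_left_cancel₀ (pow_ne _) this

/-- The image of T is saturated at p. If Tx lies in pL, then ψ x lives in the last level and equals
ψ(T²y) for some y. So x - T²y = pk, and T³ = 0 gives Tx = pTk. -/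
theorem exists_of_smul_eq (hψ : Function.Surjective ψ)
    (hker : ∀ {l : L}, ψ l = 0 → ∃ k : L, l = (p : ℤ) • k) {l x : L}
    (h : (p : ℤ) • l = D.T x) : ∃ y, l = D.T y := by
  have h0 : ψ (D.T x) = 0 := by
    rw [← h, map_zsmul]
    ext i
    simp
  rw [D.ψ_T] at h0
  have e2 := congrFun h0 2
  have e3 := congrFun h0 3
  have e4 := congrFun h0 4
  have e5 := congrFun h0 5
  simp [D.τ_ne] at e2 e3
  simp [D.τ_ne, e2, e3] at e4 e5
  obtain ⟨y, hy⟩ := hψ ![ψ x 4 / D.τ ^ 2, ψ x 5 / D.τ ^ 2, 0, 0, 0, 0]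
  have hτ := D.τ_ne
  obtain ⟨k, hk⟩ := hker (l := x - D.T (D.T y)) (by
    rw [map_sub, D.ψ_T, D.ψ_T, hy, sub_eq_zero]
    ext i
    fin_cases i
    · simpa
    · simpa
    · simpa
    · simpa
    · simp; field_simp
    · simp; field_simp)
  refine ⟨k, ?_⟩
  have : D.T x = (p : ℤ) • D.T k := by
    rw [← map_zsmul, ← hk, map_sub, D.TTT, sub_zero]
  rw [this] at h
  have hp0 : (p : ℤ) ≠ 0 := by exact_mod_cast hpf.out.ne_zero
  ext i
  have := congrFun (congrArg Subtype.val h) i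
  exact mul_left_cancel₀ hp0 this

/-- Over ℚ such a vector is in the image of T, so a p-power multiple is in T(L), and saturation
removes the power. -/
theorem exists_eq_T {N : ℕ} (hL : ∀ z, (p : ℤ) ^ N • z ∈ L) (hψ : Function.Surjective ψ)
    (hker : ∀ {l : L}, ψ l = 0 → ∃ k : L, l = (p : ℤ) • k) {l : L} (h0 : l.1 0 = 0)
    (h1 : l.1 1 = 0) : ∃ y, l = D.T y := by
  have hind : ∀ n (x : L), (p : ℤ) ^ n • l = D.T x → ∃ y, l = D.T y := by
    intro n
    induction n with
    | zero => intro x hx; exact ⟨x, by simpa using hx⟩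
    | succ n ih =>
      intro x hx
      rw [pow_succ', mul_smul] at hx
      obtain ⟨y, hy⟩ := D.exists_of_smul_eq hψ hker hx
      exact ih y hy
  let a : ℤ := (p : ℤ) ^ (D.r + D.r')
  let b : ℤ := (p : ℤ) ^ D.r' * D.s
  let c : ℤ := (p : ℤ) ^ (2 * D.r)
  -- The preimage solves the formulas `T_two` to `T_five` with denominators cleared by a². The
  -- factor p^N puts it into L.
  refine hind (2 * (D.r + D.r') + N)
    ⟨_, hL ![a * c * l.1 2, a * c * l.1 3, c * (a * l.1 4 - b * l.1 2),
      c * (a * l.1 5 - b * l.1 3), 0, 0]⟩ ?_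
  ext i
  set x : L := ⟨_, hL ![a * c * l.1 2, a * c * l.1 3, c * (a * l.1 4 - b * l.1 2),
      c * (a * l.1 5 - b * l.1 3), 0, 0]⟩ with hx
  have x0 : x.1 0 = (p : ℤ) ^ N * (a * c * l.1 2) := by simp [hx]
  have x1 : x.1 1 = (p : ℤ) ^ N * (a * c * l.1 3) := by simp [hx]
  have x2 : x.1 2 = (p : ℤ) ^ N * (c * (a * l.1 4 - b * l.1 2)) := by simp [hx]
  have x3 : x.1 3 = (p : ℤ) ^ N * (c * (a * l.1 5 - b * l.1 3)) := by simp [hx]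
  have t2 := D.T_two x
  have t3 := D.T_three x
  have t4 := D.T_four x
  have t5 := D.T_five x
  fin_cases i
  · change (p : ℤ) ^ _ * l.1 0 = (D.T x).1 0
    rw [h0, D.T_zero, mul_zero]
  · change (p : ℤ) ^ _ * l.1 1 = (D.T x).1 1
    rw [h1, D.T_one, mul_zero]
  · change (p : ℤ) ^ _ * l.1 2 = (D.T x).1 2
    apply mul_left_cancel₀ (pow_ne (p := p) D.r)
    rw [t2, x0]; simp only [a, c]; ring
  · change (p : ℤ) ^ _ * l.1 3 = (D.T x).1 3
    apply mul_left_cancel₀ (pow_ne (p := p) D.r)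
    rw [t3, x1]; simp only [a, c]; ring
  · change (p : ℤ) ^ _ * l.1 4 = (D.T x).1 4
    apply mul_left_cancel₀ (pow_ne (p := p) (2 * D.r))
    rw [t4, x0, x2]; simp only [a, b, c]; ring
  · change (p : ℤ) ^ _ * l.1 5 = (D.T x).1 5
    apply mul_left_cancel₀ (pow_ne (p := p) (2 * D.r))
    rw [t5, x1, x3]; simp only [a, b, c]; ring

end ShiftData

namespace ShiftData

theorem form_eq {p : ℕ} {L : AddSubgroup (Fin 6 → ℤ)} {M : AddSubgroup (ℤ × ℤ)}
    {ψ : L →+ (Fin 6 → ZMod p)} (D : ShiftData p L M ψ) (l l' : L) : heiForm l.1 l'.1 =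
    (D.b₁ l l' * (p : ℤ) ^ D.r, D.b₁ l l' * D.s + D.b₂ l l' * (p : ℤ) ^ D.r') := by
  ext
  · rw [D.form_fst, mul_comm]
  · rw [D.form_snd]; ring

variable {p : ℕ} [hpf : Fact p.Prime] {L : AddSubgroup (Fin 6 → ℤ)} {M : AddSubgroup (ℤ × ℤ)}
  {ψ : L →+ (Fin 6 → ZMod p)} (D : ShiftData p L M ψ)

theorem le_of_pow_mul_eq {p : ℕ} (hp : p.Prime) {a b : ℕ} {x : ℤ}
    (h : (p : ℤ) ^ a * x = (p : ℤ) ^ b) : a ≤ b := by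
  have : (p : ℤ) ^ a ∣ (p : ℤ) ^ b := ⟨x, h.symm⟩
  have h2 : p ^ a ∣ p ^ b := by exact_mod_cast this
  exact (Nat.pow_dvd_pow_iff_le_right hp.one_lt).1 h2

theorem eq_pow_of_pow_mul_eq {p : ℕ} (hp : p.Prime) {a b : ℕ} {x : ℤ}
    (h : (p : ℤ) ^ a * x = (p : ℤ) ^ b) : x = (p : ℤ) ^ (b - a) := by
  have hab := le_of_pow_mul_eq hp h
  have hp0 : (p : ℤ) ^ a ≠ 0 := pow_ne_zero _ (by exact_mod_cast hp.ne_zero)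
  apply mul_left_cancel₀ hp0
  rw [h, ← pow_add, Nat.add_sub_cancel' hab]

/-- L is spanned by v, w and T(L). Iterating with T³ = 0 produces the basis, and the value of b₁(Tv,
w) links the exponents of L to those of M. -/
theorem exists_frame (D : ShiftData p L M ψ) {N : ℕ} (hL : ∀ z, (p : ℤ) ^ N • z ∈ L) (hψ : Function.Surjective ψ)
    {r₀ d : ℕ} (hdvd : ∀ l : L, (p : ℤ) ^ r₀ ∣ l.1 0 ∧ (p : ℤ) ^ (r₀ + d) ∣ l.1 1) {v w : L}
    (v0 : v.1 0 = (p : ℤ) ^ r₀) (v1 : v.1 1 = 0) (w0 : w.1 0 = 0)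
    (w1 : w.1 1 = (p : ℤ) ^ (r₀ + d)) :
    ∃ F : Frame, F.Valid p ∧ F.r₀ = r₀ ∧ F.d = d ∧ L = (F.map p).range ∧
      M = (F.centre p).range := by
  have hp : p.Prime := hpf.out
  have hker : ∀ {l : L}, ψ l = 0 → ∃ k : L, l = (p : ℤ) • k := fun h =>
    exists_eq_smul_of_map_eq_zero hp.ne_zero (index_ne_zero_of_smul_mem hp.ne_zero hL) hψ h
  -- every vector is a combination of two vectors and an element of the image of `T`
  have hdec : ∀ v : L, v.1 0 = (p : ℤ) ^ r₀ → v.1 1 = 0 → ∀ l : L,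
      ∃ (a b : ℤ) (k : L), l = a • v + b • w + D.T k := by
    intro v v0 v1 l
    obtain ⟨⟨a, ha⟩, ⟨b, hb⟩⟩ := hdvd l
    obtain ⟨k, hk⟩ := D.exists_eq_T hL hψ hker (l := l - a • v - b • w)
      (by change l.1 0 - a * v.1 0 - b * w.1 0 = 0; rw [ha, v0, w0]; ring)
      (by change l.1 1 - a * v.1 1 - b * w.1 1 = 0; rw [hb, v1, w1]; ring)
    exact ⟨a, b, k, by rw [← hk]; abel⟩
  -- the leading parts
  have hδ : ψ v 0 * ψ w 1 - ψ v 1 * ψ w 0 ≠ 0 := by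
    have hlead : ∀ (a b : ℤ) (k : L), ψ (a • v + b • w + D.T k) 0 = a * ψ v 0 + b * ψ w 0 ∧
        ψ (a • v + b • w + D.T k) 1 = a * ψ v 1 + b * ψ w 1 := by
      intro a b k
      rw [map_add, map_add, map_zsmul, map_zsmul, D.ψ_T]
      simp
    obtain ⟨l, hl⟩ := hψ (Pi.single 0 1)
    obtain ⟨l', hl'⟩ := hψ (Pi.single 1 1)
    obtain ⟨a, b, k, rfl⟩ := hdec v v0 v1 l
    obtain ⟨a', b', k', rfl⟩ := hdec v v0 v1 l'
    have e1 := hlead a b k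
    have e2 := hlead a' b' k'
    rw [hl] at e1
    rw [hl'] at e2
    obtain ⟨e1, e3⟩ := e1
    obtain ⟨e2, e4⟩ := e2
    simp at e1 e2 e3 e4
    intro h
    have : (1 : ZMod p) = 0 := by
      linear_combination (a * b' - b * a' : ZMod p) * h + e1 * (a' * ψ v 1 + b' * ψ w 1) +
        e4 - e2 * (a * ψ v 1 + b * ψ w 1)
    exact one_ne_zero this
  -- exponents
  have tv2 := D.T_two v
  have tv3 := D.T_three_eq_zero v1
  have tw2 := D.T_two_eq_zero w0
  have tw3 := D.T_three w
  rw [v0, ← pow_add] at tv2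
  rw [w1, ← pow_add] at tw3
  have hle1 := le_of_pow_mul_eq hp tv2
  replace tv2 := eq_pow_of_pow_mul_eq hp tv2
  replace tw3 := eq_pow_of_pow_mul_eq hp tw3
  have hb1' : (p : ℤ) ^ D.r * D.b₁ (D.T v) w = (p : ℤ) ^ (D.r' + r₀ - D.r + (r₀ + d)) := by
    rw [← D.form_fst, heiForm_fst, D.T_zero, D.T_one, tv2, tv3, w1, pow_add _ _ (r₀ + d)]; ring
  -- b₁(Tv, w) is a power of p by the equation above, and modulo p it is a nonzero multiple of the
  -- determinant of the leading parts. Hence it is 1, and r = r₀ + r₁ + d.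
  have hb1ne : ¬ (p : ℤ) ∣ D.b₁ (D.T v) w := by
    intro h
    have h2 := D.red (D.T v) w
    rw [(ZMod.intCast_zmod_eq_zero_iff_dvd _ _).2 h, D.ψ_T, heiForm_fst] at h2
    simp at h2
    have : D.τ * (ψ v 0 * ψ w 1 - ψ v 1 * ψ w 0) = 0 := by linear_combination -h2
    exact mul_ne_zero D.τ_ne hδ this
  have hle2 := le_of_pow_mul_eq hp hb1'
  have hb1e := eq_pow_of_pow_mul_eq hp hb1'
  have hr : D.r = D.r' + r₀ - D.r + (r₀ + d) := by
    by_contra hne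
    refine hb1ne ?_
    rw [hb1e]
    exact dvd_pow_self _ (by omega)
  have hb1one : D.b₁ (D.T v) w = 1 := by
    rw [hb1e, ← hr, Nat.sub_self, pow_zero]
  obtain ⟨r₁, hr₁⟩ : ∃ r₁, r₁ = D.r' + r₀ - D.r := ⟨_, rfl⟩
  have hrr : D.r = r₀ + r₁ + d := by omega
  have hrr' : D.r' = 2 * r₁ + d := by omega
  have ttv4 := D.TT_four v
  rw [tv2, ← hr₁, ← pow_add] at ttv4
  have hle3 := le_of_pow_mul_eq hp ttv4
  replace ttv4 := eq_pow_of_pow_mul_eq hp ttv4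
  have ttw5 := D.TT_five w
  rw [tw3, ← pow_add] at ttw5
  replace ttw5 := eq_pow_of_pow_mul_eq hp ttw5
  obtain ⟨r₂, hr₂⟩ : ∃ r₂, r₂ = D.r' + r₁ - D.r := ⟨_, rfl⟩
  rw [← hr₂] at ttv4
  rw [show D.r' + (D.r' + (r₀ + d) - D.r) - D.r = r₂ + d by omega] at ttw5
  rw [← hr₁] at tv2
  rw [show D.r' + (r₀ + d) - D.r = r₁ + d by omega] at tw3
  have ttv5 := D.TT_five v
  rw [tv3, mul_zero] at ttv5
  replace ttv5 := (mul_eq_zero.1 ttv5).resolve_left (pow_ne _)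
  have ttw4 := D.TT_four w
  rw [tw2, mul_zero] at ttw4
  replace ttw4 := (mul_eq_zero.1 ttw4).resolve_left (pow_ne _)
  -- adjust the first vector so that the two vectors commute
  set β := D.b₁ v w with hβ
  set γ := D.b₂ v w with hγ
  have f1 : heiForm v.1 w.1 = (β * (p : ℤ) ^ D.r, β * D.s + γ * (p : ℤ) ^ D.r') := D.form_eq _ _
  have f2 : heiForm (D.T v).1 w.1 = ((p : ℤ) ^ D.r, D.s + β * (p : ℤ) ^ D.r') := by
    rw [D.form_eq, hb1one, D.b₂_T, one_mul, one_mul]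
  have f3 : heiForm (D.T (D.T v)).1 w.1 = (0, (p : ℤ) ^ D.r') := by
    have h1 : (heiForm (D.T (D.T v)).1 w.1).1 = 0 := by
      rw [heiForm_fst, D.TT_apply v 0 (by decide), D.TT_apply v 1 (by decide),
        D.TT_apply v 2 (by decide), D.TT_apply v 3 (by decide)]
      ring
    have h2 : D.b₁ (D.T (D.T v)) w = 0 := by
      rw [D.form_fst] at h1
      exact (mul_eq_zero.1 h1).resolve_left (pow_ne _)
    rw [D.form_eq, h2, D.b₂_T, hb1one]
    simp
  -- The pairs (b₁, b₂) of v, Tv, T²v with w are (β, γ), (1, β), (0, 1). The coefficients solve the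
  -- resulting triangular system.
  set v' : L := v + (-β) • D.T v + (β ^ 2 - γ) • D.T (D.T v) with hv'
  have hv'z : v'.1 = v.1 + (-β) • (D.T v).1 + (β ^ 2 - γ) • (D.T (D.T v)).1 := rfl
  have hvw : heiForm v'.1 w.1 = 0 := by
    have hs : ∀ (n : ℤ) (x y : Fin 6 → ℤ), heiForm (n • x) y = n • heiForm x y := by
      intro n x y
      ext
      · simp [heiForm_fst]; ring
      · simp [heiForm_snd]; ring
    rw [hv'z, heiForm_add_left, heiForm_add_left, hs, hs, f1, f2, f3]
    ext
    · simp
    · simp; ring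
  have hTv' : D.T v' = D.T v + (-β) • D.T (D.T v) := by
    rw [hv', map_add, map_add, map_zsmul, map_zsmul, D.TTT, smul_zero, add_zero]
  have hTTv' : D.T (D.T v') = D.T (D.T v) := by
    rw [hTv', map_add, map_zsmul, D.TTT, smul_zero, add_zero]
  have u0 : v'.1 0 = (p : ℤ) ^ r₀ := by
    rw [hv'z]
    simp [v0, D.T_zero]
  have u1 : v'.1 1 = 0 := by
    rw [hv'z]
    simp [v1, D.T_one]
  have tu2 : (D.T v').1 2 = (p : ℤ) ^ r₁ := by
    rw [hTv']
    simp [tv2, D.TT_apply v 2 (by decide)]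
  have tu3 : (D.T v').1 3 = 0 := by
    rw [hTv']
    simp [tv3, D.TT_apply v 3 (by decide)]
  have hTvw : heiForm (D.T v').1 w.1 = ((p : ℤ) ^ D.r, D.s + D.b₂ (D.T v') w * (p : ℤ) ^ D.r') := by
    have h1 : D.b₁ (D.T v') w = 1 := by
      apply mul_left_cancel₀ (pow_ne (p := p) D.r)
      rw [← D.form_fst, heiForm_fst, D.T_zero, D.T_one, tu2, tu3, w1, hrr]
      ring
    rw [D.form_eq, h1, one_mul, one_mul]
  have e1 := congrArg Prod.fst hvw
  have e2 := congrArg Prod.snd hvw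
  rw [heiForm_fst, u0, u1, w0, w1] at e1
  rw [heiForm_snd, u0, u1, w0, w1] at e2
  have w3 : w.1 3 = -(p ^ d * v'.1 2) := by
    apply mul_left_cancel₀ (pow_ne (p := p) r₀)
    rw [pow_add] at e1
    simp only [Prod.fst_zero] at e1
    linear_combination e1
  rw [w3] at e2
  simp only [Prod.snd_zero] at e2
  have t4 := D.T_four v'
  have t5 := D.T_five v'
  have s4 := D.T_four w
  have s5 := D.T_five w
  rw [u0] at t4
  rw [u1, mul_zero, add_zero] at t5
  rw [w0, mul_zero, add_zero] at s4
  rw [w1, w3] at s5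
  have hx : (p : ℤ) ^ (2 * D.r) = (p : ℤ) ^ (r₀ + r₁ + d + r₁ + d) * (p : ℤ) ^ r₀ := by
    rw [← pow_add]; congr 1; omega
  have hy : (p : ℤ) ^ (D.r + D.r') = (p : ℤ) ^ (r₀ + r₁ + d + r₁ + d) * (p : ℤ) ^ r₁ := by
    rw [← pow_add]; congr 1; omega
  -- The entries are coordinates of v', w, Tv', Tw. The relation `W` comes from the vanishing
  -- pairing of v' with w, and `B`, `C`, `E` from the formulas for T in the last level.
  let F : Frame := ⟨r₀, r₁, r₂, d, v'.1 2, w.1 2, v'.1 3, (D.T v').1 4, v'.1 4, w.1 4, v'.1 5,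
    w.1 5, (D.T w).1 4, (D.T v').1 5, (D.T w).1 5⟩
  have hcoe : ∀ n, F.map p n = ((n 0 • v' + n 1 • w + D.T (n 2 • v' + n 3 • w +
      D.T (n 4 • v' + n 5 • w)) : L) : Fin 6 → ℤ) := by
    intro n
    simp only [map_add, map_zsmul, hTTv', AddSubgroup.coe_add, AddSubgroup.coe_zsmul]
    rw [F.map_apply]
    ext i
    fin_cases i
    · simp [F, u0, w0, D.T_zero]; ring
    · simp [F, u1, w1, D.T_one]; ring
    · simp [F, tu2, tw2, D.TT_apply _ 2 (by decide)]; ring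
    · simp [F, tu3, tw3, w3, D.TT_apply _ 3 (by decide)]; ring
    · simp [F, ttv4, ttw4]; ring
    · simp [F, ttv5, ttw5]; ring
  refine ⟨F, ⟨?_, ?_, ?_, ?_, ?_⟩, rfl, rfl, ?_, ?_⟩
  · change r₂ + r₀ = 2 * r₁; omega
  · change (p : ℤ) ^ r₀ * w.1 5 = p ^ d * v'.1 2 ^ 2 + w.1 2 * v'.1 3 - p ^ (r₀ + d) * v'.1 4
    linear_combination e2
  · change (p : ℤ) ^ r₀ * (D.T w).1 4 = p ^ r₁ * w.1 2
    rw [hx, hy, mul_assoc, mul_assoc] at s4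
    exact mul_left_cancel₀ (pow_ne _) s4
  · change (p : ℤ) ^ r₀ * (D.T v').1 5 = p ^ r₁ * v'.1 3
    rw [hx, hy, mul_assoc, mul_assoc] at t5
    exact mul_left_cancel₀ (pow_ne _) t5
  · change (p : ℤ) ^ r₀ * ((D.T w).1 5 - p ^ d * (D.T v').1 4) = -2 * p ^ (r₁ + d) * v'.1 2
    apply mul_left_cancel₀ (pow_ne (p := p) (r₀ + r₁ + d + r₁ + d))
    rw [hx, hy] at s5 t4
    rw [pow_add _ r₀ d] at s5
    rw [pow_add _ r₁ d]
    linear_combination s5 - p ^ d * t4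
  · ext l
    constructor
    · intro hl
      obtain ⟨a, b, k, hk⟩ := hdec v' u0 u1 ⟨l, hl⟩
      obtain ⟨a', b', k', rfl⟩ := hdec v' u0 u1 k
      obtain ⟨a'', b'', k'', rfl⟩ := hdec v' u0 u1 k'
      refine ⟨![a, b, a', b', a'', b''], (hcoe _).trans ?_⟩
      have : l = (⟨l, hl⟩ : L).1 := rfl
      rw [this, hk, map_add D.T (a'' • v' + b'' • w), map_add, map_add D.T _ (D.T _ + _),
        map_add D.T (D.T _), D.TTT, add_zero]
      simp
    · rintro ⟨n, rfl⟩
      rw [hcoe]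
      exact Subtype.prop _
  · have hc : ∀ u : ℤ × ℤ, F.centre p u = (u.1 * (p : ℤ) ^ D.r,
        u.1 * D.s + (u.1 * D.b₂ (D.T v') w + u.2) * (p : ℤ) ^ D.r') := by
      intro u
      have h2 := congrArg Prod.snd hTvw
      rw [heiForm_snd, D.T_zero, D.T_one, tu2, tu3, w0, w1, w3] at h2
      rw [F.centre_apply]
      ext
      · change (p : ℤ) ^ (r₀ + r₁ + d) * u.1 = _
        rw [hrr, mul_comm]
      · change ((p : ℤ) ^ (r₀ + d) * (D.T v').1 4 - p ^ (r₁ + d) * v'.1 2) * u.1 +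
          p ^ (2 * r₁ + d) * u.2 = _
        rw [← hrr']
        simp only at h2 ⊢
        rw [pow_add _ r₁ d]
        linear_combination u.1 * h2
    ext u
    constructor
    · intro hu
      obtain ⟨x, y, rfl⟩ := D.eq_of_mem u hu
      refine ⟨(x, y - x * D.b₂ (D.T v') w), ?_⟩
      rw [hc]
      ext <;> simp
    · rintro ⟨u, rfl⟩
      rw [hc]
      have := M.add_mem (M.zsmul_mem D.mem₁ u.1)
        (M.zsmul_mem D.mem₂ (u.1 * D.b₂ (D.T v') w + u.2))
      convert this using 1
      ext <;> simp

end ShiftData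

/-! ### Reduced frames and the group acting on frames. -/

namespace Frame

/-- The coordinates that are not determined by the others lie in fundamental domains. -/
structure Reduced (p : ℕ) (F : Frame) : Prop where
  A : 0 ≤ F.A ∧ F.A < p ^ F.r₁
  B : 0 ≤ F.B ∧ F.B < p ^ F.r₁
  C : 0 ≤ F.C ∧ F.C < p ^ (F.r₁ + F.d)
  E : 0 ≤ F.E ∧ F.E < p ^ F.r₂
  W₁₁ : 0 ≤ F.W₁₁ ∧ F.W₁₁ < p ^ F.r₂
  W₁₂ : 0 ≤ F.W₁₂ ∧ F.W₁₂ < p ^ F.r₂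
  W₂₁ : 0 ≤ F.W₂₁ ∧ F.W₂₁ < p ^ (F.r₂ + F.d)

/-- Change of a frame by a unipotent matrix. -/
def move (p : ℕ) (F : Frame) (x y z k a b c : ℤ) : Frame where
  r₀ := F.r₀
  r₁ := F.r₁
  r₂ := F.r₂
  d := F.d
  A := F.A + x * p ^ F.r₁
  B := F.B + y * p ^ F.r₁
  C := F.C + z * p ^ (F.r₁ + F.d)
  E := F.E + (x + k) * p ^ F.r₂
  W₁₁ := F.W₁₁ + x * F.E + z * F.B₁ + a * p ^ F.r₂
  W₁₂ := F.W₁₂ + y * F.E - x * F.B₁ + b * p ^ F.r₂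
  W₂₁ := F.W₂₁ + x * F.C₁ + z * F.E₁ + c * p ^ (F.r₂ + F.d)
  W₂₂ := F.W₂₂ + y * F.C₁ - x * F.E₁ + (x ^ 2 + y * z - a) * p ^ (F.r₂ + F.d)
  B₁ := F.B₁ + y * p ^ F.r₂
  C₁ := F.C₁ + z * p ^ (F.r₂ + F.d)
  E₁ := F.E₁ + (k - x) * p ^ (F.r₂ + F.d)

variable {p : ℕ} {F : Frame}

theorem Valid.pow_eq (h : F.Valid p) : (p : ℤ) ^ F.r₂ * p ^ F.r₀ = p ^ F.r₁ * p ^ F.r₁ := by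
  rw [← pow_add, ← pow_add, h.r, two_mul]

/-- The new v, w arise from the old ones by a matrix 1 + tN + t²N' with N traceless. The entry x² +
yz - a makes its determinant 1 modulo t³. The parameter k replaces T by T + kT². -/
theorem Valid.move (h : F.Valid p) (x y z k a b c : ℤ) : (F.move p x y z k a b c).Valid p := by
  obtain ⟨hr, hW, hB, hC, hE⟩ := h
  have h2 : (p : ℤ) ^ F.r₂ * p ^ F.r₀ = p ^ F.r₁ * p ^ F.r₁ := by
    rw [← pow_add, ← pow_add, hr, two_mul]
  refine ⟨hr, ?_, ?_, ?_, ?_⟩ <;> simp only [Frame.move, pow_add] at *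
  · linear_combination hW + y * hC - x * hE + z * p ^ F.d * hB +
      (x ^ 2 + y * z - a) * p ^ F.d * h2 + a * p ^ F.d * h2
  · linear_combination hB + y * h2
  · linear_combination hC + z * p ^ F.d * h2
  · linear_combination hE - 2 * x * p ^ F.d * h2

theorem range_map_move (x y z k a b c : ℤ) :
    ((F.move p x y z k a b c).map p).range = (F.map p).range := by
  ext l
  constructor
  · rintro ⟨n, rfl⟩
    refine ⟨![n 0, n 1, n 2 + x * n 0 + y * n 1, n 3 + z * n 0 - x * n 1,
      n 4 + a * n 0 + b * n 1 + (x + k) * n 2 + y * n 3,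
      n 5 + c * n 0 + (x ^ 2 + y * z - a) * n 1 + z * n 2 + (k - x) * n 3], ?_⟩
    rw [map_apply, map_apply]
    ext i
    fin_cases i <;> simp [move] <;> ring
  · rintro ⟨n, rfl⟩
    obtain ⟨n2, h2⟩ : ∃ m, m = n 2 - x * n 0 - y * n 1 := ⟨_, rfl⟩
    obtain ⟨n3, h3⟩ : ∃ m, m = n 3 - z * n 0 + x * n 1 := ⟨_, rfl⟩
    refine ⟨![n 0, n 1, n2, n3, n 4 - a * n 0 - b * n 1 - (x + k) * n2 - y * n3,
      n 5 - c * n 0 - (x ^ 2 + y * z - a) * n 1 - z * n2 - (k - x) * n3], ?_⟩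
    rw [map_apply, map_apply]
    ext i
    fin_cases i <;> simp [move, h2, h3] <;> ring

/-- The contributions of x to the off-diagonal entry cancel because r₂ + r₀ = 2r₁. Only k acts on M,
by an integral shear. -/
theorem range_centre_move (h : F.Valid p) (x y z k a b c : ℤ) :
    ((F.move p x y z k a b c).centre p).range = (F.centre p).range := by
  have h2 := h.pow_eq
  ext l
  constructor
  · rintro ⟨n, rfl⟩
    refine ⟨(n.1, n.2 + k * n.1), ?_⟩
    rw [centre_apply, centre_apply]
    ext
    · simp [move]
    · simp only [move, pow_add, two_mul]
      linear_combination (-n.1 * (x + k) * p ^ F.d) * h2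
  · rintro ⟨n, rfl⟩
    refine ⟨(n.1, n.2 - k * n.1), ?_⟩
    rw [centre_apply, centre_apply]
    ext
    · simp [move]
    · simp only [move, pow_add, two_mul]
      linear_combination (n.1 * (x + k) * p ^ F.d) * h2

theorem exists_reduced (hp : 0 < p) (h : F.Valid p) : ∃ F' : Frame, F'.Valid p ∧ F'.Reduced p ∧
    F'.r₀ = F.r₀ ∧ F'.d = F.d ∧ (F'.map p).range = (F.map p).range ∧
    (F'.centre p).range = (F.centre p).range := by
  have hn : ∀ n, (0 : ℤ) < (p : ℤ) ^ n := fun n => pow_pos (by exact_mod_cast hp) n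
  have hmod : ∀ (u : ℤ) (n : ℕ), 0 ≤ u + -(u / (p : ℤ) ^ n) * (p : ℤ) ^ n ∧
      u + -(u / (p : ℤ) ^ n) * (p : ℤ) ^ n < (p : ℤ) ^ n := by
    intro u n
    have e : u + -(u / (p : ℤ) ^ n) * (p : ℤ) ^ n = u % (p : ℤ) ^ n := by
      rw [Int.emod_def]; ring
    rw [e]
    exact ⟨Int.emod_nonneg _ (hn n).ne', Int.emod_lt_of_pos _ (hn n)⟩
  -- x, y, z normalize level 1. Then k is shifted by -x because E moves by x + k, and a, b, c
  -- normalize the entries W that x, y, z have disturbed.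
  obtain ⟨x, hx⟩ : ∃ x, x = -(F.A / (p : ℤ) ^ F.r₁) := ⟨_, rfl⟩
  obtain ⟨y, hy⟩ : ∃ y, y = -(F.B / (p : ℤ) ^ F.r₁) := ⟨_, rfl⟩
  obtain ⟨z, hz⟩ : ∃ z, z = -(F.C / (p : ℤ) ^ (F.r₁ + F.d)) := ⟨_, rfl⟩
  refine ⟨F.move p x y z (-(F.E / (p : ℤ) ^ F.r₂) - x)
    (-((F.W₁₁ + x * F.E + z * F.B₁) / (p : ℤ) ^ F.r₂))
    (-((F.W₁₂ + y * F.E - x * F.B₁) / (p : ℤ) ^ F.r₂))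
    (-((F.W₂₁ + x * F.C₁ + z * F.E₁) / (p : ℤ) ^ (F.r₂ + F.d))), h.move _ _ _ _ _ _ _,
    ⟨?_, ?_, ?_, ?_, ?_, ?_, ?_⟩, rfl, rfl, range_map_move _ _ _ _ _ _ _,
    range_centre_move h _ _ _ _ _ _ _⟩
  · simp only [move, hx]; exact hmod _ _
  · simp only [move, hy]; exact hmod _ _
  · simp only [move, hz]; exact hmod _ _
  · simp only [move]
    rw [show x + (-(F.E / (p : ℤ) ^ F.r₂) - x) = -(F.E / (p : ℤ) ^ F.r₂) by ring]
    exact hmod _ _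
  · simp only [move]; exact hmod _ _
  · simp only [move]; exact hmod _ _
  · simp only [move]; exact hmod _ _

theorem map_injective (hp : 0 < p) : Function.Injective (F.map p) := by
  have hn : ∀ n, (p : ℤ) ^ n ≠ 0 := fun n => (pow_pos (by exact_mod_cast hp) n).ne'
  have hp' : p ≠ 0 := hp.ne'
  rw [injective_iff_map_eq_zero]
  intro n h
  rw [map_apply] at h
  have h0 := congrFun h 0
  have h1 := congrFun h 1
  have h2 := congrFun h 2
  have h3 := congrFun h 3
  have h4 := congrFun h 4
  have h5 := congrFun h 5
  simp [hp'] at h0 h1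
  simp [hp', h0, h1] at h2 h3
  simp [hp', h0, h1, h2, h3] at h4 h5
  ext i
  fin_cases i <;> simpa

theorem centre_injective (hp : 0 < p) : Function.Injective (F.centre p) := by
  have hp' : p ≠ 0 := hp.ne'
  rw [injective_iff_map_eq_zero]
  intro n h
  rw [centre_apply] at h
  have h0 := congrArg Prod.fst h
  have h1 := congrArg Prod.snd h
  simp [hp'] at h0
  simp [hp', h0] at h1
  exact Prod.ext h0 h1

/-- The relations in `Valid` account for all coefficients of the difference of the two sides. -/
theorem Valid.heiForm_map (h : F.Valid p) (z w : Fin 6 → ℤ) :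
    heiForm (F.map p z) (F.map p w) = F.centre p (heiForm z w) := by
  have h2 := h.pow_eq
  obtain ⟨hr, hW, hB, hC, hE⟩ := h
  ext
  · rw [centre_apply, heiForm_fst, heiForm_fst, map_apply, map_apply]
    simp [pow_add]
    ring
  · rw [centre_apply, heiForm_snd, heiForm_fst, heiForm_snd, map_apply, map_apply]
    simp only [pow_add, two_mul] at *
    simp
    linear_combination (z 0 * w 1 - z 1 * w 0) * hW + (z 1 * w 3 - z 3 * w 1) * (-(p:ℤ) ^ F.d) * hB +
      (z 0 * w 2 - z 2 * w 0) * hC + (z 0 * w 3 - z 3 * w 0) * hE +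
      (z 0 * w 5 - z 5 * w 0 + z 4 * w 1 - z 1 * w 4) * p ^ F.d * h2

end Frame

/-! ### Rotations and the projective line over ℤ/p^d. -/

/-- The action of a `2 × 2` matrix on `(R[t]/t³)²`. -/
def slMap (a b c e : ℤ) : (Fin 6 → ℤ) →+ (Fin 6 → ℤ) :=
  AddMonoidHom.mk' (fun l => ![a * l 0 + b * l 1, c * l 0 + e * l 1, a * l 2 + b * l 3,
    c * l 2 + e * l 3, a * l 4 + b * l 5, c * l 4 + e * l 5])
    (fun x y => by ext i; fin_cases i <;> simp <;> ring)

theorem slMap_apply (a b c e : ℤ) (l : Fin 6 → ℤ) : slMap a b c e l =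
    ![a * l 0 + b * l 1, c * l 0 + e * l 1, a * l 2 + b * l 3,
    c * l 2 + e * l 3, a * l 4 + b * l 5, c * l 4 + e * l 5] := rfl

theorem slMap_slMap {a b c e : ℤ} (h : a * e - b * c = 1) (l : Fin 6 → ℤ) :
    slMap a b c e (slMap e (-b) (-c) a l) = l := by
  rw [slMap_apply, slMap_apply]
  ext i
  fin_cases i <;> simp
  · linear_combination l 0 * h
  · linear_combination l 1 * h
  · linear_combination l 2 * h
  · linear_combination l 3 * h
  · linear_combination l 4 * h
  · linear_combination l 5 * h

theorem heiForm_slMap {a b c e : ℤ} (h : a * e - b * c = 1) (z w : Fin 6 → ℤ) :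
    heiForm (slMap a b c e z) (slMap a b c e w) = heiForm z w := by
  ext
  · rw [slMap_apply, slMap_apply, heiForm_fst, heiForm_fst]
    simp
    linear_combination (z 0 * w 3 - z 1 * w 2 + z 2 * w 1 - z 3 * w 0) * h
  · rw [slMap_apply, slMap_apply, heiForm_snd, heiForm_snd]
    simp
    linear_combination
      (z 0 * w 5 - z 1 * w 4 + z 2 * w 3 - z 3 * w 2 + z 4 * w 1 - z 5 * w 0) * h

/-- The rotation with the given label: the labels in `rotSet p d` are the points of the projective
line over `ℤ/p^d`. -/
def rot (p : ℕ) : ℕ ⊕ ℕ → (Fin 6 → ℤ) →+ (Fin 6 → ℤ)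
  | .inl c => slMap 1 0 c 1
  | .inr c => slMap (p * c) (-1) 1 0

/-- The inverse rotation. -/
def rotInv (p : ℕ) : ℕ ⊕ ℕ → (Fin 6 → ℤ) →+ (Fin 6 → ℤ)
  | .inl c => slMap 1 0 (-c) 1
  | .inr c => slMap 0 1 (-1) (p * c)

/-- The labels of the points of the projective line over `ℤ/p^d`. -/
def rotSet (p d : ℕ) : Finset (ℕ ⊕ ℕ) :=
  (Finset.range (p ^ d)).disjSum (if d = 0 then ∅ else Finset.range (p ^ (d - 1)))

theorem card_rotSet (p d : ℕ) :
    (rotSet p d).card = p ^ d + if d = 0 then 0 else p ^ (d - 1) := by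
  rw [rotSet, Finset.card_disjSum, Finset.card_range]
  split_ifs <;> simp

theorem inl_mem_rotSet {p d c : ℕ} : Sum.inl c ∈ rotSet p d ↔ c < p ^ d := by
  simp [rotSet]

theorem inr_mem_rotSet {p d c : ℕ} : Sum.inr c ∈ rotSet p d ↔ d ≠ 0 ∧ c < p ^ (d - 1) := by
  rw [rotSet, Finset.inr_mem_disjSum]
  split_ifs with h <;> simp [h]

theorem rot_rotInv (p : ℕ) (γ : ℕ ⊕ ℕ) (l : Fin 6 → ℤ) : rot p γ (rotInv p γ l) = l := by
  cases γ with
  | inl c => simpa [rot, rotInv] using slMap_slMap (a := 1) (b := 0) (c := c) (e := 1) (by ring) l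
  | inr c => simpa [rot, rotInv] using slMap_slMap (a := p * c) (b := -1) (c := 1) (e := 0) (by ring) l

theorem rotInv_rot (p : ℕ) (γ : ℕ ⊕ ℕ) (l : Fin 6 → ℤ) : rotInv p γ (rot p γ l) = l := by
  cases γ with
  | inl c => simpa [rot, rotInv] using slMap_slMap (a := 1) (b := 0) (c := -c) (e := 1) (by ring) l
  | inr c => simpa [rot, rotInv] using slMap_slMap (a := 0) (b := 1) (c := -1) (e := p * c) (by ring) l

theorem heiForm_rot (p : ℕ) (γ : ℕ ⊕ ℕ) (z w : Fin 6 → ℤ) :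
    heiForm (rot p γ z) (rot p γ w) = heiForm z w := by
  cases γ with
  | inl c => exact heiForm_slMap (by ring) z w
  | inr c => exact heiForm_slMap (by ring) z w

theorem exists_not_forall_dvd {p : ℕ} (hp : p.Prime) {S : AddSubgroup (ℤ × ℤ)} {N : ℕ}
    (hS : ∀ u, (p : ℤ) ^ N • u ∈ S) : ∃ n, (∀ u ∈ S, (p : ℤ) ^ n ∣ u.1 ∧ (p : ℤ) ^ n ∣ u.2) ∧
      ¬ ∀ u ∈ S, (p : ℤ) ^ (n + 1) ∣ u.1 ∧ (p : ℤ) ^ (n + 1) ∣ u.2 := by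
  by_contra! h
  have hall : ∀ n, ∀ u ∈ S, (p : ℤ) ^ n ∣ u.1 ∧ (p : ℤ) ^ n ∣ u.2 := by
    intro n
    induction n with
    | zero => intro u _; simp
    | succ n ih => exact h n ih
  have h1 := (hall (N + 1) _ (hS (1, 0))).1
  simp only [Prod.smul_mk, smul_eq_mul, mul_one] at h1
  have h2 : p ^ (N + 1) ∣ p ^ N := by exact_mod_cast h1
  have := (Nat.pow_dvd_pow_iff_le_right hp.one_lt).1 h2
  omega

/-- A primitive plane lattice of p-power index has cyclic quotient ℤ/p^d. It is the kernel of a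
primitive linear functional modulo p^d, that is, a point of the projective line in one of its two
charts. -/
theorem plane_primitive {p : ℕ} (hp : p.Prime) {S : AddSubgroup (ℤ × ℤ)} {N : ℕ}
    (hS : ∀ u, (p : ℤ) ^ N • u ∈ S) (hprim : ¬ ∀ u ∈ S, (p : ℤ) ∣ u.1 ∧ (p : ℤ) ∣ u.2) :
    ∃ d : ℕ, (∃ c < p ^ d, (∀ u ∈ S, (p : ℤ) ^ d ∣ u.2 - c * u.1) ∧ ((1 : ℤ), (c : ℤ)) ∈ S ∧
        ((0 : ℤ), (p : ℤ) ^ d) ∈ S) ∨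
      (d ≠ 0 ∧ ∃ c < p ^ (d - 1), (∀ u ∈ S, (p : ℤ) ^ d ∣ p * c * u.2 - u.1) ∧
        ((p * c : ℤ), (1 : ℤ)) ∈ S ∧ (-(p : ℤ) ^ d, (0 : ℤ)) ∈ S) := by
  have hn : ∀ n, (0 : ℤ) < (p : ℤ) ^ n := fun n => pow_pos (by exact_mod_cast hp.pos) n
  obtain ⟨r, r', s, m1, m2, hm⟩ := AddSubgroup.exists_hermite hp S hS
  have hmem : ∀ x y : ℤ, (x * (p : ℤ) ^ r, x * s + y * (p : ℤ) ^ r') ∈ S := by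
    intro x y
    have := S.add_mem (S.zsmul_mem m1 x) (S.zsmul_mem m2 y)
    simpa using this
  rcases Nat.eq_zero_or_pos r with rfl | hr
  · refine ⟨r', Or.inl ⟨(s % (p : ℤ) ^ r').toNat, ?_, ?_, ?_, m2⟩⟩
    · have := Int.emod_lt_of_pos s (hn r')
      zify
      rwa [Int.toNat_of_nonneg (Int.emod_nonneg _ (hn r').ne')]
    · intro u hu
      obtain ⟨x, y, rfl⟩ := hm u hu
      rw [Int.toNat_of_nonneg (Int.emod_nonneg _ (hn r').ne'), Int.emod_def]
      exact ⟨y + x * (s / (p : ℤ) ^ r'), by simp; ring⟩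
    · rw [Int.toNat_of_nonneg (Int.emod_nonneg _ (hn r').ne'), Int.emod_def]
      convert hmem 1 (-(s / (p : ℤ) ^ r')) using 2
      · simp
      · ring
  · -- a label for the remaining cases
    have key : ∀ (c₀ : ℤ) (e : ℕ), e ≠ 0 → (∀ u ∈ S, (p : ℤ) ^ e ∣ p * c₀ * u.2 - u.1) →
        (p * c₀, (1 : ℤ)) ∈ S → (-(p : ℤ) ^ e, (0 : ℤ)) ∈ S →
        ∃ c < p ^ (e - 1), (∀ u ∈ S, (p : ℤ) ^ e ∣ p * c * u.2 - u.1) ∧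
        ((p * c : ℤ), (1 : ℤ)) ∈ S ∧ (-(p : ℤ) ^ e, (0 : ℤ)) ∈ S := by
      intro c₀ e he h1 h2 h3
      have hpe : (p : ℤ) ^ e = p * (p : ℤ) ^ (e - 1) := by
        rw [← pow_succ', Nat.sub_add_cancel (Nat.pos_of_ne_zero he)]
      have hc := Int.toNat_of_nonneg (Int.emod_nonneg c₀ (hn (e - 1)).ne')
      refine ⟨(c₀ % (p : ℤ) ^ (e - 1)).toNat, ?_, ?_, ?_, h3⟩
      · zify
        rw [hc]
        exact Int.emod_lt_of_pos _ (hn _)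
      · intro u hu
        obtain ⟨k, hk⟩ := h1 u hu
        rw [hc, Int.emod_def]
        exact ⟨k - c₀ / (p : ℤ) ^ (e - 1) * u.2, by
          linear_combination hk + (c₀ / (p : ℤ) ^ (e - 1)) * u.2 * hpe⟩
      · rw [hc, Int.emod_def]
        convert S.add_mem h2 (S.zsmul_mem h3 (c₀ / (p : ℤ) ^ (e - 1))) using 1
        ext
        · simp [hpe]; ring
        · simp
    by_cases hs : (p : ℤ) ∣ s
    · have hr' : r' = 0 := by
        by_contra hr'
        refine hprim fun u hu => ?_
        obtain ⟨x, y, rfl⟩ := hm u hu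
        exact ⟨Dvd.dvd.mul_left (dvd_pow_self _ hr.ne') _,
          dvd_add (Dvd.dvd.mul_left hs _) (Dvd.dvd.mul_left (dvd_pow_self _ hr') _)⟩
      subst hr'
      refine ⟨r, Or.inr ⟨hr.ne', key 0 r hr.ne' ?_ ?_ ?_⟩⟩
      · intro u hu
        obtain ⟨x, y, rfl⟩ := hm u hu
        exact ⟨-x, by ring⟩
      · convert hmem 0 1 using 2 <;> simp
      · convert hmem (-1) s using 2 <;> ring
    -- Here s is prime to p. Bézout against p^(r + r') gives u with u·s ≡ 1, so the lattice contains
    -- (u·p^r, 1), whose first entry is divisible by p as r > 0.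
    · have hcop : IsCoprime s ((p : ℤ) ^ (r + r')) := by
        refine IsCoprime.pow_right ?_
        rw [isCoprime_comm]
        exact (Nat.prime_iff_prime_int.1 hp).coprime_iff_not_dvd.2 hs
      obtain ⟨u, t, hut⟩ := hcop
      have hpr : (p : ℤ) ^ r = p * (p : ℤ) ^ (r - 1) := by
        rw [← pow_succ', Nat.sub_add_cancel hr]
      refine ⟨r + r', Or.inr ⟨by omega, key (u * (p : ℤ) ^ (r - 1)) _ (by omega) ?_ ?_ ?_⟩⟩
      · intro v hv
        obtain ⟨x, y, rfl⟩ := hm v hv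
        refine ⟨u * y - x * (p : ℤ) ^ r * t, ?_⟩
        have : (p : ℤ) * (u * (p : ℤ) ^ (r - 1)) = u * (p : ℤ) ^ r := by rw [hpr]; ring
        simp only
        rw [this]
        rw [pow_add] at hut ⊢
        linear_combination x * (p : ℤ) ^ r * hut
      · convert hmem u (t * (p : ℤ) ^ r) using 2
        · rw [hpr]; ring
        · rw [pow_add] at hut
          linear_combination -hut
      · convert hmem (-(p : ℤ) ^ r') s using 2
        · rw [pow_add]; ring
        · ring

/-- The level-0 projection of L is its content p^r₀ times a primitive plane lattice, and the label
of that lattice gives the rotation. -/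
theorem exists_rot {p : ℕ} (hp : p.Prime) {L : AddSubgroup (Fin 6 → ℤ)} {N : ℕ}
    (hL : ∀ z, (p : ℤ) ^ N • z ∈ L) : ∃ (r₀ d : ℕ) (γ : ℕ ⊕ ℕ), γ ∈ rotSet p d ∧
      (∀ l ∈ L, (p : ℤ) ^ r₀ ∣ rotInv p γ l 0 ∧ (p : ℤ) ^ (r₀ + d) ∣ rotInv p γ l 1) ∧
      (∃ v ∈ L, rotInv p γ v 0 = (p : ℤ) ^ r₀ ∧ rotInv p γ v 1 = 0) ∧
      ∃ w ∈ L, rotInv p γ w 0 = 0 ∧ rotInv p γ w 1 = (p : ℤ) ^ (r₀ + d) := by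
  have hn : ∀ n, (p : ℤ) ^ n ≠ 0 := fun n => (pow_pos (by exact_mod_cast hp.pos) n).ne'
  let f : (Fin 6 → ℤ) →+ ℤ × ℤ := AddMonoidHom.mk' (fun l => (l 0, l 1)) (fun _ _ => rfl)
  have hS : ∀ u, (p : ℤ) ^ N • u ∈ L.map f := fun u =>
    ⟨(p : ℤ) ^ N • ![u.1, u.2, 0, 0, 0, 0], hL _, by simp [f]; rfl⟩
  obtain ⟨n, hn1, hn2⟩ := exists_not_forall_dvd hp hS
  let S : AddSubgroup (ℤ × ℤ) := (L.map f).comap (zsmulAddGroupHom ((p : ℤ) ^ n))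
  have hmemS : ∀ l ∈ L, ∃ u ∈ S, l 0 = (p : ℤ) ^ n * u.1 ∧ l 1 = (p : ℤ) ^ n * u.2 := by
    intro l hl
    obtain ⟨⟨x, hx⟩, ⟨y, hy⟩⟩ := hn1 (f l) ⟨l, hl, rfl⟩
    refine ⟨(x, y), ⟨l, hl, ?_⟩, hx, hy⟩
    exact Prod.ext hx hy
  have hSL : ∀ u ∈ S, ∃ l ∈ L, l 0 = (p : ℤ) ^ n * u.1 ∧ l 1 = (p : ℤ) ^ n * u.2 := by
    rintro u ⟨l, hl, e⟩
    exact ⟨l, hl, congrArg Prod.fst e, congrArg Prod.snd e⟩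
  obtain ⟨d, h⟩ := plane_primitive hp (S := S) (N := N) (fun u => by
      change (p : ℤ) ^ n • (p : ℤ) ^ N • u ∈ L.map f
      exact (L.map f).zsmul_mem (hS u) _) (by
      intro h
      refine hn2 ?_
      rintro _ ⟨l, hl, rfl⟩
      obtain ⟨u, hu, e1, e2⟩ := hmemS l hl
      change _ ∣ l 0 ∧ _ ∣ l 1
      rw [e1, e2, pow_succ]
      exact ⟨mul_dvd_mul_left _ (h u hu).1, mul_dvd_mul_left _ (h u hu).2⟩)
  rcases h with ⟨c, hc, h1, h2, h3⟩ | ⟨hd, c, hc, h1, h2, h3⟩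
  · refine ⟨n, d, .inl c, inl_mem_rotSet.2 hc, ?_, ?_, ?_⟩
    · intro l hl
      obtain ⟨u, hu, e1, e2⟩ := hmemS l hl
      obtain ⟨k, hk⟩ := h1 u hu
      rw [rotInv, slMap_apply]
      simp only [Matrix.cons_val]
      rw [e1, e2]
      refine ⟨⟨u.1, by ring⟩, ⟨k, ?_⟩⟩
      rw [pow_add]; linear_combination (p : ℤ) ^ n * hk
    · obtain ⟨v, hv, e1, e2⟩ := hSL _ h2
      refine ⟨v, hv, ?_⟩
      rw [rotInv, slMap_apply]
      simp only [Matrix.cons_val]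
      rw [e1, e2]
      constructor <;> simp only <;> ring
    · obtain ⟨v, hv, e1, e2⟩ := hSL _ h3
      refine ⟨v, hv, ?_⟩
      rw [rotInv, slMap_apply]
      simp only [Matrix.cons_val]
      rw [e1, e2]
      constructor <;> simp only <;> ring
  · refine ⟨n, d, .inr c, inr_mem_rotSet.2 ⟨hd, hc⟩, ?_, ?_, ?_⟩
    · intro l hl
      obtain ⟨u, hu, e1, e2⟩ := hmemS l hl
      obtain ⟨k, hk⟩ := h1 u hu
      rw [rotInv, slMap_apply]
      simp only [Matrix.cons_val]
      rw [e1, e2]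
      refine ⟨⟨u.2, by ring⟩, ⟨k, ?_⟩⟩
      rw [pow_add]; linear_combination (p : ℤ) ^ n * hk
    · obtain ⟨v, hv, e1, e2⟩ := hSL _ h2
      refine ⟨v, hv, ?_⟩
      rw [rotInv, slMap_apply]
      simp only [Matrix.cons_val]
      rw [e1, e2]
      constructor <;> simp only <;> ring
    · obtain ⟨v, hv, e1, e2⟩ := hSL _ h3
      refine ⟨v, hv, ?_⟩
      rw [rotInv, slMap_apply]
      simp only [Matrix.cons_val]
      rw [e1, e2]
      constructor <;> simp only <;> ring

/-! ### Uniqueness of the label and of the reduced frame. -/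

namespace Frame

variable {p : ℕ}

theorem eq_of_sub_eq_mul {n x y k : ℤ} (hx : 0 ≤ x ∧ x < n) (hy : 0 ≤ y ∧ y < n)
    (h : x = y + k * n) : x = y ∧ k = 0 := by
  have h1 : x % n = x := Int.emod_eq_of_lt hx.1 hx.2
  have h2 : y % n = y := Int.emod_eq_of_lt hy.1 hy.2
  have h3 : x = y := by rw [← h1, ← h2, h, Int.add_mul_emod_self_right]
  refine ⟨h3, ?_⟩
  have h4 : k * n = 0 := by linarith
  exact (mul_eq_zero.1 h4).resolve_right (by linarith [hx.1, hx.2])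

theorem le_of_dvd_pow (hp : p.Prime) {a b : ℕ} (h : (p : ℤ) ^ a ∣ (p : ℤ) ^ b) : a ≤ b := by
  have h2 : p ^ a ∣ p ^ b := by exact_mod_cast h
  exact (Nat.pow_dvd_pow_iff_le_right hp.one_lt).1 h2

/-- Reduced frames are determined by the lattices that they span. -/
theorem eq_of_range_eq (hp : p.Prime) {F G : Frame} (hF : F.Valid p) (hG : G.Valid p)
    (rF : F.Reduced p) (rG : G.Reduced p) (h0 : F.r₀ = G.r₀) (hd : F.d = G.d)
    (h : (F.map p).range = (G.map p).range) : F = G := by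
  have hn : ∀ n, (p : ℤ) ^ n ≠ 0 := fun n => (pow_pos (by exact_mod_cast hp.pos) n).ne'
  have hp0 := hp.ne_zero
  -- In vectors vanishing in level 0, the first level-1 coordinate ranges over the multiples of
  -- p^r₁.
  have hle : ∀ F G : Frame, (F.map p).range = (G.map p).range → G.r₁ ≤ F.r₁ := by
    intro F G h
    obtain ⟨n, e⟩ : F.map p (Pi.single 2 1) ∈ (G.map p).range := h ▸ ⟨_, rfl⟩
    rw [map_apply, map_apply] at e
    have e0 := congrFun e 0
    have e1 := congrFun e 1
    have e2 := congrFun e 2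
    simp [hp0] at e0 e1
    simp [e0, e1] at e2
    exact le_of_dvd_pow hp ⟨_, e2.symm⟩
  have h1 : F.r₁ = G.r₁ := le_antisymm (hle G F h.symm) (hle F G h)
  have h2 : F.r₂ = G.r₂ := by have := hF.r; have := hG.r; omega
  obtain ⟨r₀, r₁, r₂, d, A, B, C, E, W₁₁, W₁₂, W₂₁, W₂₂, B₁, C₁, E₁⟩ := F
  obtain ⟨r₀', r₁', r₂', d', A', B', C', E', W₁₁', W₁₂', W₂₁', W₂₂', B₁', C₁', E₁'⟩ := G
  simp only at h0 h1 h2 hd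
  subst h0 h1 h2 hd
  obtain ⟨n, e⟩ : Frame.map p ⟨r₀, r₁, r₂, d, A, B, C, E, W₁₁, W₁₂, W₂₁, W₂₂, B₁, C₁, E₁⟩
    (Pi.single 0 1) ∈
      (Frame.map p ⟨r₀, r₁, r₂, d, A', B', C', E', W₁₁', W₁₂', W₂₁', W₂₂', B₁', C₁', E₁'⟩).range :=
    h ▸ ⟨_, rfl⟩
  obtain ⟨m, f⟩ : Frame.map p ⟨r₀, r₁, r₂, d, A, B, C, E, W₁₁, W₁₂, W₂₁, W₂₂, B₁, C₁, E₁⟩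
    (Pi.single 1 1) ∈
      (Frame.map p ⟨r₀, r₁, r₂, d, A', B', C', E', W₁₁', W₁₂', W₂₁', W₂₂', B₁', C₁', E₁'⟩).range :=
    h ▸ ⟨_, rfl⟩
  obtain ⟨l, g⟩ : Frame.map p ⟨r₀, r₁, r₂, d, A, B, C, E, W₁₁, W₁₂, W₂₁, W₂₂, B₁, C₁, E₁⟩
    (Pi.single 2 1) ∈
      (Frame.map p ⟨r₀, r₁, r₂, d, A', B', C', E', W₁₁', W₁₂', W₂₁', W₂₂', B₁', C₁', E₁'⟩).range :=
    h ▸ ⟨_, rfl⟩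
  rw [map_apply, map_apply] at e f g
  have e0 := congrFun e 0
  have e1 := congrFun e 1
  have e2 := congrFun e 2
  have e3 := congrFun e 3
  have e4 := congrFun e 4
  have e5 := congrFun e 5
  have f0 := congrFun f 0
  have f1 := congrFun f 1
  have f2 := congrFun f 2
  have f3 := congrFun f 3
  have f4 := congrFun f 4
  have f5 := congrFun f 5
  have g0 := congrFun g 0
  have g1 := congrFun g 1
  have g2 := congrFun g 2
  have g3 := congrFun g 3
  have g4 := congrFun g 4
  simp [hp0] at e0 e1 f0 f1 g0 g1
  simp [e0, e1] at e2 e3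
  simp [f0, f1] at f2 f3
  simp [g0, g1, hp0] at g2 g3
  -- Two representatives in one fundamental domain agree and the connecting coefficient vanishes,
  -- which removes level 1 from the equations of level 2.
  obtain ⟨hA, n2⟩ := eq_of_sub_eq_mul rF.A rG.A (k := n 2) (by simp only; linear_combination -e2)
  obtain ⟨hC, n3⟩ := eq_of_sub_eq_mul rF.C rG.C (k := n 3) (by simp only; linear_combination -e3)
  obtain ⟨hB, m2⟩ := eq_of_sub_eq_mul rF.B rG.B (k := m 2) (by simp only; linear_combination -f2)
  simp only at hA hC hB
  subst hA hC hB
  simp [hp0] at f3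
  simp [e0, e1, n2, n3] at e4 e5
  simp [f0, f1, m2, f3] at f4 f5
  simp [g0, g1, g2, g3] at g4
  obtain ⟨hW11, -⟩ := eq_of_sub_eq_mul rF.W₁₁ rG.W₁₁ (k := n 4)
    (by simp only; linear_combination -e4)
  obtain ⟨hW21, -⟩ := eq_of_sub_eq_mul rF.W₂₁ rG.W₂₁ (k := n 5)
    (by simp only; linear_combination -e5)
  obtain ⟨hW12, -⟩ := eq_of_sub_eq_mul rF.W₁₂ rG.W₁₂ (k := m 4)
    (by simp only; linear_combination -f4)
  obtain ⟨hE, -⟩ := eq_of_sub_eq_mul rF.E rG.E (k := l 4)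
    (by simp only; linear_combination -g4)
  simp only at hW11 hW21 hW12 hE
  subst hW11 hW21 hW12 hE
  have a1 := hF.W.trans hG.W.symm
  have a2 := hF.B.trans hG.B.symm
  have a3 := hF.C.trans hG.C.symm
  have a4 := hF.E.trans hG.E.symm
  simp only [mul_eq_mul_left_iff, hn, or_false, sub_left_inj] at a1 a2 a3 a4
  simp only [a1, a2, a3, a4]

theorem rot_map_zero_one (γ : ℕ ⊕ ℕ) (F : Frame) (n : Fin 6 → ℤ) :
    rot p γ (F.map p n) 0 = (match γ with
      | .inl _ => p ^ F.r₀ * n 0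
      | .inr c => p * c * (p ^ F.r₀ * n 0) - p ^ (F.r₀ + F.d) * n 1) ∧
    rot p γ (F.map p n) 1 = (match γ with
      | .inl c => c * (p ^ F.r₀ * n 0) + p ^ (F.r₀ + F.d) * n 1
      | .inr _ => p ^ F.r₀ * n 0) := by
  cases γ with
  | inl c =>
    rw [rot, slMap_apply, map_apply]; simp
  | inr c =>
    rw [rot, slMap_apply, map_apply]; simp; ring

/-- p^r₀ divides all level-0 coordinates and is itself attained as one: the first in the chart
`inl`, the second in `inr`. -/
theorem r₀_le (hp : p.Prime) {γ γ' : ℕ ⊕ ℕ} {F G : Frame}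
    (h : ∀ n, ∃ m, rot p γ' (G.map p m) = rot p γ (F.map p n)) : G.r₀ ≤ F.r₀ := by
  obtain ⟨m, hm⟩ := h (Pi.single 0 1)
  have h0 := congrFun hm 0
  have h1 := congrFun hm 1
  rw [(rot_map_zero_one γ F _).1, (rot_map_zero_one γ' G _).1] at h0
  rw [(rot_map_zero_one γ F _).2, (rot_map_zero_one γ' G _).2] at h1
  have key : (p : ℤ) ^ G.r₀ ∣ (p : ℤ) ^ F.r₀ := by
    cases γ with
    | inl c =>
      simp at h0
      rw [← h0]
      cases γ' with
      | inl c' => exact ⟨_, rfl⟩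
      | inr c' => exact ⟨p * c' * m 0 - p ^ G.d * m 1, by simp only [pow_add]; ring⟩
    | inr c =>
      simp at h1
      rw [← h1]
      cases γ' with
      | inl c' => exact ⟨c' * m 0 + p ^ G.d * m 1, by simp only [pow_add]; ring⟩
      | inr c' => exact ⟨_, rfl⟩
  exact le_of_dvd_pow hp key

/-- In the chart `inr`, where d > 0, all first level-0 coordinates are divisible by p^(r₀ + 1),
while in `inl` one equals p^r₀. So the lattice separates the charts. Within a chart it determines d,
and c modulo its range. -/
theorem rot_cases (hp : p.Prime) {γ γ' : ℕ ⊕ ℕ} {F G : Frame} (hγ' : γ' ∈ rotSet p G.d)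
    (h0 : F.r₀ = G.r₀) (h : ∀ n, ∃ m, rot p γ' (G.map p m) = rot p γ (F.map p n)) :
    (γ.isLeft → γ'.isLeft) ∧ (γ.isLeft = γ'.isLeft →
      G.d ≤ F.d ∧ (F.d = G.d → γ ∈ rotSet p F.d → γ = γ')) := by
  have hn : ∀ n, (p : ℤ) ^ n ≠ 0 := fun n => (pow_pos (by exact_mod_cast hp.pos) n).ne'
  have hp0 : (p : ℤ) ≠ 0 := by exact_mod_cast hp.ne_zero
  obtain ⟨m, hm⟩ := h (Pi.single 0 1)
  obtain ⟨l, hl⟩ := h (Pi.single 1 1)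
  have m0 := congrFun hm 0
  have m1 := congrFun hm 1
  have l0 := congrFun hl 0
  have l1 := congrFun hl 1
  rw [(rot_map_zero_one γ F _).1, (rot_map_zero_one γ' G _).1] at m0 l0
  rw [(rot_map_zero_one γ F _).2, (rot_map_zero_one γ' G _).2] at m1 l1
  rw [h0, pow_add] at m0 m1 l0 l1
  have hcancel : ∀ x y : ℤ, (p : ℤ) ^ G.r₀ * x = p ^ G.r₀ * y → x = y := fun x y e =>
    mul_left_cancel₀ (hn _) e
  rw [pow_add] at m0 m1 l0 l1
  cases γ with
  | inl c =>
    cases γ' with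
    | inl c' =>
      refine ⟨fun _ => rfl, fun _ => ?_⟩
      simp [hp.ne_zero] at m0 l0
      simp [m0] at m1
      simp [l0] at l1
      have l2 := hcancel (p ^ G.d * l 1) (p ^ F.d) (by linear_combination l1)
      have m2 := hcancel (c' + p ^ G.d * m 1) c (by linear_combination m1)
      refine ⟨le_of_dvd_pow hp ⟨_, l2.symm⟩, fun hd hγ => ?_⟩
      rw [hd] at hγ
      rw [inl_mem_rotSet] at hγ hγ'
      have := eq_of_sub_eq_mul (x := c) (y := c') (n := p ^ G.d) (k := m 1)
        ⟨by positivity, by exact_mod_cast hγ⟩ ⟨by positivity, by exact_mod_cast hγ'⟩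
        (by linear_combination -m2)
      exact congrArg _ (by exact_mod_cast this.1)
    | inr c' =>
      exfalso
      rw [inr_mem_rotSet] at hγ'
      simp at m0
      have m2 := hcancel (p * c' * m 0 - p ^ G.d * m 1) 1 (by linear_combination m0)
      have hpd : (p : ℤ) ^ G.d = p * p ^ (G.d - 1) := by
        rw [← pow_succ', Nat.sub_add_cancel (Nat.pos_of_ne_zero hγ'.1)]
      have : (p : ℤ) ∣ 1 := ⟨c' * m 0 - p ^ (G.d - 1) * m 1, by
        rw [← m2, hpd]; ring⟩
      exact (Nat.prime_iff_prime_int.1 hp).not_dvd_one this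
  | inr c =>
    cases γ' with
    | inl c' => exact ⟨fun e => absurd e (by simp), fun e => absurd e (by simp)⟩
    | inr c' =>
      refine ⟨fun e => e, fun _ => ?_⟩
      simp [hp.ne_zero] at m1 l1
      simp [m1] at m0
      simp [l1] at l0
      have l2 := hcancel (p ^ G.d * l 1) (p ^ F.d) (by linear_combination l0)
      have m2 := hcancel (p * c' - p ^ G.d * m 1) (p * c) (by linear_combination m0)
      refine ⟨le_of_dvd_pow hp ⟨_, l2.symm⟩, fun hd hγ => ?_⟩
      rw [hd] at hγ
      rw [inr_mem_rotSet] at hγ hγ'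
      have hpd : (p : ℤ) ^ G.d = p * p ^ (G.d - 1) := by
        rw [← pow_succ', Nat.sub_add_cancel (Nat.pos_of_ne_zero hγ'.1)]
      have m3 : (c' - p ^ (G.d - 1) * m 1 : ℤ) = c := by
        apply mul_left_cancel₀ hp0
        rw [← m2, hpd]; ring
      have := eq_of_sub_eq_mul (x := c) (y := c') (n := p ^ (G.d - 1)) (k := -m 1)
        ⟨by positivity, by exact_mod_cast hγ.2⟩ ⟨by positivity, by exact_mod_cast hγ'.2⟩
        (by linear_combination -m3)
      exact congrArg _ (by exact_mod_cast this.1)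

theorem eq_of_rot_range_eq (hp : p.Prime) {F G : Frame} (hF : F.Valid p) (hG : G.Valid p)
    (rF : F.Reduced p) (rG : G.Reduced p) {γ γ' : ℕ ⊕ ℕ} (hγ : γ ∈ rotSet p F.d)
    (hγ' : γ' ∈ rotSet p G.d)
    (h : ((rot p γ).comp (F.map p)).range = ((rot p γ').comp (G.map p)).range) :
    γ = γ' ∧ F = G := by
  have h1 : ∀ n, ∃ m, rot p γ' (G.map p m) = rot p γ (F.map p n) := fun n => by
    have : rot p γ (F.map p n) ∈ ((rot p γ).comp (F.map p)).range := ⟨n, rfl⟩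
    rw [h] at this
    exact this
  have h2 : ∀ n, ∃ m, rot p γ (F.map p m) = rot p γ' (G.map p n) := fun n => by
    have : rot p γ' (G.map p n) ∈ ((rot p γ').comp (G.map p)).range := ⟨n, rfl⟩
    rw [← h] at this
    exact this
  have h0 : F.r₀ = G.r₀ := le_antisymm (r₀_le hp h2) (r₀_le hp h1)
  have c1 := rot_cases hp hγ' h0 h1
  have c2 := rot_cases hp hγ h0.symm h2
  have key : F.d = G.d ∧ γ = γ' := by
    have e : γ.isLeft = γ'.isLeft := Bool.eq_iff_iff.2 ⟨c1.1, c2.1⟩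
    have hd := le_antisymm (c2.2 e.symm).1 (c1.2 e).1
    exact ⟨hd, (c1.2 e).2 hd hγ⟩
  obtain ⟨hd, rfl⟩ := key
  refine ⟨rfl, eq_of_range_eq hp hF hG rF rG h0 hd ?_⟩
  ext l
  constructor
  · rintro ⟨n, rfl⟩
    obtain ⟨m, hm⟩ := h1 n
    refine ⟨m, ?_⟩
    rw [← rotInv_rot p γ (G.map p m), hm, rotInv_rot]
  · rintro ⟨n, rfl⟩
    obtain ⟨m, hm⟩ := h2 n
    refine ⟨m, ?_⟩
    rw [← rotInv_rot p γ (F.map p m), hm, rotInv_rot]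

end Frame

/-! ### Indices, and the bijection between subgroups and framed data. -/

theorem AddMonoidHom.index_range_eq_natAbs_det {n : ℕ} {E : Type} [AddCommGroup E]
    (b : Module.Basis (Fin n) ℤ E) {f : E →+ E} (hf : Function.Injective f) :
    f.range.index = (Matrix.of fun i j => b.repr (f (b j)) i).det.natAbs :=
  AddSubgroup.index_eq_natAbs_det b f.range (b.map (AddMonoidHom.ofInjective hf).toIntLinearEquiv)

namespace Frame

variable {p : ℕ}

/-- The matrix is triangular, and its exponents sum to 2(r₀ + r₁ + r₂) + 3d with r₀ + r₂ = 2r₁. -/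
theorem index_range_map (hp : 0 < p) {F : Frame} (h : F.Valid p) :
    (F.map p).range.index = p ^ (6 * F.r₁ + 3 * F.d) := by
  rw [AddMonoidHom.index_range_eq_natAbs_det (Pi.basisFun ℤ (Fin 6)) (map_injective hp),
    Matrix.det_of_isLowerTriangular]
  · have e : (p : ℤ) ^ F.r₀ * (p ^ (F.r₀ + F.d) * (p ^ F.r₁ * (p ^ (F.r₁ + F.d) *
        (p ^ F.r₂ * p ^ (F.r₂ + F.d))))) = ((p ^ (6 * F.r₁ + 3 * F.d) : ℕ) : ℤ) := by
      rw [Nat.cast_pow]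
      simp only [← pow_add]
      congr 1
      have := h.r
      omega
    rw [← Int.natAbs_natCast (p ^ _), ← e]
    congr 1
    simp [Fin.prod_univ_succ, map_apply]
  · intro i j hij
    replace hij : i < j := hij
    rw [Matrix.of_apply, map_apply]
    fin_cases i <;> fin_cases j <;> simp at hij ⊢

theorem index_range_centre (hp : 0 < p) {F : Frame} :
    (F.centre p).range.index = p ^ (F.r₀ + 3 * F.r₁ + 2 * F.d) := by
  rw [AddMonoidHom.index_range_eq_natAbs_det (Module.Basis.finTwoProd ℤ) (centre_injective hp),
    Matrix.det_fin_two, ← Int.natAbs_natCast (p ^ _), Nat.cast_pow]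
  congr 1
  simp [centre_apply, ← pow_add]
  congr 1
  ring

theorem index_range_rot_comp (γ : ℕ ⊕ ℕ) (f : (Fin 6 → ℤ) →+ (Fin 6 → ℤ)) :
    ((rot p γ).comp f).range.index = f.range.index := by
  rw [AddMonoidHom.range_comp]
  apply AddSubgroup.index_map_of_bijective
  exact ⟨Function.LeftInverse.injective (rotInv_rot p γ),
    Function.RightInverse.surjective (rot_rotInv p γ)⟩

end Frame

theorem AddSubgroup.index_smul_mem {E : Type} [AddCommGroup E] (S : AddSubgroup E) (z : E) :
    (S.index : ℤ) • z ∈ S := by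
  rw [natCast_zsmul]
  exact S.nsmul_index_mem z

/-- The completion enters only through its quotient `Hei (ZMod p)`; with p-power index this
suffices. -/
theorem exists_frame_of_completion {p : ℕ} (hp : p.Prime) {Δ : Subgroup (Hei ℤ)} {k : ℕ}
    (hΔ : Δ.index = p ^ k)
    (e : Nonempty (ProfiniteGrp.ProfiniteCompletion.completion (GrpCat.of Δ) ≃ₜ*
      ProfiniteGrp.ProfiniteCompletion.completion (GrpCat.of (Hei ℤ)))) :
    ∃ (γ : ℕ ⊕ ℕ) (F : Frame), γ ∈ rotSet p F.d ∧ F.Valid p ∧ F.Reduced p ∧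
      Hei.zSub Δ = ((rot p γ).comp (F.map p)).range ∧ Hei.cSub Δ = (F.centre p).range := by
  have : Fact p.Prime := ⟨hp⟩
  obtain ⟨e⟩ := e
  obtain ⟨g, hg⟩ := exists_surjective_of_completion e (Hei.cast (ZMod p)) (Hei.cast_surjective p)
  obtain ⟨ψ, θ, hψ, hθ⟩ := Hei.reducesTo_of_surjective g hg
  have hidx := Hei.index_eq Δ
  have hL : ∀ z, (p : ℤ) ^ k • z ∈ Hei.zSub Δ := fun z => by
    have := (Hei.zSub Δ).zsmul_mem (AddSubgroup.index_smul_mem (Hei.zSub Δ) z)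
      ((Hei.cSub Δ).index : ℤ)
    rwa [smul_smul, mul_comm, ← Nat.cast_mul, ← hidx, hΔ, Nat.cast_pow] at this
  have hM : ∀ u, (p : ℤ) ^ k • u ∈ Hei.cSub Δ := fun u => by
    have := (Hei.cSub Δ).zsmul_mem (AddSubgroup.index_smul_mem (Hei.cSub Δ) u)
      ((Hei.zSub Δ).index : ℤ)
    rwa [smul_smul, ← Nat.cast_mul, ← hidx, hΔ, Nat.cast_pow] at this
  generalize Hei.zSub Δ = L at *
  generalize Hei.cSub Δ = M at *
  obtain ⟨r₀, d, γ, hγ, hdvd, ⟨v, hv, v0, v1⟩, w, hw, w0, w1⟩ := exists_rot hp hL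
  have hmem : ∀ l, l ∈ L.comap (rot p γ) ↔ rot p γ l ∈ L := fun l => Iff.rfl
  -- Rotations preserve the form, so the lattice pulled back by the rotation keeps its reduction and
  -- its central lattice.
  let ρ : L.comap (rot p γ) →+ L := AddMonoidHom.mk' (fun l => ⟨rot p γ l.1, l.2⟩)
    (fun a b => Subtype.ext (map_add _ _ _))
  have hρ : Function.Surjective ρ := fun l =>
    ⟨⟨rotInv p γ l.1, by rw [hmem, rot_rotInv]; exact l.2⟩,
      Subtype.ext (rot_rotInv _ _ _)⟩
  have hL' : ∀ z, (p : ℤ) ^ k • z ∈ L.comap (rot p γ) := fun z => by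
    rw [hmem, map_zsmul]; exact hL _
  have hψ' : Function.Surjective (ψ.comp ρ) := hψ.comp hρ
  obtain ⟨D⟩ := nonempty_shiftData hL' hM hψ' (θ := θ) (fun l l' => by
    obtain ⟨h, h'⟩ := hθ (ρ l) (ρ l')
    have e : heiForm (ρ l : Fin 6 → ℤ) (ρ l') = heiForm l.1 l'.1 := heiForm_rot _ _ _ _
    refine ⟨e ▸ h, ?_⟩
    rw [AddMonoidHom.comp_apply, AddMonoidHom.comp_apply, ← h']
    exact congrArg θ (Subtype.ext e.symm))
  have hinv : ∀ l : L.comap (rot p γ), rotInv p γ (rot p γ l.1) = l.1 :=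
    fun l => rotInv_rot _ _ _
  obtain ⟨F, hF, h0, hd, hFL, hFM⟩ := D.exists_frame hL' hψ' (r₀ := r₀) (d := d)
    (v := ⟨rotInv p γ v, by rw [hmem, rot_rotInv]; exact hv⟩)
    (w := ⟨rotInv p γ w, by rw [hmem, rot_rotInv]; exact hw⟩)
    (fun l => by rw [← hinv l]; exact hdvd _ l.2) v0 v1 w0 w1
  obtain ⟨G, hG, rG, g0, gd, gL, gM⟩ := Frame.exists_reduced hp.pos hF
  refine ⟨γ, G, by rwa [gd, hd], hG, rG, ?_, by rw [gM, hFM]⟩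
  rw [AddMonoidHom.range_comp, gL, ← hFL]
  exact (AddSubgroup.map_comap_eq_self_of_surjective
    (Function.RightInverse.surjective (rot_rotInv p γ)) L).symm

/-- The reduced frames with given exponents. -/
abbrev FrameFiber (p : ℕ) (t : ℕ × ℕ × ℕ) : Type :=
  {F : Frame // F.Valid p ∧ F.Reduced p ∧ F.r₀ = t.1 ∧ F.r₁ = t.2.1 ∧ F.d = t.2.2}

/-- The possible exponents of the frames of subgroups of index `p ^ k`. -/
def exponentSet (k : ℕ) : Finset (ℕ × ℕ × ℕ) :=
  (Finset.range (k + 1) ×ˢ Finset.range (k + 1) ×ˢ Finset.range (k + 1)).filter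
    fun t => t.1 ≤ 2 * t.2.1 ∧ t.1 + 9 * t.2.1 + 5 * t.2.2 = k

theorem mem_exponentSet {k : ℕ} {t : ℕ × ℕ × ℕ} :
    t ∈ exponentSet k ↔ t.1 ≤ 2 * t.2.1 ∧ t.1 + 9 * t.2.1 + 5 * t.2.2 = k := by
  simp only [exponentSet, Finset.mem_filter, Finset.mem_product, Finset.mem_range]
  omega

/-- The subgroups with given frame. -/
abbrev SubgroupFiber (p : ℕ) (γ : ℕ ⊕ ℕ) (F : Frame) : Type :=
  {Δ : Subgroup (Hei ℤ) // Hei.zSub Δ = ((rot p γ).comp (F.map p)).range ∧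
    Hei.cSub Δ = (F.centre p).range}

theorem Frame.rot_comp_injective {p : ℕ} (hp : 0 < p) (γ : ℕ ⊕ ℕ) (F : Frame) :
    Function.Injective ((rot p γ).comp (F.map p)) :=
  (Function.LeftInverse.injective (rotInv_rot p γ)).comp (map_injective hp)

theorem Frame.Valid.heiForm_rot_comp {p : ℕ} {F : Frame} (h : F.Valid p) (γ : ℕ ⊕ ℕ)
    (z w : Fin 6 → ℤ) : heiForm ((rot p γ).comp (F.map p) z) ((rot p γ).comp (F.map p) w) =
      F.centre p (heiForm z w) :=
  (heiForm_rot p γ _ _).trans (h.heiForm_map z w)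

theorem card_subgroupFiber {p : ℕ} (hp : 0 < p) (γ : ℕ ⊕ ℕ) {F : Frame} (h : F.Valid p) :
    Nat.card (SubgroupFiber p γ F) = p ^ (6 * (F.r₀ + 3 * F.r₁ + 2 * F.d)) := by
  rw [Hei.card_fiber (Frame.rot_comp_injective hp γ F) (h.heiForm_rot_comp γ),
    Frame.index_range_centre hp, ← pow_mul, mul_comm]

theorem index_of_subgroupFiber {p : ℕ} (hp : 0 < p) {γ : ℕ ⊕ ℕ} {F : Frame} (h : F.Valid p)
    {Δ : Subgroup (Hei ℤ)} (hz : Hei.zSub Δ = ((rot p γ).comp (F.map p)).range)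
    (hc : Hei.cSub Δ = (F.centre p).range) :
    Δ.index = p ^ (F.r₀ + 9 * F.r₁ + 5 * F.d) := by
  rw [Hei.index_eq, hz, hc, Frame.index_range_rot_comp, Frame.index_range_map hp h,
    Frame.index_range_centre hp, ← pow_add]
  congr 1
  ring

/-- The subgroups of index `n` with the same completion as the whole group. -/
abbrev ProIsoSubgroup (n : ℕ) : Type :=
  {Δ : Subgroup (Hei ℤ) // Δ.index = n ∧
    Nonempty (ProfiniteGrp.ProfiniteCompletion.completion (GrpCat.of Δ) ≃ₜ*
      ProfiniteGrp.ProfiniteCompletion.completion (GrpCat.of (Hei ℤ)))}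

/-- The subgroups sorted by their frames. -/
abbrev FramedSubgroup (p k : ℕ) : Type :=
  Σ (t : exponentSet k) (x : rotSet p t.1.2.2 × FrameFiber p t), SubgroupFiber p x.1.1 x.2.1

theorem framedSubgroup_prop {p : ℕ} (hp : p.Prime) {k : ℕ} (x : FramedSubgroup p k) :
    x.2.2.1.index = p ^ k ∧
    Nonempty (ProfiniteGrp.ProfiniteCompletion.completion (GrpCat.of x.2.2.1) ≃ₜ*
      ProfiniteGrp.ProfiniteCompletion.completion (GrpCat.of (Hei ℤ))) := by
  obtain ⟨⟨t, ht⟩, ⟨⟨γ, hγ⟩, ⟨F, hF, rF, h0, h1, hd⟩⟩, ⟨Δ, hz, hc⟩⟩ := x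
  constructor
  · rw [index_of_subgroupFiber hp.pos hF hz hc, h0, h1, hd, (mem_exponentSet.1 ht).2]
  · obtain ⟨e⟩ := Hei.nonempty_mulEquiv (Frame.rot_comp_injective hp.pos γ F)
      (F.centre_injective hp.pos) (hF.heiForm_rot_comp γ) hz hc
    exact nonempty_completion_congr e

theorem framedSubgroup_ext {p : ℕ} (hp : p.Prime) {k : ℕ} {x y : FramedSubgroup p k}
    (h : x.2.2.1 = y.2.2.1) : x = y := by
  obtain ⟨⟨t, ht⟩, ⟨⟨γ, hγ⟩, ⟨F, hF, rF, h0, h1, hd⟩⟩, ⟨Δ, hz, hc⟩⟩ := x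
  obtain ⟨⟨t', ht'⟩, ⟨⟨γ', hγ'⟩, ⟨F', hF', rF', h0', h1', hd'⟩⟩, ⟨Δ', hz', hc'⟩⟩ := y
  simp only at h h0 h1 hd h0' h1' hd' hγ hγ' hz hz'
  subst h
  obtain ⟨rfl, rfl⟩ := Frame.eq_of_rot_range_eq hp hF hF' rF rF' (by rw [hd]; exact hγ)
    (by rw [hd']; exact hγ') (hz.symm.trans hz')
  obtain rfl : t = t' :=
    Prod.ext (h0.symm.trans h0') (Prod.ext (h1.symm.trans h1') (hd.symm.trans hd'))
  rfl

theorem exists_framedSubgroup {p : ℕ} (hp : p.Prime) {k : ℕ} (Δ : ProIsoSubgroup (p ^ k)) :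
    ∃ x : FramedSubgroup p k, x.2.2.1 = Δ.1 := by
  obtain ⟨Δ, hΔ, e⟩ := Δ
  obtain ⟨γ, F, hγ, hF, rF, hz, hc⟩ := exists_frame_of_completion hp hΔ e
  have hk : F.r₀ + 9 * F.r₁ + 5 * F.d = k := Nat.pow_right_injective hp.two_le
    ((index_of_subgroupFiber hp.pos hF hz hc).symm.trans hΔ)
  have ht : (F.r₀, F.r₁, F.d) ∈ exponentSet k :=
    mem_exponentSet.2 ⟨by have := hF.r; simp only; omega, hk⟩
  exact ⟨⟨⟨_, ht⟩, ⟨⟨γ, hγ⟩, ⟨F, hF, rF, rfl, rfl, rfl⟩⟩, ⟨Δ, hz, hc⟩⟩, rfl⟩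

theorem card_proIsoSubgroup {p : ℕ} (hp : p.Prime) (k : ℕ) :
    Nat.card (ProIsoSubgroup (p ^ k)) = Nat.card (FramedSubgroup p k) :=
  (Nat.card_eq_of_bijective (fun x => ⟨x.2.2.1, framedSubgroup_prop hp x⟩)
    ⟨fun _ _ h => framedSubgroup_ext hp (congrArg Subtype.val h), fun Δ =>
      (exists_framedSubgroup hp Δ).imp fun _ h => Subtype.ext h⟩).symm

/-- The three factors count the rotations, the reduced frames, and the subgroups over the resulting
pair of lattices, the last being the sixth power of the index of M. -/
theorem proIsoCount_eq_sum {p : ℕ} (hp : p.Prime) (hfin : ∀ t, Finite (FrameFiber p t)) (k : ℕ) :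
    proIsoCount DStarCube (p ^ k) = ∑ t ∈ exponentSet k, (rotSet p t.2.2).card *
      Nat.card (FrameFiber p t) * p ^ (6 * (t.1 + 3 * t.2.1 + 2 * t.2.2)) := by
  have hfib : ∀ (t : exponentSet k) (x : rotSet p t.1.2.2 × FrameFiber p t),
      Nat.card (SubgroupFiber p x.1.1 x.2.1) = p ^ (6 * (t.1.1 + 3 * t.1.2.1 + 2 * t.1.2.2)) := by
    rintro ⟨t, ht⟩ ⟨γ, ⟨F, hF, rF, h0, h1, hd⟩⟩
    rw [card_subgroupFiber hp.pos _ hF, h0, h1, hd]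
  have hfib' : ∀ (t : exponentSet k) (x : rotSet p t.1.2.2 × FrameFiber p t),
      Finite (SubgroupFiber p x.1.1 x.2.1) := fun t x =>
    Nat.finite_of_card_ne_zero (by rw [hfib]; exact (pow_pos hp.pos _).ne')
  have := hfin
  rw [proIsoCount_congr Hei.ofDStarCube, proIsoCount, card_proIsoSubgroup hp k,
    Nat.card_sigma, ← Finset.sum_coe_sort (exponentSet k)]
  refine Finset.sum_congr rfl fun t _ => ?_
  have := Fintype.ofFinite (rotSet p t.1.2.2 × FrameFiber p t)
  rw [Nat.card_sigma, Finset.sum_congr rfl (fun x _ => hfib t x), Finset.sum_const,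
    Finset.card_univ, ← Nat.card_eq_fintype_card, Nat.card_prod, smul_eq_mul, Nat.card_eq_fintype_card,
    Fintype.card_coe]

/-! ### Counting solutions of p^d A² + BC ≡ 0. -/

namespace Finset

theorem card_filter_range_mul (a b : ℕ) (P : ℕ → Prop) [DecidablePred P]
    (h : ∀ x, P (x + a) ↔ P x) :
    #{x ∈ range (a * b) | P x} = b * #{x ∈ range a | P x} := by
  have h' : ∀ k x, P (a * k + x) ↔ P x := by
    intro k
    induction k with
    | zero => simp
    | succ k ih => intro x; rw [mul_add_one, add_right_comm, h, ih]
  induction b with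
  | zero => simp
  | succ b ih =>
    rw [mul_add_one, card_filter, sum_range_add, ← card_filter, ih]
    simp only [h']
    rw [← card_filter, add_one_mul]

end Finset

open Finset in
theorem card_dvd_add_mul {M b : ℕ} (N : ℕ) (hM : 0 < M) (h : b.Coprime M) :
    #{x ∈ range M | M ∣ N + b * x} = 1 := by
  have : NeZero M := ⟨hM.ne'⟩
  rw [card_eq_one]
  have key : ∃ x < M, M ∣ N + b * x := by
    refine ⟨(-(N : ZMod M) * ((ZMod.unitOfCoprime b h)⁻¹ : (ZMod M)ˣ)).val, ZMod.val_lt _, ?_⟩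
    rw [← ZMod.natCast_eq_zero_iff]
    have hu : ((ZMod.unitOfCoprime b h : (ZMod M)ˣ) : ZMod M) = b := rfl
    have := (ZMod.unitOfCoprime b h).mul_inv
    rw [hu] at this
    push_cast
    rw [ZMod.natCast_val, ZMod.cast_id]
    linear_combination -(N : ZMod M) * this
  obtain ⟨x, hx, hd⟩ := key
  refine ⟨x, ?_⟩
  ext y
  simp only [mem_filter, mem_range, mem_singleton]
  constructor
  · rintro ⟨hy, hd'⟩
    have e : N + b * y ≡ N + b * x [MOD M] :=
      ((Nat.modEq_zero_iff_dvd.2 hd').trans (Nat.modEq_zero_iff_dvd.2 hd).symm)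
    have e' := Nat.ModEq.cancel_left_of_coprime (Nat.Coprime.gcd_eq_one h.symm)
      (Nat.ModEq.add_left_cancel' _ e)
    exact Nat.ModEq.eq_of_lt_of_lt e' hy hx
  · rintro rfl
    exact ⟨hx, hd⟩

section

open Finset

/-- Dividing by p^l leaves a linear congruence in C with unit coefficient modulo p^(n-l), which has
one solution per period. -/
theorem card_dvd_add_mul_of_gcd {p : ℕ} (hp : p.Prime) {n l c B : ℕ} (N : ℕ) (hB : Nat.gcd (p ^ n) B = p ^ l)
    (hl : l ≤ n) : #{C ∈ range (p ^ (n + c)) | p ^ n ∣ N + B * C} =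
      if p ^ l ∣ N then p ^ (c + l) else 0 := by
  have hpl : 0 < p ^ l := pow_pos hp.pos l
  have hBl : p ^ l ∣ B := hB ▸ Nat.gcd_dvd_right _ _
  split_ifs with h
  · obtain ⟨N', rfl⟩ := h
    obtain ⟨B', rfl⟩ := hBl
    obtain ⟨m, rfl⟩ := Nat.exists_eq_add_of_le hl
    have hcop : B'.Coprime (p ^ m) := by
      rw [pow_add, Nat.gcd_mul_left] at hB
      exact Nat.Coprime.symm (Nat.eq_of_mul_eq_mul_left hpl (by rw [hB, mul_one]))
    have hiff : ∀ C, p ^ (l + m) ∣ p ^ l * N' + p ^ l * B' * C ↔ p ^ m ∣ N' + B' * C := fun C => by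
      rw [pow_add, mul_assoc, ← mul_add, Nat.mul_dvd_mul_iff_left hpl]
    simp only [hiff]
    rw [show l + m + c = m + (c + l) by ring, pow_add p m, card_filter_range_mul,
      card_dvd_add_mul _ (pow_pos hp.pos m) hcop, mul_one]
    intro x
    rw [mul_add, ← add_assoc, Nat.dvd_add_left (dvd_mul_left _ _)]
  · rw [card_eq_zero, filter_eq_empty_iff]
    intro C _ hC
    exact h ((Nat.dvd_add_left (hBl.mul_right C)).1 ((pow_dvd_pow p hl).trans hC))

theorem card_gcd_eq {p : ℕ} (hp : p.Prime) {n l j : ℕ} (hl : l ≤ n) :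
    #{B ∈ range (p ^ (n + j)) | Nat.gcd (p ^ n) B = p ^ l} = p ^ j * Nat.totient (p ^ (n - l)) := by
  rw [pow_add, card_filter_range_mul, ← Nat.pow_div hl hp.pos,
    Nat.totient_div_of_dvd (pow_dvd_pow p hl)]
  intro x
  rw [Nat.gcd_add_self_right]

theorem sum_card_dvd_add_mul {p : ℕ} (hp : p.Prime) (n j c N : ℕ) :
    ∑ B ∈ range (p ^ (n + j)), #{C ∈ range (p ^ (n + c)) | p ^ n ∣ N + B * C} =
      ∑ l ∈ range (n + 1), if p ^ l ∣ N then
        p ^ j * Nat.totient (p ^ (n - l)) * p ^ (c + l) else 0 := by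
  have h1 : ∀ B, ∃ l ∈ range (n + 1), Nat.gcd (p ^ n) B = p ^ l := fun B => by
    obtain ⟨l, hl, e⟩ := (Nat.dvd_prime_pow hp).1 (Nat.gcd_dvd_left (p ^ n) B)
    exact ⟨l, mem_range.2 (by omega), e⟩
  choose g hg hgB using h1
  rw [← sum_fiberwise_of_maps_to (s := range (p ^ (n + j))) (t := range (n + 1)) (g := g)
    (fun B _ => hg B)]
  refine sum_congr rfl fun l hl => ?_
  have hl' : l ≤ n := by have := mem_range.1 hl; omega
  have hiff : ∀ B, g B = l ↔ Nat.gcd (p ^ n) B = p ^ l := fun B => by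
    rw [hgB]
    exact (Nat.pow_right_injective hp.two_le).eq_iff.symm
  rw [sum_congr rfl (fun B hB => card_dvd_add_mul_of_gcd hp N ((hiff B).1 (mem_filter.1 hB).2) hl'),
    sum_const]
  simp only [hiff]
  rw [card_gcd_eq hp hl']
  split_ifs <;> simp

/-- The exponent is ⌈(m - d)/2⌉, and truncated subtraction makes it 0 when m ≤ d. -/
theorem pow_dvd_pow_mul_sq_iff {p : ℕ} (hp : p.Prime) (m d A : ℕ) :
    p ^ m ∣ p ^ d * A ^ 2 ↔ p ^ ((m - d + 1) / 2) ∣ A := by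
  rcases eq_or_ne A 0 with rfl | hA
  · simp
  · rw [hp.pow_dvd_iff_le_factorization (mul_ne_zero (pow_ne_zero _ hp.ne_zero) (pow_ne_zero _ hA)),
      hp.pow_dvd_iff_le_factorization hA,
      Nat.factorization_mul (pow_ne_zero _ hp.ne_zero) (pow_ne_zero _ hA)]
    simp [hp.factorization_self]
    omega

theorem card_pow_dvd {p : ℕ} (hp : p.Prime) {r t : ℕ} (h : t ≤ r) : #{A ∈ range (p ^ r) | p ^ t ∣ A} = p ^ (r - t) := by
  obtain ⟨c, rfl⟩ := Nat.exists_eq_add_of_le h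
  rw [pow_add, card_filter_range_mul, Nat.add_sub_cancel_left]
  · have := card_dvd_add_mul (M := p ^ t) (b := 1) 0 (pow_pos hp.pos t) (Nat.coprime_one_left _)
    simp only [zero_add, one_mul] at this
    rw [this, mul_one]
  · intro x
    simp

/-- Here gcd(B, pⁿ) = p^l. A suitable C exists exactly when p^(2μ + l) divides p^d A², a condition
on A alone. -/
theorem sum_card_dvd_sq {p : ℕ} (hp : p.Prime) (μ n j d : ℕ) :
    ∑ A ∈ range (p ^ (μ + n + j)), ∑ B ∈ range (p ^ (n + j)),
      #{C ∈ range (p ^ (n + (j + d))) | p ^ (2 * μ + n) ∣ p ^ d * A ^ 2 + p ^ (2 * μ) * (B * C)} =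
    ∑ l ∈ range (n + 1), p ^ j * Nat.totient (p ^ (n - l)) * p ^ (j + d + l) *
      p ^ (μ + n + j - (l + 2 * μ - d + 1) / 2) := by
  have hpμ : 0 < p ^ (2 * μ) := pow_pos hp.pos _
  have h1 : ∀ A, ∑ B ∈ range (p ^ (n + j)),
      #{C ∈ range (p ^ (n + (j + d))) | p ^ (2 * μ + n) ∣ p ^ d * A ^ 2 + p ^ (2 * μ) * (B * C)} =
      ∑ l ∈ range (n + 1), if p ^ ((l + 2 * μ - d + 1) / 2) ∣ A then
        p ^ j * Nat.totient (p ^ (n - l)) * p ^ (j + d + l) else 0 := by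
    intro A
    simp only [← pow_dvd_pow_mul_sq_iff hp]
    by_cases hA : p ^ (2 * μ) ∣ p ^ d * A ^ 2
    · obtain ⟨N, hN⟩ := hA
      rw [hN]
      simp only [pow_add p (2 * μ), ← mul_add, pow_add p _ (2 * μ), Nat.mul_dvd_mul_iff_left hpμ]
      rw [sum_card_dvd_add_mul hp]
      refine sum_congr rfl fun l _ => ?_
      simp only [mul_comm (p ^ l), Nat.mul_dvd_mul_iff_left hpμ]
    · rw [sum_eq_zero, sum_eq_zero]
      · intro l _
        rw [if_neg]
        exact fun h => hA ((pow_dvd_pow p (by omega)).trans h)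
      · intro B _
        rw [card_eq_zero, filter_eq_empty_iff]
        intro C _ h
        exact hA ((Nat.dvd_add_left (dvd_mul_right _ _)).1 ((pow_dvd_pow p (by omega)).trans h))
  rw [sum_congr rfl fun A _ => h1 A, sum_comm]
  refine sum_congr rfl fun l hl => ?_
  have hl := mem_range.1 hl
  rw [← sum_filter, sum_const, card_pow_dvd hp (by omega), smul_eq_mul, mul_comm]

end

/-! ### Counting reduced frames with given exponents. -/

namespace Frame

open Finset

/-- The admissible level `1` coordinates of a reduced frame. -/
def levelOneSet (p μ n j d : ℕ) : Finset (ℕ × ℕ × ℕ) :=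
  (range (p ^ (μ + n + j)) ×ˢ range (p ^ (n + j)) ×ˢ range (p ^ (n + (j + d)))).filter
    fun x => p ^ (2 * μ + n) ∣ p ^ d * x.1 ^ 2 + p ^ (2 * μ) * (x.2.1 * x.2.2)

theorem card_levelOneSet {p : ℕ} (hp : p.Prime) (μ n j d : ℕ) :
    #(levelOneSet p μ n j d) = ∑ l ∈ range (n + 1), p ^ j * Nat.totient (p ^ (n - l)) *
      p ^ (j + d + l) * p ^ (μ + n + j - (l + 2 * μ - d + 1) / 2) := by
  rw [← sum_card_dvd_sq hp, levelOneSet, card_filter, sum_product]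
  refine sum_congr rfl fun A _ => ?_
  rw [sum_product]
  exact sum_congr rfl fun B _ => (card_filter _ _).symm

/-- The coordinates which parametrize reduced frames. -/
def paramSet (p μ n j d : ℕ) : Finset ((ℕ × ℕ × ℕ) × ℕ × ℕ × ℕ × ℕ) :=
  levelOneSet p μ n j d ×ˢ range (p ^ (n + 2 * j)) ×ˢ range (p ^ (n + 2 * j)) ×ˢ
    range (p ^ (n + 2 * j)) ×ˢ range (p ^ (n + 2 * j + d))

/-- The parameters of a frame. -/
def params (p μ : ℕ) (F : Frame) : (ℕ × ℕ × ℕ) × ℕ × ℕ × ℕ × ℕ :=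
  ((F.A.toNat, (F.B / p ^ μ).toNat, (F.C / p ^ μ).toNat),
    F.E.toNat, F.W₁₁.toNat, F.W₁₂.toNat, F.W₂₁.toNat)

variable {p μ n j d : ℕ}

/-- If j = 0, then r₀ = r₁ + μ, and the relations defining B₁ and C₁ leave a factor p^μ in B and C.
-/
theorem Valid.pow_dvd (hp : p.Prime) (h0 : μ = 0 ∨ j = 0) {F : Frame} (h : F.Valid p)
    (e0 : F.r₀ = 2 * μ + n) (e1 : F.r₁ = μ + n + j) :
    (p : ℤ) ^ μ ∣ F.B ∧ (p : ℤ) ^ μ ∣ F.C := by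
  have hn : ∀ n, (p : ℤ) ^ n ≠ 0 := fun n => (pow_pos (by exact_mod_cast hp.pos) n).ne'
  rcases h0 with rfl | rfl
  · simp
  · have hB := h.B
    have hC := h.C
    rw [e0, e1, show 2 * μ + n = (μ + n + 0) + μ by ring, pow_add, mul_assoc] at hB hC
    exact ⟨⟨_, (mul_left_cancel₀ (hn _) hB).symm⟩, ⟨_, (mul_left_cancel₀ (hn _) hC).symm⟩⟩

theorem toNat_eq_iff {x y : ℤ} (hx : 0 ≤ x) (hy : 0 ≤ y) : x.toNat = y.toNat ↔ x = y := by
  omega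

theorem toNat_div_lt {x : ℤ} {a b : ℕ} (hp : 0 < p) (hx : 0 ≤ x ∧ x < p ^ (a + b)) :
    (x / p ^ a).toNat < p ^ b := by
  have hpa : (0 : ℤ) < p ^ a := pow_pos (by exact_mod_cast hp) a
  have h1 : x / p ^ a < p ^ b := Int.ediv_lt_of_lt_mul hpa (by rw [← pow_add, add_comm]; exact hx.2)
  have h2 : 0 ≤ x / (p : ℤ) ^ a := Int.ediv_nonneg hx.1 hpa.le
  zify
  rwa [Int.toNat_of_nonneg h2]

theorem toNat_lt {x : ℤ} {a : ℕ} (hx : 0 ≤ x ∧ x < p ^ a) : x.toNat < p ^ a := by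
  zify
  rw [Int.toNat_of_nonneg hx.1]
  exact hx.2

theorem params_mem (hp : p.Prime) (h0 : μ = 0 ∨ j = 0) {F : Frame} (h : F.Valid p)
    (hr : F.Reduced p) (e0 : F.r₀ = 2 * μ + n) (e1 : F.r₁ = μ + n + j) (ed : F.d = d) :
    params p μ F ∈ paramSet p μ n j d := by
  obtain ⟨hB, hC⟩ := h.pow_dvd hp h0 e0 e1
  have hW := h.W
  have e2 : F.r₂ = n + 2 * j := by have := h.r; omega
  have hpa : (0 : ℤ) ≤ p ^ μ := by positivity
  obtain ⟨rA, rB, rC, rE, r11, r12, r21⟩ := hr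
  rw [e1, ed] at *
  rw [e2] at *
  simp only [paramSet, params, levelOneSet, mem_product, mem_filter, mem_range]
  refine ⟨⟨⟨toNat_lt rA, toNat_div_lt hp.pos (by rwa [← add_assoc]), toNat_div_lt hp.pos ?_⟩, ?_⟩,
    toNat_lt rE, toNat_lt r11, toNat_lt r12, toNat_lt r21⟩
  · rwa [← add_assoc, ← add_assoc]
  · zify
    rw [Int.toNat_of_nonneg rA.1, Int.toNat_of_nonneg (Int.ediv_nonneg rB.1 hpa),
      Int.toNat_of_nonneg (Int.ediv_nonneg rC.1 hpa), two_mul μ, pow_add _ μ μ,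
      mul_mul_mul_comm, Int.mul_ediv_cancel' hB, Int.mul_ediv_cancel' hC, ← two_mul, ← e0]
    exact ⟨F.W₂₂ + p ^ d * F.W₁₁, by rw [mul_add, hW, pow_add]; ring⟩

theorem params_injective (hp : p.Prime) (h0 : μ = 0 ∨ j = 0) {F G : Frame} (h : F.Valid p)
    (hr : F.Reduced p) (e0 : F.r₀ = 2 * μ + n) (e1 : F.r₁ = μ + n + j) (ed : F.d = d)
    (h' : G.Valid p) (hr' : G.Reduced p) (e0' : G.r₀ = 2 * μ + n) (e1' : G.r₁ = μ + n + j)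
    (ed' : G.d = d) (e : params p μ F = params p μ G) : F = G := by
  have hn : ∀ n, (p : ℤ) ^ n ≠ 0 := fun n => (pow_pos (by exact_mod_cast hp.pos) n).ne'
  obtain ⟨hB, hC⟩ := h.pow_dvd hp h0 e0 e1
  obtain ⟨hB', hC'⟩ := h'.pow_dvd hp h0 e0' e1'
  have hpa : (0 : ℤ) ≤ p ^ μ := by positivity
  simp only [params, Prod.mk.injEq] at e
  obtain ⟨⟨eA, eB, eC⟩, eE, e11, e12, e21⟩ := e
  rw [toNat_eq_iff hr.A.1 hr'.A.1] at eA
  rw [toNat_eq_iff hr.E.1 hr'.E.1] at eE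
  rw [toNat_eq_iff hr.W₁₁.1 hr'.W₁₁.1] at e11
  rw [toNat_eq_iff hr.W₁₂.1 hr'.W₁₂.1] at e12
  rw [toNat_eq_iff hr.W₂₁.1 hr'.W₂₁.1] at e21
  rw [toNat_eq_iff (Int.ediv_nonneg hr.B.1 hpa) (Int.ediv_nonneg hr'.B.1 hpa)] at eB
  rw [toNat_eq_iff (Int.ediv_nonneg hr.C.1 hpa) (Int.ediv_nonneg hr'.C.1 hpa)] at eC
  replace eB := (Int.ediv_left_inj hB hB').1 eB
  replace eC := (Int.ediv_left_inj hC hC').1 eC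
  have e2 : F.r₂ = G.r₂ := by have := h.r; have := h'.r; omega
  have a1 := h.W
  have a2 := h.B
  have a3 := h.C
  have a4 := h.E
  rw [eA, eB, eC, e11, e0.trans e0'.symm, ed.trans ed'.symm, ← h'.W] at a1
  rw [eB, e0.trans e0'.symm, e1.trans e1'.symm, ← h'.B] at a2
  rw [eC, e0.trans e0'.symm, e1.trans e1'.symm, ← h'.C] at a3
  rw [eA, eE, e0.trans e0'.symm, e1.trans e1'.symm, ed.trans ed'.symm, ← h'.E] at a4
  replace a1 := mul_left_cancel₀ (hn _) a1
  replace a2 := mul_left_cancel₀ (hn _) a2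
  replace a3 := mul_left_cancel₀ (hn _) a3
  replace a4 := sub_left_injective (mul_left_cancel₀ (hn _) a4)
  cases F
  cases G
  simp only at *
  simp [*]

theorem exists_params_eq (hp : p.Prime) {x : (ℕ × ℕ × ℕ) × ℕ × ℕ × ℕ × ℕ}
    (hx : x ∈ paramSet p μ n j d) : ∃ F : Frame, F.Valid p ∧ F.Reduced p ∧ F.r₀ = 2 * μ + n ∧
      F.r₁ = μ + n + j ∧ F.d = d ∧ params p μ F = x := by
  obtain ⟨⟨A, B, C⟩, E, w1, w2, w3⟩ := x
  simp only [paramSet, levelOneSet, mem_product, mem_filter, mem_range] at hx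
  obtain ⟨⟨⟨hA, hB, hC⟩, hW⟩, hE, h1, h2, h3⟩ := hx
  have hpa : (p : ℤ) ^ μ ≠ 0 := (pow_pos (by exact_mod_cast hp.pos) _).ne'
  have hA2 : p ^ (2 * μ) ∣ p ^ d * A ^ 2 :=
    (Nat.dvd_add_left (dvd_mul_right _ _)).1 ((pow_dvd_pow p (by omega)).trans hW)
  -- The relation for E₁ imposes nothing new: p^(2μ) dividing p^d A² already makes A divisible
  -- enough.
  have hA1 : p ^ (2 * μ + n) ∣ p ^ (μ + n + j + d) * A := by
    rw [pow_dvd_pow_mul_sq_iff hp] at hA2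
    have := mul_dvd_mul (dvd_refl (p ^ (μ + n + j + d))) hA2
    rw [← pow_add] at this
    exact (pow_dvd_pow p (by omega)).trans this
  obtain ⟨u, hu⟩ := hW
  obtain ⟨v, hv⟩ := hA1
  zify at hu hv
  -- W₂₂, B₁, C₁ and E₁ are the solutions of the four relations of `Valid`.
  refine ⟨⟨2 * μ + n, μ + n + j, n + 2 * j, d, A, p ^ μ * B, p ^ μ * C, E, w1, w2, w3,
    u - p ^ d * w1, p ^ j * B, p ^ j * C, p ^ d * E - 2 * v⟩, ?_, ?_, rfl, rfl, rfl, ?_⟩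
  · constructor
    · simp only; ring
    · simp only
      rw [mul_sub, ← hu]
      ring
    · simp only; ring
    · simp only; ring
    · simp only
      linear_combination 2 * hv
  · have hmul : ∀ {y a : ℕ}, y < p ^ a → (0 : ℤ) ≤ p ^ μ * y ∧ (p : ℤ) ^ μ * y < p ^ (μ + a) := by
      intro y a hy
      refine ⟨by positivity, ?_⟩
      rw [pow_add]
      exact mul_lt_mul_of_pos_left (by exact_mod_cast hy) (pow_pos (by exact_mod_cast hp.pos) _)
    have hcast : ∀ {y a : ℕ}, y < p ^ a → (0 : ℤ) ≤ y ∧ (y : ℤ) < p ^ a := fun hy =>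
      ⟨by positivity, by exact_mod_cast hy⟩
    constructor
    · exact hcast hA
    · have := hmul hB
      rwa [← add_assoc] at this
    · have := hmul hC
      rwa [← add_assoc, ← add_assoc] at this
    · exact hcast hE
    · exact hcast h1
    · exact hcast h2
    · exact hcast h3
  · simp [params, Int.mul_ediv_cancel_left _ hpa]

end Frame

theorem nonempty_frameFiber_equiv {p : ℕ} (hp : p.Prime) {μ n j : ℕ} (d : ℕ)
    (h0 : μ = 0 ∨ j = 0) :
    Nonempty (FrameFiber p (2 * μ + n, μ + n + j, d) ≃ Frame.paramSet p μ n j d) := by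
  refine ⟨Equiv.ofBijective (fun F => ⟨Frame.params p μ F.1, ?_⟩) ⟨?_, ?_⟩⟩
  · obtain ⟨F, h, hr, e0, e1, ed⟩ := F
    exact Frame.params_mem hp h0 h hr e0 e1 ed
  · rintro ⟨F, h, hr, e0, e1, ed⟩ ⟨G, h', hr', e0', e1', ed'⟩ e
    exact Subtype.ext (Frame.params_injective hp h0 h hr e0 e1 ed h' hr' e0' e1' ed'
      (congrArg Subtype.val e))
  · rintro ⟨x, hx⟩
    obtain ⟨F, h, hr, e0, e1, ed, e⟩ := Frame.exists_params_eq hp hx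
    exact ⟨⟨F, h, hr, e0, e1, ed⟩, Subtype.ext e⟩

theorem card_frameFiber {p : ℕ} (hp : p.Prime) {μ n j : ℕ} (d : ℕ) (h0 : μ = 0 ∨ j = 0) :
    Nat.card (FrameFiber p (2 * μ + n, μ + n + j, d)) = p ^ (4 * n + 8 * j + d) *
      ∑ l ∈ Finset.range (n + 1), p ^ j * Nat.totient (p ^ (n - l)) *
      p ^ (j + d + l) * p ^ (μ + n + j - (l + 2 * μ - d + 1) / 2) := by
  obtain ⟨e⟩ := nonempty_frameFiber_equiv hp d h0
  rw [Nat.card_congr e, Nat.card_eq_fintype_card, Fintype.card_coe, Frame.paramSet,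
    Finset.card_product, Finset.card_product, Finset.card_product, Finset.card_product,
    Frame.card_levelOneSet hp, Finset.card_range, Finset.card_range, mul_comm]
  congr 1
  ring

/-- μ and j are the positive parts of r₀ - r₁ and r₁ - r₀, and n = min(r₀, 2r₁ - r₀). -/
theorem exists_exponents {r₀ r₁ : ℕ} (h : r₀ ≤ 2 * r₁) :
    ∃ μ n j, (μ = 0 ∨ j = 0) ∧ r₀ = 2 * μ + n ∧ r₁ = μ + n + j := by
  rcases le_total r₀ r₁ with h' | h'
  · exact ⟨0, r₀, r₁ - r₀, by omega, by omega, by omega⟩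
  · exact ⟨r₀ - r₁, 2 * r₁ - r₀, 0, by omega, by omega, by omega⟩

theorem isEmpty_frameFiber {p r₀ r₁ d : ℕ} (h : ¬ r₀ ≤ 2 * r₁) :
    IsEmpty (FrameFiber p (r₀, r₁, d)) :=
  ⟨fun F => by
    obtain ⟨F, h', -, e0, e1, -⟩ := F
    have := h'.r
    simp only at e0 e1
    omega⟩

theorem finite_frameFiber {p : ℕ} (hp : p.Prime) (t : ℕ × ℕ × ℕ) : Finite (FrameFiber p t) := by
  obtain ⟨r₀, r₁, d⟩ := t
  by_cases h : r₀ ≤ 2 * r₁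
  · obtain ⟨μ, n, j, h0, rfl, rfl⟩ := exists_exponents h
    obtain ⟨e⟩ := nonempty_frameFiber_equiv hp d h0
    exact Finite.of_equiv _ e.symm
  · have := isEmpty_frameFiber (p := p) (d := d) h
    infer_instance

/-! ### Summation of the kernel with a ceiling in the exponent. -/

theorem HasSum.mul_prod {ι κ : Type} {f : ι → ℂ} {g : κ → ℂ} {a b : ℂ} (hf : HasSum f a)
    (hg : HasSum g b) : HasSum (fun x : ι × κ => f x.1 * g x.2) (a * b) :=
  hf.mul hg (summable_mul_of_summable_norm hf.summable.norm hg.summable.norm)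

/-- Pairs `(l, d)` with `d < l` and with `l ≤ d`. -/
def pairSplit (x : ℕ × ℕ ⊕ ℕ × ℕ) : ℕ × ℕ :=
  x.elim (fun y => (y.1 + 1 + y.2, y.1)) (fun y => (y.1, y.1 + y.2))

theorem pairSplit_bijective : Function.Bijective pairSplit := by
  constructor
  · rintro (⟨a, b⟩ | ⟨a, b⟩) (⟨c, d⟩ | ⟨c, d⟩) h <;>
      simp only [pairSplit, Sum.elim_inl, Sum.elim_inr, Prod.mk.injEq] at h <;>
      simp only [Sum.inl.injEq, Sum.inr.injEq, Prod.mk.injEq, reduceCtorEq] <;> omega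
  · rintro ⟨a, b⟩
    rcases lt_or_ge b a with h | h
    · exact ⟨.inl (b, a - b - 1), Prod.ext (by simp [pairSplit]; omega) (by simp [pairSplit])⟩
    · exact ⟨.inr (a, b - a), Prod.ext (by simp [pairSplit]) (by simp [pairSplit]; omega)⟩

theorem hasSum_of_pairSplit {f : ℕ × ℕ → ℂ} {a b : ℂ}
    (h1 : HasSum (fun x : ℕ × ℕ => f (x.1 + 1 + x.2, x.1)) a)
    (h2 : HasSum (fun x : ℕ × ℕ => f (x.1, x.1 + x.2)) b) : HasSum f (a + b) :=
  (Equiv.hasSum_iff (Equiv.ofBijective _ pairSplit_bijective)).1 (HasSum.sum h1 h2)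

theorem hasSum_of_pairSplit_prod {κ : Type} {f : (ℕ × ℕ) × κ → ℂ} {a b : ℂ}
    (h1 : HasSum (fun x : (ℕ × ℕ) × κ => f ((x.1.1 + 1 + x.1.2, x.1.1), x.2)) a)
    (h2 : HasSum (fun x : (ℕ × ℕ) × κ => f ((x.1.1, x.1.1 + x.1.2), x.2)) b) :
    HasSum f (a + b) :=
  (Equiv.hasSum_iff ((Equiv.sumProdDistrib _ _ _).symm.trans
    ((Equiv.ofBijective _ pairSplit_bijective).prodCongr (Equiv.refl κ)))).1 (HasSum.sum h1 h2)

theorem hasSum_even_odd_prod {κ : Type} {f : ℕ × κ → ℂ} {a b : ℂ}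
    (h1 : HasSum (fun x : ℕ × κ => f (2 * x.1, x.2)) a)
    (h2 : HasSum (fun x : ℕ × κ => f (2 * x.1 + 1, x.2)) b) : HasSum f (a + b) :=
  (Equiv.hasSum_iff ((Equiv.sumProdDistrib _ _ _).symm.trans
    (Equiv.natSumNatEquivNat.prodCongr (Equiv.refl κ)))).1 (HasSum.sum h1 h2)

theorem hasSum_geom {z : ℂ} (h : ‖z‖ < 1) : HasSum (fun n : ℕ => z ^ n) (1 - z)⁻¹ :=
  hasSum_geometric_of_norm_lt_one h

section

variable {X q u v w : ℂ}

/-- The difference in the exponent is truncated. Below the diagonal it is 0, and above it the powers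
of q cancel those of X. -/
theorem hasSum_kernel_square (hX : X * q = 1) (hu : ‖u ^ 2‖ < 1) (hw : ‖w‖ < 1)
    (hU : ‖u ^ 2 * w * X‖ < 1) :
    HasSum (fun x : ℕ × ℕ => (w * X) ^ x.1 * u ^ (2 * x.2) * q ^ (x.1 - x.2))
      ((1 - u ^ 2 * w * X)⁻¹ * (w * (1 - w)⁻¹) + (1 - u ^ 2 * w * X)⁻¹ * (1 - u ^ 2)⁻¹) := by
  refine hasSum_of_pairSplit ?_ ?_
  · convert! (hasSum_geom hU).mul_prod ((hasSum_geom hw).mul_left w) using 2 with x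
    have e : x.1 + 1 + x.2 - x.1 = x.2 + 1 := by omega
    simp only [e]
    calc _ = (w * X) ^ x.1 * (u ^ 2) ^ x.1 * w ^ (x.2 + 1) * (X * q) ^ (x.2 + 1) := by
          rw [pow_mul]; ring
      _ = _ := by rw [hX, one_pow]; ring
  · convert! (hasSum_geom hU).mul_prod (hasSum_geom hu) using 2 with x
    have e : x.1 - (x.1 + x.2) = 0 := by omega
    simp only [e, pow_zero]
    rw [pow_mul]
    ring

/-- The value of the sum over `d`, `l` and `μ`. -/
noncomputable def kernelSum (X q u v w : ℂ) : ℂ :=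
  (1 - u * v)⁻¹ * (v * q * (1 + v) * (1 - v ^ 2 * q)⁻¹) * (1 - w)⁻¹ +
    (1 - u * v)⁻¹ * ((1 + u) *
      ((1 - u ^ 2 * w * X)⁻¹ * (w * (1 - w)⁻¹) + (1 - u ^ 2 * w * X)⁻¹ * (1 - u ^ 2)⁻¹))

/-- The indices are (l, d) and μ. For d < l the ceiling splits as μ plus a term without μ. For d = l
+ b it depends only on 2μ - b, and both parities of b lead to the square kernel, truncation
included. -/
theorem hasSum_kernel (hX : X * q = 1) (hu : ‖u ^ 2‖ < 1) (hw : ‖w‖ < 1)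
    (huv : ‖u * v‖ < 1) (hv : ‖v ^ 2 * q‖ < 1) (hU : ‖u ^ 2 * w * X‖ < 1) :
    HasSum (fun x : (ℕ × ℕ) × ℕ => u ^ x.1.2 * v ^ x.1.1 * (w * X) ^ x.2 *
      q ^ ((x.1.1 + 2 * x.2 - x.1.2 + 1) / 2)) (kernelSum X q u v w) := by
  have hXn : ∀ n, X ^ n * q ^ n = 1 := fun n => by rw [← mul_pow, hX, one_pow]
  refine hasSum_of_pairSplit_prod ?_ ?_
  · have ha : HasSum (fun a : ℕ => v ^ (a + 1) * q ^ (1 + a / 2))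
        (v * q * (1 + v) * (1 - v ^ 2 * q)⁻¹) := by
      have e : v * q * (1 + v) * (1 - v ^ 2 * q)⁻¹ =
        v * q * (1 - v ^ 2 * q)⁻¹ + v ^ 2 * q * (1 - v ^ 2 * q)⁻¹ := by ring
      rw [e]
      refine HasSum.even_add_odd ?_ ?_
      · convert! (hasSum_geom hv).mul_left (v * q) using 2 with b
        rw [Nat.mul_div_cancel_left _ two_pos, mul_pow, ← pow_mul]
        ring
      · convert! (hasSum_geom hv).mul_left (v ^ 2 * q) using 2 with b
        rw [show (2 * b + 1) / 2 = b by omega, mul_pow, ← pow_mul]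
        ring
    convert! ((hasSum_geom huv).mul_prod ha).mul_prod (hasSum_geom hw) using 2 with x
    have e : (x.1.1 + 1 + x.1.2 + 2 * x.2 - x.1.1 + 1) / 2 = x.2 + (1 + x.1.2 / 2) := by omega
    simp only [e]
    rw [mul_pow w, pow_add q, mul_pow u]
    linear_combination (u ^ x.1.1 * v ^ (x.1.1 + 1 + x.1.2) * w ^ x.2 * q ^ (1 + x.1.2 / 2)) *
      hXn x.2
  · refine (Equiv.hasSum_iff (Equiv.prodAssoc ℕ ℕ ℕ).symm).1 ?_
    have ha : HasSum (fun x : ℕ × ℕ => u ^ x.1 * (w * X) ^ x.2 * q ^ ((2 * x.2 - x.1 + 1) / 2))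
        ((1 + u) * ((1 - u ^ 2 * w * X)⁻¹ * (w * (1 - w)⁻¹) +
          (1 - u ^ 2 * w * X)⁻¹ * (1 - u ^ 2)⁻¹)) := by
      have hs := (Equiv.hasSum_iff (Equiv.prodComm ℕ ℕ)).2 (hasSum_kernel_square hX hu hw hU)
      rw [add_mul, one_mul]
      refine hasSum_even_odd_prod ?_ ?_
      · convert! hs using 2 with x
        have e : (2 * x.2 - 2 * x.1 + 1) / 2 = x.2 - x.1 := by omega
        simp only [Function.comp, Equiv.prodComm_apply, Prod.fst_swap, Prod.snd_swap, e]
        ring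
      · convert! hs.mul_left u using 2 with x
        have e : (2 * x.2 - (2 * x.1 + 1) + 1) / 2 = x.2 - x.1 := by omega
        simp only [Function.comp, Equiv.prodComm_apply, Prod.fst_swap, Prod.snd_swap, e]
        ring
    convert! (hasSum_geom huv).mul_prod ha using 2 with x
    have e : (x.1 + 2 * x.2.2 - (x.1 + x.2.1) + 1) / 2 = (2 * x.2.2 - x.2.1 + 1) / 2 := by omega
    simp [e]
    ring

end

/-! ### The generating function as a sum over exponents. -/

theorem HasSum.group_by_degree {ι : Type} {f : ι → ℂ} {a : ℂ} (hf : HasSum f a) (deg : ι → ℕ)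
    (s : ℕ → Finset ι) (hs : ∀ k, ∀ x ∈ s k, deg x = k)
    (h0 : ∀ x, x ∉ s (deg x) → f x = 0) : HasSum (fun k => ∑ x ∈ s k, f x) a := by
  refine ((Equiv.sigmaFiberEquiv deg).hasSum_iff.2 hf).sigma fun k => ?_
  have h1 : HasSum ({x | deg x = k}.indicator f) (∑ x ∈ s k, {x | deg x = k}.indicator f x) := by
    refine hasSum_sum_of_ne_finset_zero fun x hx => ?_
    by_cases h : deg x = k
    · rw [Set.indicator_of_mem (s := {x | deg x = k}) h]
      exact h0 x (h ▸ hx)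
    · exact Set.indicator_of_notMem (s := {x | deg x = k}) h f
  rw [Finset.sum_congr rfl fun x hx => Set.indicator_of_mem (s := {x | deg x = k}) (hs k x hx) f]
    at h1
  exact hasSum_subtype_iff_indicator.2 h1

/-- The contribution of the exponents `t` and of the divisor `p ^ l` to the number of subgroups. -/
def exponentTerm (p : ℕ) (t : ℕ × ℕ × ℕ) (l : ℕ) : ℕ :=
  (rotSet p t.2.2).card * (p ^ (4 * (min t.1 (2 * t.2.1 - t.1)) + 8 * (t.2.1 - t.1) + t.2.2) *
    (p ^ (t.2.1 - t.1) * Nat.totient (p ^ (min t.1 (2 * t.2.1 - t.1) - l)) *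
      p ^ (t.2.1 - t.1 + t.2.2 + l) * p ^ (t.2.1 - (l + 2 * (t.1 - t.2.1) - t.2.2 + 1) / 2))) *
    p ^ (6 * (t.1 + 3 * t.2.1 + 2 * t.2.2))

/-- The pairs `(t, l)` which contribute. -/
def termSet : Set ((ℕ × ℕ × ℕ) × ℕ) :=
  {x | x.1.1 ≤ 2 * x.1.2.1 ∧ x.2 ≤ min x.1.1 (2 * x.1.2.1 - x.1.1)}

/-- Parametrization of `termSet`. -/
def termParam (x : ℕ × ((ℕ × ℕ) × ℕ) ⊕ ℕ × ((ℕ × ℕ) × ℕ)) : (ℕ × ℕ × ℕ) × ℕ :=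
  x.elim
    (fun y => ((2 * y.2.2 + (y.2.1.1 + y.1), y.2.2 + (y.2.1.1 + y.1), y.2.1.2), y.2.1.1))
    (fun y => ((y.2.1.1 + y.1, y.2.1.1 + y.1 + (y.2.2 + 1), y.2.1.2), y.2.1.1))

/-- With n = l + m, the left summand has j = 0 and the right one j ≥ 1. The shift by one keeps them
disjoint. -/
theorem termParam_injective : Function.Injective termParam := by
  rintro (⟨m, ⟨l, d⟩, μ⟩ | ⟨m, ⟨l, d⟩, j⟩) (⟨m', ⟨l', d'⟩, μ'⟩ | ⟨m', ⟨l', d'⟩, j'⟩) h <;>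
    simp only [termParam, Sum.elim_inl, Sum.elim_inr, Prod.mk.injEq] at h <;>
    simp only [Sum.inl.injEq, Sum.inr.injEq, Prod.mk.injEq, reduceCtorEq] <;> omega

theorem range_termParam : Set.range termParam = termSet := by
  ext ⟨⟨r₀, r₁, d⟩, l⟩
  simp only [Set.mem_range, termSet, Set.mem_ofPred_eq]
  constructor
  · rintro ⟨⟨m, ⟨l', d'⟩, μ⟩ | ⟨m, ⟨l', d'⟩, μ⟩, h⟩ <;>
      simp only [termParam, Sum.elim_inl, Sum.elim_inr, Prod.mk.injEq] at h <;> omega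
  · rintro ⟨h1, h2⟩
    rcases le_or_gt r₁ r₀ with h | h
    · refine ⟨.inl (2 * r₁ - r₀ - l, (l, d), r₀ - r₁), ?_⟩
      simp only [termParam, Sum.elim_inl, Prod.mk.injEq, and_true]
      omega
    · refine ⟨.inr (r₀ - l, (l, d), r₁ - r₀ - 1), ?_⟩
      simp only [termParam, Sum.elim_inr, Prod.mk.injEq, and_true]
      omega

open scoped Classical in
theorem hasSum_term {p : ℕ} (hp : p.Prime) (T : ℂ) (t : ℕ × ℕ × ℕ) :
    HasSum (fun l => termSet.indicator (fun x => (exponentTerm p x.1 x.2 : ℂ) *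
      T ^ (x.1.1 + 9 * x.1.2.1 + 5 * x.1.2.2)) (t, l))
      (((rotSet p t.2.2).card * Nat.card (FrameFiber p t) *
        p ^ (6 * (t.1 + 3 * t.2.1 + 2 * t.2.2)) : ℕ) * T ^ (t.1 + 9 * t.2.1 + 5 * t.2.2)) := by
  obtain ⟨r₀, r₁, d⟩ := t
  by_cases h : r₀ ≤ 2 * r₁
  · have hc := card_frameFiber hp (μ := r₀ - r₁) (n := min r₀ (2 * r₁ - r₀)) (j := r₁ - r₀) d
      (by omega)
    rw [show 2 * (r₀ - r₁) + min r₀ (2 * r₁ - r₀) = r₀ by omega,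
      show r₀ - r₁ + min r₀ (2 * r₁ - r₀) + (r₁ - r₀) = r₁ by omega] at hc
    simp only [hc]
    rw [Finset.mul_sum, Finset.mul_sum, Finset.sum_mul, Nat.cast_sum, Finset.sum_mul]
    have key : ∀ l ∈ Finset.range (min r₀ (2 * r₁ - r₀) + 1), termSet.indicator
        (fun x => (exponentTerm p x.1 x.2 : ℂ) *
          T ^ (x.1.1 + 9 * x.1.2.1 + 5 * x.1.2.2)) ((r₀, r₁, d), l) =
        (exponentTerm p (r₀, r₁, d) l : ℂ) * T ^ (r₀ + 9 * r₁ + 5 * d) := fun l hl =>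
      Set.indicator_of_mem (s := termSet)
        ⟨h, by have := Finset.mem_range.1 hl; simp only; omega⟩ _
    have := hasSum_sum_of_ne_finset_zero (s := Finset.range (min r₀ (2 * r₁ - r₀) + 1))
      (f := fun l => termSet.indicator (fun x => (exponentTerm p x.1 x.2 : ℂ) *
        T ^ (x.1.1 + 9 * x.1.2.1 + 5 * x.1.2.2)) ((r₀, r₁, d), l)) (L := .unconditional ℕ)
      (fun l hl => Set.indicator_of_notMem
        (fun hx => hl (Finset.mem_range.2 (Nat.lt_succ_of_le hx.2))) _)
    rwa [Finset.sum_congr rfl key] at this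
  · have hE : IsEmpty (FrameFiber p (r₀, r₁, d)) := isEmpty_frameFiber h
    simp only [Nat.card_of_isEmpty, mul_zero, zero_mul, Nat.cast_zero]
    convert! hasSum_zero with l
    exact Set.indicator_of_notMem (fun hx => h hx.1) _

/-- Fibring the absolutely convergent sum first over l and then over the index exponent r₀ + 9r₁ +
5d recovers the coefficients. -/
theorem hasSum_proIsoCount {p : ℕ} (hp : p.Prime) (T : ℂ) {a b : ℂ}
    (h1 : HasSum (fun y : ℕ × ((ℕ × ℕ) × ℕ) =>
      (exponentTerm p (2 * y.2.2 + (y.2.1.1 + y.1), y.2.2 + (y.2.1.1 + y.1), y.2.1.2) y.2.1.1 : ℂ) *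
      T ^ (11 * y.2.2 + 10 * (y.2.1.1 + y.1) + 5 * y.2.1.2)) a)
    (h2 : HasSum (fun y : ℕ × ((ℕ × ℕ) × ℕ) =>
      (exponentTerm p (y.2.1.1 + y.1, y.2.1.1 + y.1 + (y.2.2 + 1), y.2.1.2) y.2.1.1 : ℂ) *
      T ^ (10 * (y.2.1.1 + y.1) + 9 * (y.2.2 + 1) + 5 * y.2.1.2)) b) :
    HasSum (fun k => (proIsoCount DStarCube (p ^ k) : ℂ) * T ^ k) (a + b) := by
  set f : (ℕ × ℕ × ℕ) × ℕ → ℂ := termSet.indicator (fun x => (exponentTerm p x.1 x.2 : ℂ) *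
      T ^ (x.1.1 + 9 * x.1.2.1 + 5 * x.1.2.2)) with hf
  have hmem : ∀ x, termParam x ∈ termSet := fun x => range_termParam ▸ ⟨x, rfl⟩
  have hsum : HasSum f (a + b) := by
    refine (termParam_injective.hasSum_iff fun x hx => ?_).1 (HasSum.sum ?_ ?_)
    · rw [range_termParam] at hx
      exact Set.indicator_of_notMem hx _
    · convert! h1 with y
      rw [Function.comp, Function.comp, hf, Set.indicator_of_mem (hmem _)]
      simp only [termParam, Sum.elim_inl]
      ring_nf
    · convert! h2 with y
      rw [Function.comp, Function.comp, hf, Set.indicator_of_mem (hmem _)]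
      simp only [termParam, Sum.elim_inr]
      ring_nf
  have hsum2 := hsum.prod_fiberwise (hasSum_term hp T)
  have hsum3 := hsum2.group_by_degree (fun t => t.1 + 9 * t.2.1 + 5 * t.2.2) exponentSet
    (fun k t ht => (mem_exponentSet.1 ht).2) (fun t ht => by
      have := isEmpty_frameFiber (p := p) (r₀ := t.1) (r₁ := t.2.1) (d := t.2.2)
        (fun h => ht (mem_exponentSet.2 ⟨h, rfl⟩))
      simp)
  convert! hsum3 with k
  rw [proIsoCount_eq_sum hp (finite_frameFiber hp), Nat.cast_sum, Finset.sum_mul]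
  refine Finset.sum_congr rfl fun t ht => ?_
  rw [(mem_exponentSet.1 ht).2]

theorem hasSum_totient_pow {p : ℕ} (hp : p.Prime) {z : ℂ} (h : ‖(p : ℂ) * z‖ < 1) :
    HasSum (fun m : ℕ => (Nat.totient (p ^ m) : ℂ) * z ^ m) ((1 - z) * (1 - p * z)⁻¹) := by
  have h1 : (1 : ℂ) - p * z ≠ 0 := fun h0 => by
    rw [← sub_eq_zero.1 h0, norm_one] at h
    exact lt_irrefl _ h
  have hs : HasSum (fun m : ℕ => (Nat.totient (p ^ (m + 1)) : ℂ) * z ^ (m + 1))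
      ((p - 1) * z * (1 - p * z)⁻¹) := by
    convert! (hasSum_geom h).mul_left (((p : ℂ) - 1) * z) using 2 with m
    rw [Nat.totient_prime_pow_succ hp, Nat.cast_mul, Nat.cast_sub hp.one_le, mul_pow]
    push_cast
    ring
  have := (hasSum_nat_add_iff (f := fun m : ℕ => (Nat.totient (p ^ m) : ℂ) * z ^ m) 1).1 hs
  convert! this using 1
  simp
  linear_combination mul_inv_cancel₀ h1

/-- The kernel sum with the number of sublattices of the plane taken into account. -/
noncomputable def planeSum (X q y w : ℂ) : ℂ :=
  (1 + q) * kernelSum X q y (y ^ 2) w - q * kernelSum X q 0 (y ^ 2) w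

/-- The projective line over ℤ/p^d has (1 + q)p^d - q·0^d points, where q = 1/p and 0^d corrects d =
0. So two kernels are combined, the second at u = 0. -/
theorem hasSum_plane {X q y w : ℂ} (hX : X * q = 1) (hy : ‖y‖ < 1) (hq : ‖q‖ ≤ 1) (hw : ‖w‖ < 1)
    (hU : ‖y ^ 2 * w * X‖ < 1) :
    HasSum (fun x : (ℕ × ℕ) × ℕ => ((1 + q) * y ^ x.1.2 - q * 0 ^ x.1.2) * (y ^ 2) ^ x.1.1 *
      (w * X) ^ x.2 * q ^ ((x.1.1 + 2 * x.2 - x.1.2 + 1) / 2)) (planeSum X q y w) := by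
  have hpow : ∀ n, n ≠ 0 → ‖y ^ n‖ < 1 := fun n hn => by
    rw [norm_pow]
    exact pow_lt_one₀ (norm_nonneg _) hy hn
  have hv : ‖(y ^ 2) ^ 2 * q‖ < 1 := by
    rw [← pow_mul, norm_mul]
    exact (mul_le_of_le_one_right (norm_nonneg _) hq).trans_lt (hpow 4 (by norm_num))
  have h1 := hasSum_kernel (u := y) (v := y ^ 2) (w := w) hX (hpow 2 two_ne_zero) hw
    (by rw [← pow_succ']; exact hpow 3 (by norm_num)) hv hU
  have h0 := hasSum_kernel (u := 0) (v := y ^ 2) (w := w) hX (by simp) hw (by simp) hv (by simp)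
  refine ((h1.mul_left (1 + q)).sub (h0.mul_left q)).congr_fun ?_
  intro x
  ring

theorem hasSum_plane_zero {X q y : ℂ} (hX : X * q = 1) (hy : ‖y‖ < 1) (hq : ‖q‖ ≤ 1) :
    HasSum (fun x : ℕ × ℕ => ((1 + q) * y ^ x.2 - q * 0 ^ x.2) * (y ^ 2) ^ x.1 *
      q ^ ((x.1 - x.2 + 1) / 2)) (planeSum X q y 0) := by
  have h := hasSum_plane hX hy hq (w := 0) (by simp) (by simp)
  have hinj : Function.Injective (fun x : ℕ × ℕ => (x, 0) : ℕ × ℕ → (ℕ × ℕ) × ℕ) :=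
    fun _ _ h => congrArg Prod.fst h
  convert! (hinj.hasSum_iff ?_).2 h using 1
  · ext x
    simp
  · rintro ⟨x, μ⟩ hx
    have : μ ≠ 0 := fun h0 => hx ⟨x, by rw [h0]⟩
    simp [this]

/-- As μ or j vanishes, the truncated differences simplify. Apart from the ceiling and the
correction at d = 0, every factor is a totient or a power of one index. -/
theorem exponentTerm_mul {p : ℕ} {q T : ℂ} (hq : (p : ℂ) * q = 1) {μ j : ℕ}
    (h0 : μ = 0 ∨ j = 0) (m l d : ℕ) :
    (exponentTerm p (2 * μ + (l + m), μ + (l + m) + j, d) l : ℂ) *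
      T ^ (11 * μ + 10 * (l + m) + 9 * j + 5 * d) =
    Nat.totient (p ^ m) * (p ^ 29 * T ^ 10) ^ m *
      (((1 + q) * (p ^ 15 * T ^ 5) ^ d - q * 0 ^ d) * ((p ^ 15 * T ^ 5) ^ 2) ^ l *
      (p ^ 30 * T ^ 11 * p) ^ μ * q ^ ((l + 2 * μ - d + 1) / 2)) * (p ^ 29 * T ^ 9) ^ j := by
  have hcard : ((rotSet p d).card : ℂ) * ((p : ℂ) ^ (14 * d) * T ^ (5 * d)) =
      (1 + q) * (p ^ 15 * T ^ 5) ^ d - q * 0 ^ d := by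
    rw [card_rotSet]
    rcases d with _ | d
    · simp
    · rw [if_neg (Nat.succ_ne_zero d), Nat.add_sub_cancel, zero_pow (Nat.succ_ne_zero d)]
      push_cast
      have e : (p : ℂ) ^ d = p ^ (d + 1) * q := by rw [pow_succ, mul_assoc, hq, mul_one]
      rw [e]
      ring
  have hsub : ∀ {a b : ℕ}, b ≤ a → (p : ℂ) ^ (a - b) = p ^ a * q ^ b := fun {a b} h => by
    obtain ⟨c, rfl⟩ := Nat.exists_eq_add_of_le h
    rw [Nat.add_sub_cancel_left, pow_add, mul_right_comm, ← mul_pow, hq, one_pow, one_mul]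
  rw [← hcard, exponentTerm]
  simp only
  rw [show μ + (l + m) + j - (2 * μ + (l + m)) = j by omega,
    show 2 * μ + (l + m) - (μ + (l + m) + j) = μ by omega,
    show min (2 * μ + (l + m)) (2 * (μ + (l + m) + j) - (2 * μ + (l + m))) = l + m by omega,
    Nat.add_sub_cancel_left]
  push_cast
  rw [hsub (by omega)]
  ring

/-! ### The closed form and its functional equation. -/

theorem one_sub_ne_zero {z : ℂ} (h : ‖z‖ < 1) : 1 - z ≠ 0 := fun h0 => by
  rw [← sub_eq_zero.1 h0, norm_one] at h
  exact lt_irrefl _ h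

/-- The two terms are the blocks j = 0 and j ≥ 1. In their sum the factors 1 - y², 1 - y³ and 1 -
y⁴q of the denominators cancel. -/
theorem planeSum_add {X q y w V : ℂ} (hX : X * q = 1) (hV : V * w = y ^ 4 * q) (hw0 : w ≠ 0)
    (h1 : 1 - y ≠ 0) (h2 : 1 - y ^ 2 ≠ 0) (h3 : 1 - y ^ 3 ≠ 0) (h4 : 1 - y ^ 4 * q ≠ 0)
    (hw : 1 - w ≠ 0) (hU : 1 - y ^ 2 * w * X ≠ 0) (hV1 : 1 - V ≠ 0) :
    planeSum X q y w + planeSum X q y 0 * (V * (1 - V)⁻¹) =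
      (1 + y * q + y ^ 2 * q + y ^ 3 - w * y ^ 2 * q - w * y ^ 3 - w * y ^ 4 - w * y ^ 5 * q) /
        ((1 - y) * (1 - V) * (1 - w) * (1 - y ^ 2 * w * X)) := by
  have hk : ∀ u w, kernelSum X q u (y ^ 2) w = (1 - u * y ^ 2)⁻¹ * (y ^ 2 * q * (1 + y ^ 2) *
      (1 - y ^ 4 * q)⁻¹ * (1 - w)⁻¹ + (1 + u) * (1 - u ^ 2 * w * X)⁻¹ *
        (w * (1 - w)⁻¹ + (1 - u ^ 2)⁻¹)) := fun u w => by rw [kernelSum]; ring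
  have h33 : 1 - y * y ^ 2 = 1 - y ^ 3 := by ring
  -- V enters only through Vw = y⁴q. After multiplication by w(1 - V) the claim reduces to this
  -- identity without V.
  have hR : w * (planeSum X q y w - (1 + y * q + y ^ 2 * q + y ^ 3 - w * y ^ 2 * q - w * y ^ 3 -
      w * y ^ 4 - w * y ^ 5 * q) / ((1 - y) * (1 - w) * (1 - y ^ 2 * w * X))) =
      y ^ 4 * q * (planeSum X q y w - planeSum X q y 0) := by
    simp only [planeSum, hk, h33]
    simp only [zero_mul, mul_zero, sub_zero, inv_one, mul_one, one_mul, add_zero, zero_add, ne_eq,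
      OfNat.ofNat_ne_zero, not_false_eq_true, zero_pow]
    have hq : q ≠ 0 := right_ne_zero_of_mul_eq_one hX
    obtain rfl : X = q⁻¹ := eq_inv_of_mul_eq_one_left hX
    have hU' : q - y ^ 2 * w ≠ 0 := fun h => hU (by
      rw [← sub_eq_zero.1 h, mul_inv_cancel₀ hq, sub_self])
    have e : 1 - y ^ 2 * w * q⁻¹ = (q - y ^ 2 * w) / q := by field_simp
    rw [e]
    generalize hD1 : 1 - y = D1 at *
    generalize hD2 : 1 - y ^ 2 = D2 at *
    generalize hD3 : 1 - y ^ 3 = D3 at *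
    generalize hD4 : 1 - y ^ 4 * q = D4 at *
    generalize hDw : 1 - w = Dw at *
    generalize hDU : q - y ^ 2 * w = DU at *
    field_simp
    subst hD1 hD2 hD3 hD4 hDw hDU
    ring
  refine mul_left_cancel₀ (mul_ne_zero hw0 hV1) ?_
  have e1 : w * (1 - V) * (planeSum X q y w + planeSum X q y 0 * (V * (1 - V)⁻¹)) =
      w * (1 - V) * planeSum X q y w + w * V * planeSum X q y 0 := by
    field_simp
  have e2 : ∀ N : ℂ, w * (1 - V) * (N / ((1 - y) * (1 - V) * (1 - w) * (1 - y ^ 2 * w * X))) =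
      w * (N / ((1 - y) * (1 - w) * (1 - y ^ 2 * w * X))) := fun N => by
    field_simp
  rw [e1, e2]
  linear_combination hR + (planeSum X q y 0 - planeSum X q y w) * hV

theorem norm_pow_mul_cpow_lt_one {p : ℕ} (hp : p.Prime) {s : ℂ} (a b : ℕ) (h : a < b * s.re) :
    ‖(p : ℂ) ^ a * ((p : ℂ) ^ (-s)) ^ b‖ < 1 := by
  have hp1 : (1 : ℝ) < p := by exact_mod_cast hp.one_lt
  rw [norm_mul, norm_pow, norm_pow, Complex.norm_natCast, Complex.norm_natCast_cpow_of_pos hp.pos,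
    ← Real.rpow_natCast, ← Real.rpow_natCast, ← Real.rpow_mul (by positivity),
    ← Real.rpow_add (by positivity), Complex.neg_re]
  exact Real.rpow_lt_one_of_one_lt_of_neg hp1 (by linarith)

/-- Here y = p¹⁵T⁵, w = p³⁰T¹¹, V = p²⁹T⁹, and the totient sum supplies (1 - p²⁹T¹⁰)/(1 - p³⁰T¹⁰).
Among the ratios a/b of the monomials p^a T^b involved, that of V is the largest, whence the bound
29/9. -/
theorem hasSum_zetaCube_of_norm {p : ℕ} (hp : p.Prime) {T : ℂ} (hT0 : T ≠ 0)
    (hlt : ∀ a b : ℕ, (a : ℝ) ≤ b * (29 / 9) → 0 < b → ‖(p : ℂ) ^ a * T ^ b‖ < 1) :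
    HasSum (fun k : ℕ => (proIsoCount DStarCube (p ^ k) : ℂ) * T ^ k) (zetaCube p T) := by
  have hp0 : (p : ℂ) ≠ 0 := by exact_mod_cast hp.ne_zero
  obtain ⟨q, hq⟩ : ∃ q : ℂ, (p : ℂ) * q = 1 := ⟨_, mul_inv_cancel₀ hp0⟩
  have hq1 : ‖q‖ ≤ 1 := by
    rw [eq_inv_of_mul_eq_one_right hq, norm_inv, Complex.norm_natCast]
    exact inv_le_one_of_one_le₀ (by exact_mod_cast hp.one_le)
  have hy := hlt 15 5 (by norm_num) (by norm_num)
  have hw := hlt 30 11 (by norm_num) (by norm_num)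
  have hV := hlt 29 9 (by norm_num) (by norm_num)
  have hy2 := hlt 30 10 (by norm_num) (by norm_num)
  have hy3 := hlt 45 15 (by norm_num) (by norm_num)
  have hy4 := hlt 59 20 (by norm_num) (by norm_num)
  have hU := hlt 61 21 (by norm_num) (by norm_num)
  have eU : (p : ℂ) ^ 61 * T ^ 21 = (p ^ 15 * T ^ 5) ^ 2 * (p ^ 30 * T ^ 11) * p := by ring
  have ey2 : (p : ℂ) ^ 30 * T ^ 10 = (p ^ 15 * T ^ 5) ^ 2 := by ring
  have ey3 : (p : ℂ) ^ 45 * T ^ 15 = (p ^ 15 * T ^ 5) ^ 3 := by ring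
  have ey4 : (p : ℂ) ^ 59 * T ^ 20 = (p ^ 15 * T ^ 5) ^ 4 * q := by
    linear_combination -((p : ℂ) ^ 59 * T ^ 20) * hq
  have ez : (p : ℂ) * (p ^ 29 * T ^ 10) = p ^ 30 * T ^ 10 := by ring
  have hP := hasSum_totient_pow hp (z := (p : ℂ) ^ 29 * T ^ 10) (by rw [ez]; exact hy2)
  have h1 := hP.mul_prod (hasSum_plane hq hy hq1 hw (by rw [← eU]; exact hU))
  have hgeom := (hasSum_geom hV).mul_left ((p : ℂ) ^ 29 * T ^ 9)
  have h2 := hP.mul_prod ((hasSum_plane_zero hq hy hq1).mul_prod hgeom)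
  have key := hasSum_proIsoCount hp T
    (a := (1 - p ^ 29 * T ^ 10) * (1 - p * (p ^ 29 * T ^ 10))⁻¹ *
      planeSum p q (p ^ 15 * T ^ 5) (p ^ 30 * T ^ 11))
    (b := (1 - p ^ 29 * T ^ 10) * (1 - p * (p ^ 29 * T ^ 10))⁻¹ *
      (planeSum p q (p ^ 15 * T ^ 5) 0 * (p ^ 29 * T ^ 9 * (1 - p ^ 29 * T ^ 9)⁻¹)))
    (by
      convert! h1 using 2 with x
      have e := exponentTerm_mul (T := T) hq (μ := x.2.2) (j := 0) (Or.inr rfl) x.1 x.2.1.1 x.2.1.2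
      rw [add_zero, mul_zero, add_zero, pow_zero, mul_one] at e
      exact e)
    (by
      convert! h2 using 2 with x
      have e := exponentTerm_mul (T := T) hq (μ := 0) (j := x.2.2 + 1) (Or.inl rfl) x.1 x.2.1.1
        x.2.1.2
      simp only [mul_zero, zero_add, add_zero, pow_zero, mul_one] at e
      rw [e]
      ring)
  convert! key using 1
  have hadd := planeSum_add hq (y := (p : ℂ) ^ 15 * T ^ 5) (w := p ^ 30 * T ^ 11)
    (V := p ^ 29 * T ^ 9) (by linear_combination (-(p : ℂ) ^ 59 * T ^ 20) * hq)
    (mul_ne_zero (pow_ne_zero _ hp0) (pow_ne_zero _ hT0)) (one_sub_ne_zero hy)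
    (ey2 ▸ one_sub_ne_zero hy2) (ey3 ▸ one_sub_ne_zero hy3) (ey4 ▸ one_sub_ne_zero hy4)
    (one_sub_ne_zero hw) (eU ▸ one_sub_ne_zero hU) (one_sub_ne_zero hV)
  rw [ez, ← mul_add, hadd, ← eU, zetaCube, ← div_eq_mul_inv, div_mul_div_comm]
  congr 1
  · congr 1
    linear_combination (-(p : ℂ) ^ 14 * T ^ 5 - p ^ 29 * T ^ 10 + p ^ 59 * T ^ 21 +
      p ^ 104 * T ^ 36) * hq
  · ring

theorem hasSum_zetaCube {p : ℕ} (hp : p.Prime) {s : ℂ} (hs : 29 / 9 < s.re) :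
    HasSum (fun k : ℕ => (proIsoCount DStarCube (p ^ k) : ℂ) * ((p : ℂ) ^ (-s)) ^ k)
      (zetaCube p ((p : ℂ) ^ (-s))) := by
  refine hasSum_zetaCube_of_norm hp ?_ fun a b h hb => norm_pow_mul_cpow_lt_one hp a b
    (h.trans_lt (mul_lt_mul_of_pos_left hs (by exact_mod_cast hb)))
  rw [Complex.cpow_def_of_ne_zero (by exact_mod_cast hp.ne_zero)]
  exact Complex.exp_ne_zero _

/-- Each factor 1 - x^a t^b is multiplied by -x^(-a) t^(-b), and the long numerator is
antipalindromic with top monomial x¹⁰⁴t³⁶. The factor is the quotient of these monomials, its sign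
coming from five denominator factors against two numerator factors. -/
theorem zetaCube_inv {x t : ℂ} (hx : x ≠ 0) (ht : t ≠ 0) :
    zetaCube x⁻¹ t⁻¹ = -(x ^ 32 * t ^ 10) * zetaCube x t := by
  have h : ∀ a b : ℕ, 1 - x⁻¹ ^ a * t⁻¹ ^ b = -(x ^ a * t ^ b)⁻¹ * (1 - x ^ a * t ^ b) := by
    intro a b
    have : x ^ a * t ^ b ≠ 0 := mul_ne_zero (pow_ne_zero _ hx) (pow_ne_zero _ ht)
    rw [inv_pow, inv_pow, ← mul_inv]
    linear_combination -inv_mul_cancel₀ this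
  have hN : -(x⁻¹ ^ 104 * t⁻¹ ^ 36) - x⁻¹ ^ 90 * t⁻¹ ^ 31 - x⁻¹ ^ 75 * t⁻¹ ^ 26 -
      x⁻¹ ^ 59 * t⁻¹ ^ 21 + x⁻¹ ^ 45 * t⁻¹ ^ 15 + x⁻¹ ^ 29 * t⁻¹ ^ 10 + x⁻¹ ^ 14 * t⁻¹ ^ 5 + 1 =
      -(x ^ 104 * t ^ 36)⁻¹ * (-(x ^ 104 * t ^ 36) - x ^ 90 * t ^ 31 - x ^ 75 * t ^ 26 -
        x ^ 59 * t ^ 21 + x ^ 45 * t ^ 15 + x ^ 29 * t ^ 10 + x ^ 14 * t ^ 5 + 1) := by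
    field_simp
    ring
  rw [zetaCube, zetaCube, hN]
  simp only [h]
  rw [show ∀ a b c d : ℂ, a * b * (c * d) = a * c * (b * d) from fun a b c d => by ring,
    show ∀ a₁ a₂ a₃ a₄ a₅ b₁ b₂ b₃ b₄ b₅ : ℂ, a₁ * b₁ * (a₂ * b₂) * (a₃ * b₃) * (a₄ * b₄) *
      (a₅ * b₅) = a₁ * a₂ * a₃ * a₄ * a₅ * (b₁ * b₂ * b₃ * b₄ * b₅) from
      fun a₁ a₂ a₃ a₄ a₅ b₁ b₂ b₃ b₄ b₅ => by ring, mul_div_mul_comm]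
  congr 1
  field_simp

/-- The local pro-isomorphic zeta function of `D*_{x^3}` at every prime `p > 2` is the value of one
rational function at `(p, p ^ (-s))`, and this rational function satisfies a functional equation
under the inversion of `p`. -/
theorem mainTheorem2 :
    (∀ p : ℕ, p.Prime → 2 < p → ∀ s : ℂ, 29 / 9 < s.re →
      HasSum (fun k : ℕ => (proIsoCount DStarCube (p ^ k) : ℂ) * (p : ℂ) ^ (-((k : ℂ) * s)))
        (zetaCube (p : ℂ) ((p : ℂ) ^ (-s)))) ∧
    (∀ x t : ℂ, x ≠ 0 → t ≠ 0 →
      zetaCube x⁻¹ t⁻¹ = -(x ^ 32 * t ^ 10) * zetaCube x t) := by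

  refine ⟨fun p hp _ s hs => ?_, fun x t hx ht => zetaCube_inv hx ht⟩
  refine (hasSum_zetaCube hp hs).congr_fun fun k => ?_
  rw [← Complex.cpow_nat_mul]
  ring_nf
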